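/- Let $\mathcal V$ be a symmetric monoidal closed category whose underlying ordinary category is locally small, complete and cocomplete. "Category", "functor" and "colimit" mean $\mathcal V$-category, $\mathcal V$-functor and weighted colimit; a category is small when its isomorphism classes of objects form a small set. $\mathcal V\text{-}\mathbf{Mod}$ is the bicategory whose objects are the small categories, whose 1-cells $\mathcal A\nrightarrow \mathcal B$ are the modules, that is, the functors $\mathcal B^{op}\otimes\mathcal A\to\mathcal V$, with composite $(gf)(c,a)=\int^{b} g(c,b)\otimes f(b,a)$, and whose 2-cells are the natural transformations. Let $\mathcal I$ be the unit category (one object, with hom-object the unit of $\mathcal V$). For $\mathcal B$ small, write $\overline\phi:\mathcal I\nrightarrow \mathcal B$ for the module given by a functor $\phi:\mathcal B^{op}\to\mathcal V$, and $\underline\psi:\mathcal B\nrightarrow \mathcal I$ for the module given by a functor $\psi:\mathcal B\to\mathcal V$. Let $[\mathcal B^{op},\mathcal V]$ be the functor $\mathcal V$-category, $Y:\mathcal B\to[\mathcal B^{op},\mathcal V]$ the Yoneda embedding, and $\{\phi,-\}=[\mathcal B^{op},\mathcal V](\phi,-):[\mathcal B^{op},\mathcal V]\to\mathcal V$ the representable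 functor. For $\theta:\mathcal K^{op}\to\mathcal V$ with $\mathcal K$ small and $S:\mathcal K\to\mathcal A$, the colimit $\theta*S$ is an object of $\mathcal A$ with a natural transformation $\theta\to\mathcal A(S-,\theta*S)$ inducing isomorphisms $\mathcal A(\theta*S,a)\cong[\mathcal K^{op},\mathcal V](\theta,\mathcal A(S-,a))$ for all $a$; a functor preserves it when the image of this datum is again a colimit, and is cocontinuous when it preserves all such colimits with $\mathcal K$ small. Proposition. Let $\mathcal B$ be small. For a weight $\phi:\mathcal B^{op}\to\mathcal V$ the following conditions are equivalent: (i) $\overline\phi$ has a right adjoint $\underline\psi$ in $\mathcal V\text{-}\mathbf{Mod}$; (ii) the representable functor $\{\phi,-\}:[\mathcal B^{op},\mathcal V]\to\mathcal V$ is cocontinuous (that is, $\phi$ is a small projective); (iii) $\{\phi,-\}:[\mathcal B^{op},\mathcal V]\to\mathcal V$ preserves the colimit $\phi*Y$. When these are satisfied, a right adjoint of $\overline\phi$ is given by $\underline\psi$ with $\psi=[\mathcal B^{op},\mathcal V](\phi,Y-):\mathcal B\to\mathcal V$. -/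

import Mathlib

open CategoryTheory Limits
open scoped MonoidalCategory MonoidalClosed

universe v u w w' w₁ w₂ w₃ w₄ w₅

noncomputable section

namespace EnrichedModules

section Functors

variable {V : Type u} [Category.{v} V] [MonoidalCategory V] 
variable {A : Type w} [EnrichedCategory V A] {K : Type w₁} [EnrichedCategory V K]

/-- The `V`-functor `Sᵒᵖ : Kᵒᵖ ⥤ Aᵒᵖ` opposite to a `V`-functor `S : K ⥤ A`. -/
def opFunctor [SymmetricCategory V] (S : EnrichedFunctor V K A) : EnrichedFunctor V Kᵒᵖ Aᵒᵖ where
  obj x := Opposite.op (S.obj x.unop)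
  map x y := S.map y.unop x.unop
  map_id x := S.map_id x.unop
  map_comp x y z := by
    rw [tensorHom_eComp_op_eq, eComp_op_eq, Category.assoc, S.map_comp]
    rfl

variable [MonoidalClosed V]

lemma tensorHom_compTranspose {X Y Z P Q : V} (f : P ⟶ (ihom X).obj Y) (g : Q ⟶ (ihom Y).obj Z) :
    X ◁ (f ⊗ₘ g) ≫ MonoidalClosed.compTranspose X Y Z =
      (α_ _ _ _).inv ≫ MonoidalClosed.uncurry f ▷ Q ≫ MonoidalClosed.uncurry g := by
  rw [MonoidalClosed.compTranspose_eq, MonoidalClosed.uncurry_eq, MonoidalClosed.uncurry_eq,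
    MonoidalCategory.tensorHom_def, MonoidalCategory.whiskerLeft_comp]
  simp only [MonoidalCategory.comp_whiskerRight, Category.assoc]
  rw [MonoidalCategory.associator_inv_naturality_right_assoc,
    MonoidalCategory.whisker_exchange_assoc,
    MonoidalCategory.associator_inv_naturality_middle_assoc]
  rfl

/-- The action `F X ⊗ A(X,Y) ⟶ F Y` of a `V`-functor `F : A ⥤ V`, the transpose of
`A(X,Y) ⟶ [F X, F Y]`. -/
def act (F : EnrichedFunctor V A V) (X Y : A) : F.obj X ⊗ (X ⟶[V] Y) ⟶ F.obj Y :=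
  MonoidalClosed.uncurry (F.map X Y)

lemma act_id (F : EnrichedFunctor V A V) (X : A) :
    F.obj X ◁ eId V X ≫ act F X X = (ρ_ (F.obj X)).hom := by
  rw [act, ← MonoidalClosed.uncurry_natural_left, F.map_id,
    MonoidalClosed.enrichedCategorySelf_id, MonoidalClosed.id_eq, MonoidalClosed.uncurry_curry]

lemma act_comp (F : EnrichedFunctor V A V) (X Y Z : A) :
    F.obj X ◁ eComp V X Y Z ≫ act F X Z =
      (α_ _ _ _).inv ≫ act F X Y ▷ (Y ⟶[V] Z) ≫ act F Y Z := by
  simp only [act]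
  rw [← MonoidalClosed.uncurry_natural_left, F.map_comp, MonoidalClosed.uncurry_natural_left,
    MonoidalClosed.enrichedCategorySelf_comp, MonoidalClosed.comp_eq,
    MonoidalClosed.uncurry_curry]
  exact tensorHom_compTranspose _ _

/-- The `V`-functor `A ⥤ V` with a given action `F X ⊗ A(X,Y) ⟶ F Y`. -/
def ofAct (obj : A → V) (a : ∀ X Y, obj X ⊗ (X ⟶[V] Y) ⟶ obj Y)
    (a_id : ∀ X, obj X ◁ eId V X ≫ a X X = (ρ_ (obj X)).hom)
    (a_comp : ∀ X Y Z, obj X ◁ eComp V X Y Z ≫ a X Z =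
      (α_ _ _ _).inv ≫ a X Y ▷ (Y ⟶[V] Z) ≫ a Y Z) : EnrichedFunctor V A V where
  obj := obj
  map X Y := MonoidalClosed.curry (a X Y)
  map_id X := by
    apply MonoidalClosed.uncurry_injective
    rw [MonoidalClosed.uncurry_natural_left, MonoidalClosed.uncurry_curry, a_id,
      MonoidalClosed.enrichedCategorySelf_id, MonoidalClosed.id_eq, MonoidalClosed.uncurry_curry]
  map_comp X Y Z := by
    apply MonoidalClosed.uncurry_injective
    rw [MonoidalClosed.uncurry_natural_left, MonoidalClosed.uncurry_natural_left,
      MonoidalClosed.uncurry_curry, a_comp, MonoidalClosed.enrichedCategorySelf_comp,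
      MonoidalClosed.comp_eq, MonoidalClosed.uncurry_curry]
    refine Eq.trans ?_ (tensorHom_compTranspose _ _).symm
    rw [MonoidalClosed.uncurry_curry, MonoidalClosed.uncurry_curry]

lemma act_ofAct (obj : A → V) (a : ∀ X Y, obj X ⊗ (X ⟶[V] Y) ⟶ obj Y) (a_id) (a_comp) (X Y : A) :
    act (ofAct obj a a_id a_comp) X Y = a X Y :=
  MonoidalClosed.uncurry_curry _

/-- The covariant representable `V`-functor `A(X,-) : A ⥤ V`. -/
def homFrom (X : A) : EnrichedFunctor V A V :=
  ofAct (fun Y => X ⟶[V] Y) (fun Y Z => eComp V X Y Z)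
    (fun Y => by rw [← cancel_epi (ρ_ _).inv, e_comp_id, Iso.inv_hom_id])
    (fun Y Z W => (e_assoc V X Y Z W).symm)

/-- The contravariant representable `V`-functor `A(-,X) : Aᵒᵖ ⥤ V`. -/
def homTo [SymmetricCategory V] (X : A) : EnrichedFunctor V Aᵒᵖ V :=
  homFrom (Opposite.op X)

end Functors

section Modules

variable (V : Type u) [Category.{v} V] [MonoidalCategory V]

/-- A module `A ⇸ B`: a `V`-functor `Bᵒᵖ ⊗ A ⥤ V`, given by its values `M(b,a)` and by the
commuting, associative and unital actions `B(b,b') ⊗ M(b',a) ⟶ M(b,a)` and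
`M(b,a) ⊗ A(a,a') ⟶ M(b,a')`. -/
structure VModule (A : Type w₁) [EnrichedCategory V A] (B : Type w₂) [EnrichedCategory V B] where
  /-- the object `M(b,a)` of `V` -/
  obj : B → A → V
  /-- the action of `B`, contravariant in the first variable -/
  lact (b b' : B) (a : A) : (b ⟶[V] b') ⊗ obj b' a ⟶ obj b a
  /-- the action of `A`, covariant in the second variable -/
  ract (b : B) (a a' : A) : obj b a ⊗ (a ⟶[V] a') ⟶ obj b a'
  id_lact (b : B) (a : A) : eId V b ▷ obj b a ≫ lact b b a = (λ_ (obj b a)).hom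
  comp_lact (b b' b'' : B) (a : A) :
    eComp V b b' b'' ▷ obj b'' a ≫ lact b b'' a =
      (α_ _ _ _).hom ≫ (b ⟶[V] b') ◁ lact b' b'' a ≫ lact b b' a
  ract_id (b : B) (a : A) : obj b a ◁ eId V a ≫ ract b a a = (ρ_ (obj b a)).hom
  ract_comp (b : B) (a a' a'' : A) :
    obj b a ◁ eComp V a a' a'' ≫ ract b a a'' =
      (α_ _ _ _).inv ≫ ract b a a' ▷ (a' ⟶[V] a'') ≫ ract b a' a''
  lact_ract (b b' : B) (a a' : A) :
    lact b b' a ▷ (a ⟶[V] a') ≫ ract b a a' =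
      (α_ _ _ _).hom ≫ (b ⟶[V] b') ◁ ract b' a a' ≫ lact b b' a'

variable {V}
variable {A : Type w₁} [EnrichedCategory V A] {B : Type w₂} [EnrichedCategory V B]

namespace VModule

/-- A 2-cell between modules: a `V`-natural transformation, that is, a family of morphisms of `V`
compatible with the two actions. -/
@[ext]
structure Hom (M N : VModule V A B) where
  /-- the component `M(b,a) ⟶ N(b,a)` -/
  app (b : B) (a : A) : M.obj b a ⟶ N.obj b a
  lact_app (b b' : B) (a : A) :
    M.lact b b' a ≫ app b a = (b ⟶[V] b') ◁ app b' a ≫ N.lact b b' a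
  ract_app (b : B) (a a' : A) :
    M.ract b a a' ≫ app b a' = app b a ▷ (a ⟶[V] a') ≫ N.ract b a a'

instance : Category (VModule V A B) where
  Hom M N := Hom M N
  id M := { app := fun b a => 𝟙 (M.obj b a), lact_app := by simp, ract_app := by simp }
  comp f g :=
    { app := fun b a => f.app b a ≫ g.app b a
      lact_app := fun b b' a => by
        rw [← Category.assoc, f.lact_app, Category.assoc, g.lact_app,
          MonoidalCategory.whiskerLeft_comp, Category.assoc]
      ract_app := fun b a a' => by
        rw [← Category.assoc, f.ract_app, Category.assoc, g.ract_app,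
          MonoidalCategory.comp_whiskerRight, Category.assoc] }
  id_comp f := by apply Hom.ext; funext b a; exact Category.id_comp _
  comp_id f := by apply Hom.ext; funext b a; exact Category.comp_id _
  assoc f g h := by apply Hom.ext; funext b a; exact Category.assoc _ _ _

lemma hom_ext {M N : VModule V A B} {f g : M ⟶ N} (h : ∀ b a, f.app b a = g.app b a) : f = g :=
  Hom.ext (by funext b a; exact h b a)

@[simp]
lemma id_app (M : VModule V A B) (b : B) (a : A) : Hom.app (𝟙 M) b a = 𝟙 (M.obj b a) := rfl

@[simp]
lemma comp_app {M N P : VModule V A B} (f : M ⟶ N) (g : N ⟶ P) (b : B) (a : A) :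
    Hom.app (f ≫ g) b a = f.app b a ≫ g.app b a := rfl

/-- A 2-cell with invertible components is invertible. -/
@[simps]
def isoMk {M N : VModule V A B} (f : M ⟶ N) (e : ∀ b a, N.obj b a ⟶ M.obj b a)
    (h₁ : ∀ b a, f.app b a ≫ e b a = 𝟙 _) (h₂ : ∀ b a, e b a ≫ f.app b a = 𝟙 _) : M ≅ N where
  hom := f
  inv :=
    { app := e
      lact_app := fun b b' a => by
        have : N.lact b b' a = (b ⟶[V] b') ◁ e b' a ≫ M.lact b b' a ≫ f.app b a := by
          rw [f.lact_app, ← MonoidalCategory.whiskerLeft_comp_assoc, h₂,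
            MonoidalCategory.whiskerLeft_id, Category.id_comp]
        rw [this, Category.assoc, Category.assoc, h₁, Category.comp_id]
      ract_app := fun b a a' => by
        have : N.ract b a a' = e b a ▷ (a ⟶[V] a') ≫ M.ract b a a' ≫ f.app b a' := by
          rw [f.ract_app, ← MonoidalCategory.comp_whiskerRight_assoc, h₂,
            MonoidalCategory.id_whiskerRight, Category.id_comp]
        rw [this, Category.assoc, Category.assoc, h₁, Category.comp_id] }
  hom_inv_id := hom_ext h₁
  inv_hom_id := hom_ext h₂

variable (V B) in
/-- The identity module `1 : B ⇸ B`, with `1(b,b') = B(b,b')`. -/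
@[reducible]
def unit : VModule V B B where
  obj b b' := b ⟶[V] b'
  lact b b' a := eComp V b b' a
  ract b a a' := eComp V b a a'
  id_lact b a := by rw [← cancel_epi (λ_ _).inv, e_id_comp, Iso.inv_hom_id]
  comp_lact b b' b'' a := (e_assoc' V b b' b'' a).symm
  ract_id b a := by rw [← cancel_epi (ρ_ _).inv, e_comp_id, Iso.inv_hom_id]
  ract_comp b a a' a'' := (e_assoc V b a a' a'').symm
  lact_ract b b' a a' := (e_assoc' V b b' a a').symm

end VModule


/-- The family `σ x : T ⟶ M(x,x)` is `V`-natural in `x`. -/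
abbrev IsWedge [BraidedCategory V] (M : VModule V B B) {T : V} (σ : ∀ x, T ⟶ M.obj x x) : Prop :=
  ∀ x y, σ x ▷ (x ⟶[V] y) ≫ M.ract x x y = (β_ T _).hom ≫ _ ◁ σ y ≫ M.lact x y y

/-- The family `k x : g(c,x) ⊗ f(x,a) ⟶ Z` is dinatural in `x`. -/
abbrev IsBalanced {C : Type w₃} [EnrichedCategory V C] (f : VModule V A B) (g : VModule V B C) (a : A) (c : C) {Z : V}
    (k : ∀ x, g.obj c x ⊗ f.obj x a ⟶ Z) : Prop :=
  ∀ x y, g.ract c x y ▷ f.obj y a ≫ k y = (α_ _ _ _).hom ≫ g.obj c x ◁ f.lact x y a ≫ k x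

/-! ### Actions of the morphisms of the underlying ordinary category -/

section Ordinary

open MonoidalCategory

variable {X : Type w₃} [Category.{v} X] [EnrichedOrdinaryCategory V X]

/-- `M(y,a) ⟶ M(x,a)` for a morphism `p : x ⟶ y`. -/
def actL (M : VModule V A X) {x y : X} (p : x ⟶ y) (a : A) : M.obj y a ⟶ M.obj x a :=
  (λ_ _).inv ≫ eHomEquiv V p ▷ _ ≫ M.lact x y a

/-- `M(b,x) ⟶ M(b,y)` for a morphism `p : x ⟶ y`. -/
def actR (M : VModule V X B) (b : B) {x y : X} (p : x ⟶ y) : M.obj b x ⟶ M.obj b y :=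
  (ρ_ _).inv ≫ _ ◁ eHomEquiv V p ≫ M.ract b x y

lemma lact_actL (M : VModule V A X) {x y : X} (p : x ⟶ y) (z : X) (a : A) :
    M.lact y z a ≫ actL M p a = eHomWhiskerRight V p z ▷ _ ≫ M.lact x z a := by
  dsimp [actL, eHomWhiskerRight]
  rw [leftUnitor_inv_naturality_assoc, whisker_exchange_assoc]
  simp [M.comp_lact]

lemma actL_lact (M : VModule V A X) (x : X) {y z : X} (p : y ⟶ z) (a : A) :
    (x ⟶[V] y) ◁ actL M p a ≫ M.lact x y a = eHomWhiskerLeft V x p ▷ _ ≫ M.lact x z a := by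
  dsimp [actL, eHomWhiskerLeft]
  simp [M.comp_lact]

lemma ract_actR (M : VModule V X B) (b : B) (x : X) {y z : X} (p : y ⟶ z) :
    M.ract b x y ≫ actR M b p = _ ◁ eHomWhiskerLeft V x p ≫ M.ract b x z := by
  dsimp [actR, eHomWhiskerLeft]
  rw [rightUnitor_inv_naturality_assoc, ← whisker_exchange_assoc]
  simp [M.ract_comp]

lemma actR_ract (M : VModule V X B) (b : B) {x y : X} (p : x ⟶ y) (z : X) :
    actR M b p ▷ (y ⟶[V] z) ≫ M.ract b y z = _ ◁ eHomWhiskerRight V p z ≫ M.ract b x z := by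
  dsimp [actR, eHomWhiskerRight]
  simp [M.ract_comp]

lemma actL_ract (M : VModule V A X) {x y : X} (p : x ⟶ y) (a a' : A) :
    actL M p a ▷ _ ≫ M.ract x a a' = M.ract y a a' ≫ actL M p a' := by
  dsimp [actL]
  rw [leftUnitor_inv_naturality_assoc, whisker_exchange_assoc]
  simp [M.lact_ract]

lemma actR_lact (M : VModule V X B) (b b' : B) {x y : X} (p : x ⟶ y) :
    M.lact b b' x ≫ actR M b p = _ ◁ actR M b' p ≫ M.lact b b' y := by
  dsimp [actR]
  rw [rightUnitor_inv_naturality_assoc, ← whisker_exchange_assoc]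
  simp [M.lact_ract]

lemma actR_actL (M : VModule V X X) {x y z t : X} (p : x ⟶ y) (q : z ⟶ t) :
    actR M y q ≫ actL M p t = actL M p z ≫ actR M x q := by
  have h : _ ◁ M.ract y z t ≫ M.lact x y t = (α_ _ _ _).inv ≫ M.lact x y z ▷ _ ≫ M.ract x z t := by
    rw [M.lact_ract, Iso.inv_hom_id_assoc]
  dsimp [actR, actL]
  simp only [Category.assoc]
  rw [leftUnitor_inv_naturality_assoc, whisker_exchange_assoc, h, leftUnitor_tensor_inv_assoc,
    associator_inv_naturality_left_assoc, Iso.hom_inv_id_assoc,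
    ← comp_whiskerRight_assoc, whisker_exchange_assoc,
    MonoidalCategory.whiskerRight_id_assoc, Category.assoc, Iso.inv_hom_id_assoc,
    whisker_exchange_assoc, MonoidalCategory.whiskerRight_id_assoc, Iso.inv_hom_id_assoc]

lemma actL_comp (M : VModule V A X) {x y z : X} (p : x ⟶ y) (q : y ⟶ z) (a : A) :
    actL M (p ≫ q) a = actL M q a ≫ actL M p a := by
  dsimp [actL]
  rw [Category.assoc, Category.assoc, eHomEquiv_comp, comp_whiskerRight_assoc,
    comp_whiskerRight_assoc, M.comp_lact,
    tensorHom_def', comp_whiskerRight_assoc, id_whiskerLeft, comp_whiskerRight_assoc,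
    ← comp_whiskerRight_assoc, Iso.inv_hom_id, id_whiskerRight_assoc,
    comp_whiskerRight_assoc, leftUnitor_inv_whiskerRight_assoc,
    ← associator_inv_naturality_left_assoc, Iso.inv_hom_id_assoc,
    ← whisker_exchange_assoc, id_whiskerLeft_assoc, Iso.inv_hom_id_assoc]

lemma actL_id (M : VModule V A X) (x : X) (a : A) : actL M (𝟙 x) a = 𝟙 _ := by
  simp [actL, M.id_lact]

lemma actR_comp (M : VModule V X B) (b : B) {x y z : X} (p : x ⟶ y) (q : y ⟶ z) :
    actR M b (p ≫ q) = actR M b p ≫ actR M b q := by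
  dsimp [actR]
  rw [Category.assoc, Category.assoc, eHomEquiv_comp, MonoidalCategory.whiskerLeft_comp_assoc,
    MonoidalCategory.whiskerLeft_comp_assoc, M.ract_comp, MonoidalCategory.tensorHom_def,
    MonoidalCategory.whiskerRight_id_assoc, MonoidalCategory.whiskerLeft_comp_assoc,
    MonoidalCategory.whiskerLeft_comp_assoc, MonoidalCategory.whiskerLeft_comp_assoc,
    whiskerLeft_rightUnitor_assoc, whiskerLeft_rightUnitor_inv_assoc,
    triangle_assoc_comp_left_inv_assoc, MonoidalCategory.whiskerRight_id_assoc,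
    Iso.hom_inv_id_assoc, Iso.inv_hom_id_assoc,
    associator_inv_naturality_right_assoc, Iso.hom_inv_id_assoc,
    whisker_exchange_assoc, MonoidalCategory.whiskerRight_id_assoc, Iso.inv_hom_id_assoc]

lemma actR_id (M : VModule V X B) (b : B) (x : X) : actR M b (𝟙 x) = 𝟙 _ := by
  simp [actR, M.ract_id]

/-! ### Ends and coends over an essentially small category -/

lemma actR_eq_of_wedge [BraidedCategory V] {M : VModule V X X} {T : V} {x y : X}
    {a : T ⟶ M.obj x x} {b : T ⟶ M.obj y y}
    (h : a ▷ (x ⟶[V] y) ≫ M.ract x x y = (β_ T _).hom ≫ _ ◁ b ≫ M.lact x y y) (p : x ⟶ y) :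
    a ≫ actR M x p = b ≫ actL M p y := by
  have := (ρ_ T).inv ≫= (T ◁ eHomEquiv V p ≫= h)
  dsimp [actR, actL]
  rw [whisker_exchange_assoc, BraidedCategory.braiding_naturality_right_assoc,
    ← whisker_exchange_assoc (eHomEquiv V p) b] at this
  simpa using this

theorem exists_end [EssentiallySmall.{v} X] [SymmetricCategory V] [MonoidalClosed V] [HasLimits V]
    (M : VModule V X X) :
    ∃ (N : V) (π : ∀ x, N ⟶ M.obj x x), IsWedge M π ∧
      ∀ (T : V) (σ : ∀ x, T ⟶ M.obj x x), IsWedge M σ → ∃! t : T ⟶ N, ∀ x, t ≫ π x = σ x := by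
  let e := equivSmallModel.{v} X
  let r : SmallModel.{v} X → X := fun s => e.inverse.obj s
  let q : X → SmallModel.{v} X := fun x => e.functor.obj x
  let i : ∀ x : X, x ⟶ r (q x) := fun x => e.unit.app x
  let j : ∀ x : X, r (q x) ⟶ x := fun x => e.unitInv.app x
  have hij : ∀ x, i x ≫ j x = 𝟙 x := fun x => e.unitIso.hom_inv_id_app x
  let P : V := ∏ᶜ fun s => M.obj (r s) (r s)
  let Q : V := ∏ᶜ fun st : SmallModel.{v} X × SmallModel.{v} X =>
    (ihom (r st.1 ⟶[V] r st.2)).obj (M.obj (r st.1) (r st.2))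
  let l₁ : P ⟶ Q := Pi.lift fun st =>
    MonoidalClosed.curry (_ ◁ Pi.π _ st.2 ≫ M.lact (r st.1) (r st.2) (r st.2))
  let l₂ : P ⟶ Q := Pi.lift fun st =>
    MonoidalClosed.curry ((β_ _ _).hom ≫ Pi.π _ st.1 ▷ _ ≫ M.ract (r st.1) (r st.1) (r st.2))
  let π₀ : ∀ s, equalizer l₁ l₂ ⟶ M.obj (r s) (r s) := fun s => equalizer.ι l₁ l₂ ≫ Pi.π _ s
  have hπ₀ : ∀ s t, π₀ s ▷ (r s ⟶[V] r t) ≫ M.ract (r s) (r s) (r t) =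
      (β_ _ _).hom ≫ _ ◁ π₀ t ≫ M.lact (r s) (r t) (r t) := by
    intro s t
    have h := congrArg (fun k => k ≫ Pi.π _ (s, t)) (equalizer.condition l₁ l₂)
    simp only [l₁, l₂, Category.assoc, Pi.lift_π] at h
    rw [← MonoidalClosed.curry_natural_left, ← MonoidalClosed.curry_natural_left] at h
    have h' := MonoidalClosed.curry_injective h
    rw [← MonoidalCategory.whiskerLeft_comp_assoc, BraidedCategory.braiding_naturality_right_assoc,
      ← comp_whiskerRight_assoc] at h'
    rw [h', SymmetricCategory.symmetry_assoc]
  let π : ∀ x, equalizer l₁ l₂ ⟶ M.obj x x := fun x =>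
    π₀ (q x) ≫ actL M (i x) _ ≫ actR M x (j x)
  have hπ : IsWedge M π := by
    intro x y
    have hm : eHomWhiskerRight V (j x) y =
        (eHomWhiskerRight V (j x) y ≫ eHomWhiskerLeft V _ (i y)) ≫ eHomWhiskerLeft V _ (j y) := by
      rw [Category.assoc, ← eHomWhiskerLeft_comp, hij, eHomWhiskerLeft_id, Category.comp_id]
    have hm' : (eHomWhiskerRight V (j x) y ≫ eHomWhiskerLeft V _ (i y)) ≫
        eHomWhiskerRight V (i x) _ = eHomWhiskerLeft V x (i y) := by
      rw [← eHom_whisker_exchange, Category.assoc, ← eHomWhiskerRight_comp, hij,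
        eHomWhiskerRight_id, Category.comp_id]
    obtain ⟨m, hmdef⟩ : ∃ m, m = eHomWhiskerRight V (j x) y ≫ eHomWhiskerLeft V (r (q x)) (i y) :=
      ⟨_, rfl⟩
    rw [← hmdef] at hm hm'
    calc π x ▷ (x ⟶[V] y) ≫ M.ract x x y
        = _ ◁ m ≫
            (π₀ (q x) ▷ _ ≫ M.ract _ _ _) ≫ actL M (i x) _ ≫ actR M x (j y) := by
          simp only [π, comp_whiskerRight, Category.assoc]
          rw [actR_ract, hm, MonoidalCategory.whiskerLeft_comp_assoc, ← ract_actR,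
            ← whisker_exchange_assoc, ← whisker_exchange_assoc,
            reassoc_of% actL_ract M (i x) (r (q x)) (r (q y))]
      _ = (β_ _ _).hom ≫ (x ⟶[V] y) ◁ π y ≫ M.lact x y y := by
          rw [hπ₀, Category.assoc, Category.assoc, BraidedCategory.braiding_naturality_right_assoc,
            ← whisker_exchange_assoc, reassoc_of% lact_actL M (i x), ← comp_whiskerRight_assoc, hm',
            ← reassoc_of% actL_lact M x (i y), actR_lact]
          simp [π]
  have hr : ∀ {T : V} {σ : ∀ x, T ⟶ M.obj x x}, IsWedge M σ → ∀ x,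
      σ (r (q x)) ≫ actL M (i x) _ ≫ actR M x (j x) = σ x := by
    intro T σ hσ x
    rw [← Category.assoc, ← actR_eq_of_wedge (hσ _ _), Category.assoc, ← actR_comp, hij, actR_id, Category.comp_id]
  have hr₀ : ∀ s, π (r s) = π₀ s := by
    intro s
    simp only [π]
    rw [← Category.assoc, ← actR_eq_of_wedge (hπ₀ _ _), Category.assoc, ← actR_comp, hij, actR_id,
      Category.comp_id]
  refine ⟨equalizer l₁ l₂, π, hπ, fun T σ hσ => ?_⟩
  let t : T ⟶ equalizer l₁ l₂ := equalizer.lift (Pi.lift fun s => σ (r s)) (by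
    refine Pi.hom_ext _ _ fun st => ?_
    simp only [l₁, l₂, Category.assoc, Pi.lift_π]
    rw [← MonoidalClosed.curry_natural_left, ← MonoidalClosed.curry_natural_left,
      ← MonoidalCategory.whiskerLeft_comp_assoc, BraidedCategory.braiding_naturality_right_assoc,
      ← comp_whiskerRight_assoc, Pi.lift_π, Pi.lift_π, hσ, SymmetricCategory.symmetry_assoc])
  have ht : ∀ s, t ≫ π₀ s = σ (r s) := fun s => by
    simp only [t, π₀]
    rw [equalizer.lift_ι_assoc, Pi.lift_π]
  refine ⟨t, fun x => ?_, fun t' ht' => ?_⟩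
  · simp only [π]
    rw [← Category.assoc, ht, hr hσ]
  · refine equalizer.hom_ext (Pi.hom_ext _ _ fun s => ?_)
    have h₁ := ht' (r s)
    rw [hr₀] at h₁
    have h₂ := ht s
    simp only [π₀] at h₁ h₂
    rw [Category.assoc, Category.assoc, h₁, h₂]

lemma actR_eq_of_balanced {f : VModule V A X} {g : VModule V X B} {a : A} {b : B} {Z : V} {x y : X}
    {k : g.obj b x ⊗ f.obj x a ⟶ Z} {k' : g.obj b y ⊗ f.obj y a ⟶ Z}
    (h : g.ract b x y ▷ f.obj y a ≫ k' = (α_ _ _ _).hom ≫ g.obj b x ◁ f.lact x y a ≫ k)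
    (p : x ⟶ y) : actR g b p ▷ f.obj y a ≫ k' = g.obj b x ◁ actL f p a ≫ k := by
  dsimp [actR, actL]
  simp [h]

theorem exists_coend [EssentiallySmall.{v} X] [SymmetricCategory V] [MonoidalClosed V]
    [HasColimits V] (f : VModule V A X) (g : VModule V X B) (a : A) (b : B) :
    ∃ (N : V) (κ : ∀ x, g.obj b x ⊗ f.obj x a ⟶ N), IsBalanced f g a b κ ∧
      ∀ (Z : V) (k : ∀ x, g.obj b x ⊗ f.obj x a ⟶ Z), IsBalanced f g a b k →
        ∃! t : N ⟶ Z, ∀ x, κ x ≫ t = k x := by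
  let e := equivSmallModel.{v} X
  let r : SmallModel.{v} X → X := fun s => e.inverse.obj s
  let q : X → SmallModel.{v} X := fun x => e.functor.obj x
  let i : ∀ x : X, x ⟶ r (q x) := fun x => e.unit.app x
  let j : ∀ x : X, r (q x) ⟶ x := fun x => e.unitInv.app x
  have hij : ∀ x, i x ≫ j x = 𝟙 x := fun x => e.unitIso.hom_inv_id_app x
  let P : V := ∐ fun s => g.obj b (r s) ⊗ f.obj (r s) a
  let Q : V := ∐ fun st : SmallModel.{v} X × SmallModel.{v} X =>
    (g.obj b (r st.1) ⊗ (r st.1 ⟶[V] r st.2)) ⊗ f.obj (r st.2) a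
  let l₁ : Q ⟶ P := Sigma.desc fun st => g.ract b (r st.1) (r st.2) ▷ f.obj (r st.2) a ≫
    Sigma.ι (fun s => g.obj b (r s) ⊗ f.obj (r s) a) st.2
  let l₂ : Q ⟶ P := Sigma.desc fun st => (α_ _ _ _).hom ≫
    g.obj b (r st.1) ◁ f.lact (r st.1) (r st.2) a ≫
      Sigma.ι (fun s => g.obj b (r s) ⊗ f.obj (r s) a) st.1
  let κ₀ : ∀ s, g.obj b (r s) ⊗ f.obj (r s) a ⟶ coequalizer l₁ l₂ := fun s =>
    Sigma.ι (fun s => g.obj b (r s) ⊗ f.obj (r s) a) s ≫ coequalizer.π l₁ l₂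
  have hκ₀ : ∀ s t, g.ract b (r s) (r t) ▷ f.obj (r t) a ≫ κ₀ t =
      (α_ _ _ _).hom ≫ g.obj b (r s) ◁ f.lact (r s) (r t) a ≫ κ₀ s := by
    intro s t
    have h := Sigma.ι _ (s, t) ≫= coequalizer.condition l₁ l₂
    simpa [l₁, l₂] using h
  let κ : ∀ x, g.obj b x ⊗ f.obj x a ⟶ coequalizer l₁ l₂ := fun x =>
    actR g b (i x) ▷ f.obj x a ≫ _ ◁ actL f (j x) a ≫ κ₀ (q x)
  have hκ : IsBalanced f g a b κ := by
    intro x y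
    have hm : eHomWhiskerRight V (j x) y =
        (eHomWhiskerRight V (j x) y ≫ eHomWhiskerLeft V _ (i y)) ≫ eHomWhiskerLeft V _ (j y) := by
      rw [Category.assoc, ← eHomWhiskerLeft_comp, hij, eHomWhiskerLeft_id, Category.comp_id]
    have hm' : (eHomWhiskerRight V (j x) y ≫ eHomWhiskerLeft V _ (i y)) ≫
        eHomWhiskerRight V (i x) _ = eHomWhiskerLeft V x (i y) := by
      rw [← eHom_whisker_exchange, Category.assoc, ← eHomWhiskerRight_comp, hij,
        eHomWhiskerRight_id, Category.comp_id]
    obtain ⟨m, hmdef⟩ : ∃ m, m = eHomWhiskerRight V (j x) y ≫ eHomWhiskerLeft V (r (q x)) (i y) :=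
      ⟨_, rfl⟩
    rw [← hmdef] at hm hm'
    calc g.ract b x y ▷ f.obj y a ≫ κ y
        = (g.obj b x ◁ m) ▷ f.obj y a ≫ (actR g b (i x) ▷ _) ▷ _ ≫ _ ◁ actL f (j y) a ≫
            g.ract b (r (q x)) (r (q y)) ▷ _ ≫ κ₀ (q y) := by
          simp only [κ]
          rw [← comp_whiskerRight_assoc, ract_actR, ← hm', whisker_exchange_assoc,
            ← comp_whiskerRight_assoc _ (g.ract b (r (q x)) (r (q y))), actR_ract,
            ← comp_whiskerRight_assoc, MonoidalCategory.whiskerLeft_comp, Category.assoc]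
      _ = (α_ _ _ _).hom ≫ g.obj b x ◁ f.lact x y a ≫ κ x := by
          simp only [κ]
          rw [hκ₀, whisker_exchange_assoc (actR g b (i x)), ← MonoidalCategory.whiskerLeft_comp_assoc,
            lact_actL, hm, comp_whiskerRight, Category.assoc, ← actL_lact]
          simp only [MonoidalCategory.whiskerLeft_comp, Category.assoc, tensor_whiskerLeft,
            whisker_assoc, Iso.inv_hom_id_assoc]
          rw [associator_naturality_left_assoc, Iso.inv_hom_id_assoc, whisker_exchange_assoc]
  have hr : ∀ {Z : V} {k : ∀ x, g.obj b x ⊗ f.obj x a ⟶ Z}, IsBalanced f g a b k → ∀ x,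
      actR g b (i x) ▷ f.obj x a ≫ _ ◁ actL f (j x) a ≫ k (r (q x)) = k x := by
    intro Z k hk x
    rw [← actR_eq_of_balanced (hk _ _), ← comp_whiskerRight_assoc, ← actR_comp, hij, actR_id,
      id_whiskerRight, Category.id_comp]
  have hr₀ : ∀ s, κ (r s) = κ₀ s := by
    intro s
    simp only [κ]
    rw [← actR_eq_of_balanced (hκ₀ _ _), ← comp_whiskerRight_assoc, ← actR_comp, hij, actR_id,
      id_whiskerRight, Category.id_comp]
  refine ⟨coequalizer l₁ l₂, κ, hκ, fun Z k hk => ?_⟩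
  let t : coequalizer l₁ l₂ ⟶ Z := coequalizer.desc (Sigma.desc fun s => k (r s)) (by
    refine Sigma.hom_ext _ _ fun st => ?_
    simpa [l₁, l₂] using hk (r st.1) (r st.2))
  have ht : ∀ s, κ₀ s ≫ t = k (r s) := fun s => by simp [t, κ₀]
  refine ⟨t, fun x => ?_, fun t' ht' => ?_⟩
  · simp only [κ, Category.assoc]
    rw [ht, hr hk]
  · refine coequalizer.hom_ext (Sigma.hom_ext _ _ fun s => ?_)
    have h₁ := ht' (r s)
    rw [hr₀] at h₁
    have h₂ := ht s
    simp only [κ₀, Category.assoc] at h₁ h₂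
    rw [h₁, h₂]

end Ordinary
end Modules

section Small

variable (V : Type u) [Category.{v} V] [MonoidalCategory V]

/-- A `V`-category is small when its isomorphism classes of objects form a small set. -/
class VSmall (B : Type w) [EnrichedCategory V B] : Prop where
  small : Small.{v} (Skeleton (ForgetEnrichment V B))

lemma essentiallySmall_forget (B : Type w) [EnrichedCategory V B] [h : VSmall V B] :
    EssentiallySmall.{v} (ForgetEnrichment V B) :=
  (essentiallySmall_iff _).2 ⟨h.small, inferInstance⟩

instance (B : Type w) [EnrichedCategory V B] [SymmetricCategory V] [VSmall V B] :
    VSmall V Bᵒᵖ where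
  small := by
    have := essentiallySmall_forget V B
    have : EssentiallySmall.{v} (ForgetEnrichment V Bᵒᵖ) :=
      (essentiallySmall_congr (forgetEnrichmentOppositeEquivalence V B)).2 inferInstance
    infer_instance

/-- The objects of the unit `V`-category. -/
inductive UnitObj : Type w
  | star

/-- The unit `V`-category: one object `*`, with hom object the unit of `V`. -/
instance : EnrichedCategory V UnitObj.{w} where
  Hom _ _ := 𝟙_ V
  id _ := 𝟙 _
  comp _ _ _ := (λ_ _).hom
  id_comp _ _ := by simp
  comp_id _ _ := by simp [MonoidalCategory.unitors_equal]
  assoc _ _ _ _ := by simp [MonoidalCategory.unitors_equal]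

instance : VSmall V UnitObj.{w} where
  small := small_of_surjective (α := PUnit.{v + 1})
    (f := fun _ => toSkeleton (C := ForgetEnrichment V UnitObj.{w}) UnitObj.star) (fun s => by
      induction s using Quotient.inductionOn with
      | h a => cases a; exact ⟨PUnit.unit, rfl⟩)

end Small

namespace VModule

open MonoidalCategory

variable {V : Type u} [Category.{v} V] [MonoidalCategory V] [SymmetricCategory V]
  [MonoidalClosed V] [HasColimits V]
variable {A : Type w₁} [EnrichedCategory V A] {B : Type w₂} [EnrichedCategory V B] [VSmall V B]
  {C : Type w₃} [EnrichedCategory V C]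

theorem exists_coend' (f : VModule V A B) (g : VModule V B C) (a : A) (c : C) :
    ∃ (N : V) (κ : ∀ b, g.obj c b ⊗ f.obj b a ⟶ N), IsBalanced f g a c κ ∧
      ∀ (Z : V) (k : ∀ b, g.obj c b ⊗ f.obj b a ⟶ Z), IsBalanced f g a c k →
        ∃! t : N ⟶ Z, ∀ b, κ b ≫ t = k b :=
  have := essentiallySmall_forget V B
  exists_coend (X := ForgetEnrichment V B) f g a c

/-- The coend `∫^b g(c,b) ⊗ f(b,a)`. -/
def coend (f : VModule V A B) (g : VModule V B C) (c : C) (a : A) : V :=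
  (exists_coend' f g a c).choose

/-- The universal dinatural family `g(c,b) ⊗ f(b,a) ⟶ ∫^b g(c,b) ⊗ f(b,a)`. -/
def κ (f : VModule V A B) (g : VModule V B C) (c : C) (a : A) (b : B) :
    g.obj c b ⊗ f.obj b a ⟶ coend f g c a :=
  (exists_coend' f g a c).choose_spec.choose b

lemma κ_balanced (f : VModule V A B) (g : VModule V B C) (c : C) (a : A) :
    IsBalanced f g a c (κ f g c a) :=
  (exists_coend' f g a c).choose_spec.choose_spec.1

/-- The morphism out of a coend given by a dinatural family. -/
def desc (f : VModule V A B) (g : VModule V B C) (c : C) (a : A) {Z : V}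
    (k : ∀ b, g.obj c b ⊗ f.obj b a ⟶ Z) (hk : IsBalanced f g a c k) : coend f g c a ⟶ Z :=
  ((exists_coend' f g a c).choose_spec.choose_spec.2 Z k hk).choose

lemma κ_desc (f : VModule V A B) (g : VModule V B C) (c : C) (a : A) {Z : V}
    (k : ∀ b, g.obj c b ⊗ f.obj b a ⟶ Z) (hk : IsBalanced f g a c k) (b : B) :
    κ f g c a b ≫ desc f g c a k hk = k b :=
  ((exists_coend' f g a c).choose_spec.choose_spec.2 Z k hk).choose_spec.1 b

lemma coend_ext {f : VModule V A B} {g : VModule V B C} {c : C} {a : A} {Z : V}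
    {s t : coend f g c a ⟶ Z} (h : ∀ b, κ f g c a b ≫ s = κ f g c a b ≫ t) : s = t := by
  have hk : IsBalanced f g a c fun b => κ f g c a b ≫ t := fun x y => by
    have := κ_balanced f g c a x y =≫ t
    simpa using this
  exact ((exists_coend' f g a c).choose_spec.choose_spec.2 Z _ hk).unique h (fun _ => rfl)

/-- The morphism out of `W ⊗ ∫^b g(c,b) ⊗ f(b,a)` given by a dinatural family. -/
def descL (f : VModule V A B) (g : VModule V B C) (c : C) (a : A) (W : V) {Z : V}
    (k : ∀ b, W ⊗ (g.obj c b ⊗ f.obj b a) ⟶ Z)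
    (hk : ∀ x y, W ◁ g.ract c x y ▷ f.obj y a ≫ k y =
      W ◁ (α_ _ _ _).hom ≫ W ◁ g.obj c x ◁ f.lact x y a ≫ k x) : W ⊗ coend f g c a ⟶ Z :=
  MonoidalClosed.uncurry (desc f g c a (fun b => MonoidalClosed.curry (k b)) (fun x y => by
    rw [← MonoidalClosed.curry_natural_left, hk, MonoidalClosed.curry_natural_left,
      MonoidalClosed.curry_natural_left]))

lemma κ_descL (f : VModule V A B) (g : VModule V B C) (c : C) (a : A) (W : V) {Z : V}
    (k : ∀ b, W ⊗ (g.obj c b ⊗ f.obj b a) ⟶ Z) (hk) (b : B) :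
    W ◁ κ f g c a b ≫ descL f g c a W k hk = k b := by
  rw [descL, ← MonoidalClosed.uncurry_natural_left, κ_desc, MonoidalClosed.uncurry_curry]

lemma coend_extL {f : VModule V A B} {g : VModule V B C} {c : C} {a : A} {W Z : V}
    {s t : W ⊗ coend f g c a ⟶ Z} (h : ∀ b, W ◁ κ f g c a b ≫ s = W ◁ κ f g c a b ≫ t) :
    s = t := by
  apply MonoidalClosed.curry_injective
  apply coend_ext
  intro b
  rw [← MonoidalClosed.curry_natural_left, ← MonoidalClosed.curry_natural_left, h]

/-- The morphism out of `(∫^b g(c,b) ⊗ f(b,a)) ⊗ W` given by a dinatural family. -/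
def descR (f : VModule V A B) (g : VModule V B C) (c : C) (a : A) (W : V) {Z : V}
    (k : ∀ b, (g.obj c b ⊗ f.obj b a) ⊗ W ⟶ Z)
    (hk : ∀ x y, g.ract c x y ▷ f.obj y a ▷ W ≫ k y =
      (α_ _ _ _).hom ▷ W ≫ (g.obj c x ◁ f.lact x y a) ▷ W ≫ k x) : coend f g c a ⊗ W ⟶ Z :=
  (β_ _ _).hom ≫ descL f g c a W (fun b => (β_ _ _).hom ≫ k b) (fun x y => by
    have := (β_ W _).hom ≫= hk x y
    simpa only [BraidedCategory.braiding_naturality_right_assoc] using this)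

lemma κ_descR (f : VModule V A B) (g : VModule V B C) (c : C) (a : A) (W : V) {Z : V}
    (k : ∀ b, (g.obj c b ⊗ f.obj b a) ⊗ W ⟶ Z) (hk) (b : B) :
    κ f g c a b ▷ W ≫ descR f g c a W k hk = k b := by
  rw [descR, BraidedCategory.braiding_naturality_left_assoc, κ_descL,
    SymmetricCategory.symmetry_assoc]

lemma coend_extR {f : VModule V A B} {g : VModule V B C} {c : C} {a : A} {W Z : V}
    {s t : coend f g c a ⊗ W ⟶ Z} (h : ∀ b, κ f g c a b ▷ W ≫ s = κ f g c a b ▷ W ≫ t) :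
    s = t := by
  rw [← cancel_epi (β_ W _).hom]
  apply coend_extL
  intro b
  rw [BraidedCategory.braiding_naturality_right_assoc, h,
    BraidedCategory.braiding_naturality_right_assoc]


open MonoidalCategory

variable {V : Type u} [Category.{v} V] [MonoidalCategory V] [SymmetricCategory V]
  [MonoidalClosed V] [HasColimits V]
variable {A : Type w₁} [EnrichedCategory V A] {B : Type w₂} [EnrichedCategory V B] [VSmall V B]
  {C : Type w₃} [EnrichedCategory V C]

/-- The action of `C` on the composite. -/
def compLact (f : VModule V A B) (g : VModule V B C) (c c' : C) (a : A) :
    (c ⟶[V] c') ⊗ coend f g c' a ⟶ coend f g c a :=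
  descL f g c' a (c ⟶[V] c')
    (fun b => (α_ _ _ _).inv ≫ g.lact c c' b ▷ f.obj b a ≫ κ f g c a b) (fun x y => by
      rw [associator_inv_naturality_middle_assoc, ← comp_whiskerRight_assoc]
      have h : (c ⟶[V] c') ◁ g.ract c' x y ≫ g.lact c c' y =
          (α_ _ _ _).inv ≫ g.lact c c' x ▷ _ ≫ g.ract c x y := by
        rw [g.lact_ract, Iso.inv_hom_id_assoc]
      rw [h]
      simp only [comp_whiskerRight, Category.assoc]
      rw [κ_balanced, associator_naturality_left_assoc,
        ← whisker_exchange_assoc (g.lact c c' x)]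
      simp)

/-- The action of `A` on the composite. -/
def compRact (f : VModule V A B) (g : VModule V B C) (c : C) (a a' : A) :
    coend f g c a ⊗ (a ⟶[V] a') ⟶ coend f g c a' :=
  descR f g c a (a ⟶[V] a')
    (fun b => (α_ _ _ _).hom ≫ g.obj c b ◁ f.ract b a a' ≫ κ f g c a' b) (fun x y => by
      have h := f.lact_ract x y a a'
      rw [associator_naturality_left_assoc, ← whisker_exchange_assoc, κ_balanced]
      simp only [whisker_assoc, Category.assoc, Iso.inv_hom_id_assoc, tensor_whiskerLeft]
      rw [← MonoidalCategory.whiskerLeft_comp_assoc _ (f.lact x y a ▷ _), h]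
      simp)

lemma κ_compLact (f : VModule V A B) (g : VModule V B C) (c c' : C) (a : A) (b : B) :
    (c ⟶[V] c') ◁ κ f g c' a b ≫ compLact f g c c' a =
      (α_ _ _ _).inv ≫ g.lact c c' b ▷ f.obj b a ≫ κ f g c a b :=
  κ_descL ..

lemma κ_compRact (f : VModule V A B) (g : VModule V B C) (c : C) (a a' : A) (b : B) :
    κ f g c a b ▷ (a ⟶[V] a') ≫ compRact f g c a a' =
      (α_ _ _ _).hom ≫ g.obj c b ◁ f.ract b a a' ≫ κ f g c a' b :=
  κ_descR ..

lemma κ_compLact_assoc (f : VModule V A B) (g : VModule V B C) (c c' : C) (a : A) (b : B) {Z : V}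
    (h : coend f g c a ⟶ Z) :
    (c ⟶[V] c') ◁ κ f g c' a b ≫ compLact f g c c' a ≫ h =
      (α_ _ _ _).inv ≫ g.lact c c' b ▷ f.obj b a ≫ κ f g c a b ≫ h := by
  rw [← Category.assoc, κ_compLact]; simp

lemma κ_compRact_assoc (f : VModule V A B) (g : VModule V B C) (c : C) (a a' : A) (b : B) {Z : V}
    (h : coend f g c a' ⟶ Z) :
    κ f g c a b ▷ (a ⟶[V] a') ≫ compRact f g c a a' ≫ h =
      (α_ _ _ _).hom ≫ g.obj c b ◁ f.ract b a a' ≫ κ f g c a' b ≫ h := by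
  rw [← Category.assoc, κ_compRact]; simp

lemma coend_extLR {f : VModule V A B} {g : VModule V B C} {c : C} {a : A} {X W Z : V}
    {s t : (X ⊗ coend f g c a) ⊗ W ⟶ Z}
    (h : ∀ b, (X ◁ κ f g c a b) ▷ W ≫ s = (X ◁ κ f g c a b) ▷ W ≫ t) : s = t := by
  rw [← cancel_epi (β_ W _).hom, ← cancel_epi (α_ _ _ _).hom]
  apply coend_extL
  intro b
  rw [associator_naturality_right_assoc, BraidedCategory.braiding_naturality_right_assoc, h,
    associator_naturality_right_assoc, BraidedCategory.braiding_naturality_right_assoc]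

lemma coend_extRR {f : VModule V A B} {g : VModule V B C} {c : C} {a : A} {X W Z : V}
    {s t : (coend f g c a ⊗ X) ⊗ W ⟶ Z}
    (h : ∀ b, κ f g c a b ▷ X ▷ W ≫ s = κ f g c a b ▷ X ▷ W ≫ t) : s = t := by
  rw [← cancel_epi (α_ _ _ _).inv]
  apply coend_extR
  intro b
  rw [associator_inv_naturality_left_assoc, h, associator_inv_naturality_left_assoc]

lemma coend_extLL {f : VModule V A B} {g : VModule V B C} {c : C} {a : A} {X W Z : V}
    {s t : X ⊗ (W ⊗ coend f g c a) ⟶ Z}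
    (h : ∀ b, X ◁ W ◁ κ f g c a b ≫ s = X ◁ W ◁ κ f g c a b ≫ t) : s = t := by
  rw [← cancel_epi (α_ _ _ _).hom]
  apply coend_extL
  intro b
  rw [associator_naturality_right_assoc, h, associator_naturality_right_assoc]

/-- The composite `g ∘ f : A ⇸ C` of `f : A ⇸ B` and `g : B ⇸ C`:
`(g ∘ f)(c,a) = ∫^b g(c,b) ⊗ f(b,a)`. -/
@[reducible]
def composite (f : VModule V A B) (g : VModule V B C) : VModule V A C where
  obj := coend f g
  lact := compLact f g
  ract := compRact f g
  id_lact c a := by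
    apply coend_extL
    intro b
    rw [whisker_exchange_assoc, κ_compLact]
    have := g.id_lact c b
    rw [whiskerRight_tensor]
    simp only [Category.assoc, Iso.hom_inv_id_assoc]
    rw [← comp_whiskerRight_assoc, this]
    simp
  comp_lact c c' c'' a := by
    apply coend_extL
    intro b
    rw [whisker_exchange_assoc, κ_compLact]
    simp only [whiskerRight_tensor, Category.assoc, Iso.hom_inv_id_assoc]
    rw [← comp_whiskerRight_assoc, g.comp_lact]
    simp only [tensor_whiskerLeft, Category.assoc, Iso.inv_hom_id_assoc]
    rw [← MonoidalCategory.whiskerLeft_comp_assoc _ _ (compLact f g c' c'' a), κ_compLact]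
    simp only [MonoidalCategory.whiskerLeft_comp, Category.assoc]
    rw [κ_compLact]
    simp
  ract_id c a := by
    apply coend_extR
    intro b
    rw [← whisker_exchange_assoc, κ_compRact]
    simp only [tensor_whiskerLeft, Category.assoc, Iso.inv_hom_id_assoc]
    rw [← MonoidalCategory.whiskerLeft_comp_assoc, f.ract_id]
    simp
  ract_comp c a a' a'' := by
    apply coend_extR
    intro b
    rw [← whisker_exchange_assoc, κ_compRact]
    simp only [tensor_whiskerLeft, Category.assoc, Iso.inv_hom_id_assoc]
    rw [← MonoidalCategory.whiskerLeft_comp_assoc, f.ract_comp]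
    simp only [whiskerRight_tensor, Category.assoc, Iso.hom_inv_id_assoc]
    rw [← comp_whiskerRight_assoc _ (compRact f g c a a'), κ_compRact]
    simp only [comp_whiskerRight, Category.assoc]
    rw [κ_compRact]
    simp
  lact_ract c c' a a' := by
    apply coend_extLR
    intro b
    rw [← comp_whiskerRight_assoc, κ_compLact]
    simp only [comp_whiskerRight, Category.assoc]
    rw [κ_compRact, associator_naturality_middle_assoc,
      ← MonoidalCategory.whiskerLeft_comp_assoc _ (κ f g c' a b ▷ _), κ_compRact]
    simp only [MonoidalCategory.whiskerLeft_comp, Category.assoc]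
    rw [κ_compLact, associator_naturality_left_assoc, ← whisker_exchange_assoc]
    simp


open MonoidalCategory

variable {V : Type u} [Category.{v} V] [MonoidalCategory V] [SymmetricCategory V]
  [MonoidalClosed V] [HasColimits V]
variable {A : Type w₁} [EnrichedCategory V A] {B : Type w₂} [EnrichedCategory V B] [VSmall V B]
  {C : Type w₃} [EnrichedCategory V C]

lemma κ_bal_assoc (f : VModule V A B) (g : VModule V B C) (c : C) (a : A) (b b' : B) {Z : V}
    (h : coend f g c a ⟶ Z) :
    g.ract c b b' ▷ f.obj b' a ≫ κ f g c a b' ≫ h =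
      (α_ _ _ _).hom ≫ g.obj c b ◁ f.lact b b' a ≫ κ f g c a b ≫ h := by
  have := κ_balanced f g c a b b' =≫ h
  simpa using this

lemma κ_desc_assoc (f : VModule V A B) (g : VModule V B C) (c : C) (a : A) {Z : V}
    (k : ∀ b, g.obj c b ⊗ f.obj b a ⟶ Z) (hk : IsBalanced f g a c k) (b : B) {Z' : V}
    (h : Z ⟶ Z') :
    κ f g c a b ≫ desc f g c a k hk ≫ h = k b ≫ h := by
  rw [← Category.assoc, κ_desc]

/-- Components of `η ∘ f`. -/
def appL (f : VModule V A B) {g h : VModule V B C} (η : g ⟶ h) (c : C) (a : A) :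
    coend f g c a ⟶ coend f h c a :=
  desc f g c a (fun b => η.app c b ▷ f.obj b a ≫ κ f h c a b) (fun x y => by
    rw [← comp_whiskerRight_assoc, η.ract_app, comp_whiskerRight_assoc, κ_balanced,
      associator_naturality_left_assoc, whisker_exchange_assoc])

/-- Components of `g ∘ η`. -/
def appR {f f' : VModule V A B} (η : f ⟶ f') (g : VModule V B C) (c : C) (a : A) :
    coend f g c a ⟶ coend f' g c a :=
  desc f g c a (fun b => g.obj c b ◁ η.app b a ≫ κ f' g c a b) (fun x y => by
    rw [← whisker_exchange_assoc, κ_balanced, ← MonoidalCategory.whiskerLeft_comp_assoc,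
      η.lact_app]
    simp)

lemma κ_appL (f : VModule V A B) {g h : VModule V B C} (η : g ⟶ h) (c : C) (a : A) (b : B) :
    κ f g c a b ≫ appL f η c a = η.app c b ▷ f.obj b a ≫ κ f h c a b := κ_desc ..

lemma κ_appR {f f' : VModule V A B} (η : f ⟶ f') (g : VModule V B C) (c : C) (a : A) (b : B) :
    κ f g c a b ≫ appR η g c a = g.obj c b ◁ η.app b a ≫ κ f' g c a b := κ_desc ..

lemma κ_appL_assoc (f : VModule V A B) {g h : VModule V B C} (η : g ⟶ h) (c : C) (a : A) (b : B)
    {Z : V} (k : coend f h c a ⟶ Z) :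
    κ f g c a b ≫ appL f η c a ≫ k = η.app c b ▷ f.obj b a ≫ κ f h c a b ≫ k := by
  simpa using κ_appL f η c a b =≫ k

lemma κ_appR_assoc {f f' : VModule V A B} (η : f ⟶ f') (g : VModule V B C) (c : C) (a : A) (b : B)
    {Z : V} (k : coend f' g c a ⟶ Z) :
    κ f g c a b ≫ appR η g c a ≫ k = g.obj c b ◁ η.app b a ≫ κ f' g c a b ≫ k := by
  simpa using κ_appR η g c a b =≫ k

/-- The 2-cell `η ∘ f : g ∘ f ⟶ h ∘ f`. -/
@[simps]
def whiskL (f : VModule V A B) {g h : VModule V B C} (η : g ⟶ h) :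
    composite f g ⟶ composite f h where
  app := appL f η
  lact_app c c' a := by
    apply coend_extL
    intro b
    rw [κ_compLact_assoc, κ_appL, ← MonoidalCategory.whiskerLeft_comp_assoc, κ_appL,
      MonoidalCategory.whiskerLeft_comp_assoc, κ_compLact, ← comp_whiskerRight_assoc, η.lact_app]
    simp
  ract_app c a a' := by
    apply coend_extR
    intro b
    rw [κ_compRact_assoc, κ_appL, ← comp_whiskerRight_assoc, κ_appL,
      comp_whiskerRight_assoc, κ_compRact, whisker_exchange_assoc]
    simp

/-- The 2-cell `g ∘ η : g ∘ f ⟶ g ∘ f'`. -/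
@[simps]
def whiskR {f f' : VModule V A B} (η : f ⟶ f') (g : VModule V B C) :
    composite f g ⟶ composite f' g where
  app := appR η g
  lact_app c c' a := by
    apply coend_extL
    intro b
    rw [κ_compLact_assoc, κ_appR, ← MonoidalCategory.whiskerLeft_comp_assoc, κ_appR,
      MonoidalCategory.whiskerLeft_comp_assoc, κ_compLact, ← whisker_exchange_assoc]
    simp
  ract_app c a a' := by
    apply coend_extR
    intro b
    rw [κ_compRact_assoc, κ_appR, ← comp_whiskerRight_assoc, κ_appR,
      comp_whiskerRight_assoc, κ_compRact, ← MonoidalCategory.whiskerLeft_comp_assoc, η.ract_app]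
    simp

section Unitors

/-- Components of the isomorphism `f ∘ 1 ≅ f`. -/
def luApp (f : VModule V B C) (c : C) (b : B) : coend (unit V B) f c b ⟶ f.obj c b :=
  desc (unit V B) f c b (fun b' => f.ract c b' b) (fun x y => by
    have := f.ract_comp c x y b
    rw [this, Iso.hom_inv_id_assoc])

lemma κ_luApp (f : VModule V B C) (c : C) (b b' : B) :
    κ (unit V B) f c b b' ≫ luApp f c b = f.ract c b' b := κ_desc ..

lemma κ_luApp_assoc (f : VModule V B C) (c : C) (b b' : B) {Z : V} (k : f.obj c b ⟶ Z) :
    κ (unit V B) f c b b' ≫ luApp f c b ≫ k = f.ract c b' b ≫ k := by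
  simpa using κ_luApp f c b b' =≫ k

/-- The isomorphism `f ∘ 1 ≅ f`. -/
def lu (f : VModule V B C) : composite (unit V B) f ≅ f :=
  isoMk
    { app := luApp f
      lact_app := fun c c' a => by
        apply coend_extL
        intro b
        rw [κ_compLact_assoc, κ_luApp, ← MonoidalCategory.whiskerLeft_comp_assoc, κ_luApp,
          f.lact_ract, Iso.inv_hom_id_assoc]
      ract_app := fun c a a' => by
        apply coend_extR
        intro b
        rw [κ_compRact_assoc, κ_luApp, ← comp_whiskerRight_assoc, κ_luApp]
        have := f.ract_comp c b a a'
        rw [this, Iso.hom_inv_id_assoc] }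
    (fun c b => (ρ_ _).inv ≫ f.obj c b ◁ eId V b ≫ κ (unit V B) f c b b)
    (fun c b => by
      apply coend_ext
      intro b'
      dsimp only
      rw [κ_luApp_assoc, rightUnitor_inv_naturality_assoc, ← whisker_exchange_assoc]
      have h₁ := κ_balanced (unit V B) f c b b' b
      have h₂ := (unit V B).ract_id b' b
      dsimp only at h₁ h₂
      rw [h₁]
      simp only [tensor_whiskerLeft, Category.assoc, Iso.inv_hom_id_assoc]
      rw [← MonoidalCategory.whiskerLeft_comp_assoc, h₂]
      simp)
    (fun c b => by
        rw [Category.assoc, Category.assoc, κ_luApp, f.ract_id, Iso.inv_hom_id])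

/-- Components of the isomorphism `1 ∘ f ≅ f`. -/
def ruApp (f : VModule V A B) (b : B) (a : A) : coend f (unit V B) b a ⟶ f.obj b a :=
  desc f (unit V B) b a (fun b' => f.lact b b' a) (fun x y => f.comp_lact b x y a)

lemma κ_ruApp (f : VModule V A B) (b : B) (a : A) (b' : B) :
    κ f (unit V B) b a b' ≫ ruApp f b a = f.lact b b' a := κ_desc ..

lemma κ_ruApp_assoc (f : VModule V A B) (b : B) (a : A) (b' : B) {Z : V} (k : f.obj b a ⟶ Z) :
    κ f (unit V B) b a b' ≫ ruApp f b a ≫ k = f.lact b b' a ≫ k := by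
  simpa using κ_ruApp f b a b' =≫ k

/-- The isomorphism `1 ∘ f ≅ f`. -/
def ru (f : VModule V A B) : composite f (unit V B) ≅ f :=
  isoMk
    { app := ruApp f
      lact_app := fun c c' a => by
        apply coend_extL
        intro b
        rw [κ_compLact_assoc, κ_ruApp, ← MonoidalCategory.whiskerLeft_comp_assoc, κ_ruApp]
        have := f.comp_lact c c' b a
        rw [this, Iso.inv_hom_id_assoc]
      ract_app := fun c a a' => by
        apply coend_extR
        intro b
        rw [κ_compRact_assoc, κ_ruApp, ← comp_whiskerRight_assoc, κ_ruApp, f.lact_ract] }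
    (fun b a => (λ_ _).inv ≫ eId V b ▷ f.obj b a ≫ κ f (unit V B) b a b)
    (fun b a => by
      apply coend_ext
      intro b'
      dsimp only
      rw [κ_ruApp_assoc, leftUnitor_inv_naturality_assoc, whisker_exchange_assoc]
      have h₁ := κ_balanced f (unit V B) b a b b'
      have h₂ := (unit V B).id_lact b b'
      dsimp only at h₁ h₂
      have h₃ : (b ⟶[V] b) ◁ f.lact b b' a ≫ κ f (unit V B) b a b =
          (α_ _ _ _).inv ≫ eComp V b b b' ▷ _ ≫ κ f (unit V B) b a b' := by
        rw [h₁, Iso.inv_hom_id_assoc]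
      rw [h₃]
      simp only [whiskerRight_tensor, Category.assoc, Iso.hom_inv_id_assoc]
      rw [← comp_whiskerRight_assoc, h₂]
      simp)
    (fun b a => by
        rw [Category.assoc, Category.assoc, κ_ruApp, f.id_lact, Iso.inv_hom_id])

end Unitors


open MonoidalCategory

variable {V : Type u} [Category.{v} V] [MonoidalCategory V] [SymmetricCategory V]
  [MonoidalClosed V] [HasColimits V]
variable {A : Type w₁} [EnrichedCategory V A] {B : Type w₂} [EnrichedCategory V B] [VSmall V B]
  {C : Type w₃} [EnrichedCategory V C] [VSmall V C] {D : Type w₄} [EnrichedCategory V D]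

/-- Auxiliary morphism for the associativity isomorphism. -/
def assocAux (f : VModule V A B) (g : VModule V B C) (h : VModule V C D) (d : D) (a : A) (c : C) :
    h.obj d c ⊗ coend f g c a ⟶ coend f (composite g h) d a :=
  descL f g c a (h.obj d c)
    (fun b => (α_ _ _ _).inv ≫ κ g h d b c ▷ f.obj b a ≫ κ f (composite g h) d a b)
    (fun x y => by
      have h₁ := κ_compRact g h d x y c
      have h₂ := κ_balanced f (composite g h) d a x y
      have h₃ : h.obj d c ◁ g.ract c x y ≫ κ g h d y c =
          (α_ _ _ _).inv ≫ κ g h d x c ▷ _ ≫ compRact g h d x y := by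
        rw [h₁, Iso.inv_hom_id_assoc]
      rw [associator_inv_naturality_middle_assoc, ← comp_whiskerRight_assoc, h₃]
      simp only [comp_whiskerRight, Category.assoc]
      rw [h₂, associator_naturality_left_assoc, ← whisker_exchange_assoc (κ g h d x c)]
      simp)

lemma κ_assocAux (f : VModule V A B) (g : VModule V B C) (h : VModule V C D) (d : D) (a : A)
    (c : C) (b : B) : h.obj d c ◁ κ f g c a b ≫ assocAux f g h d a c =
      (α_ _ _ _).inv ≫ κ g h d b c ▷ f.obj b a ≫ κ f (composite g h) d a b :=
  κ_descL ..

/-- Components of the associativity isomorphism. -/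
def assocApp (f : VModule V A B) (g : VModule V B C) (h : VModule V C D) (d : D) (a : A) :
    coend (composite f g) h d a ⟶ coend f (composite g h) d a :=
  desc (composite f g) h d a (fun c => assocAux f g h d a c) (fun x y => by
    apply coend_extL
    intro b
    have h₁ := κ_assocAux f g h d a
    have h₂ := κ_compLact f g x y a b
    rw [whisker_exchange_assoc, h₁, associator_naturality_right_assoc,
      ← MonoidalCategory.whiskerLeft_comp_assoc, h₂]
    simp only [MonoidalCategory.whiskerLeft_comp, Category.assoc]
    rw [h₁]
    have h₃ := κ_balanced g h d b x y
    have h₄ : h.obj d x ◁ g.lact x y b ≫ κ g h d b x =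
        (α_ _ _ _).inv ≫ h.ract d x y ▷ _ ≫ κ g h d b y := by
      rw [h₃, Iso.inv_hom_id_assoc]
    rw [associator_inv_naturality_middle_assoc, ← comp_whiskerRight_assoc (_ ◁ _), h₄]
    simp)

lemma κ_assocApp (f : VModule V A B) (g : VModule V B C) (h : VModule V C D) (d : D) (a : A)
    (c : C) (b : B) :
    h.obj d c ◁ κ f g c a b ≫ κ (composite f g) h d a c ≫ assocApp f g h d a =
      (α_ _ _ _).inv ≫ κ g h d b c ▷ f.obj b a ≫ κ f (composite g h) d a b := by
  rw [assocApp, κ_desc, κ_assocAux]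

lemma κ_assocApp_assoc (f : VModule V A B) (g : VModule V B C) (h : VModule V C D) (d : D) (a : A)
    (c : C) (b : B) {Z : V} (k : coend f (composite g h) d a ⟶ Z) :
    h.obj d c ◁ κ f g c a b ≫ κ (composite f g) h d a c ≫ assocApp f g h d a ≫ k =
      (α_ _ _ _).inv ≫ κ g h d b c ▷ f.obj b a ≫ κ f (composite g h) d a b ≫ k := by
  simpa using κ_assocApp f g h d a c b =≫ k

/-- Auxiliary morphism for the inverse of the associativity isomorphism. -/
def assocInvAux (f : VModule V A B) (g : VModule V B C) (h : VModule V C D) (d : D) (a : A)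
    (b : B) : coend g h d b ⊗ f.obj b a ⟶ coend (composite f g) h d a :=
  descR g h d b (f.obj b a)
    (fun c => (α_ _ _ _).hom ≫ h.obj d c ◁ κ f g c a b ≫ κ (composite f g) h d a c)
    (fun x y => by
      have h₁ := κ_compLact f g x y a b
      have h₂ := κ_balanced (composite f g) h d a x y
      rw [associator_naturality_left_assoc, ← whisker_exchange_assoc, h₂,
        associator_naturality_right_assoc, ← MonoidalCategory.whiskerLeft_comp_assoc, h₁]
      simp)

lemma κ_assocInvAux (f : VModule V A B) (g : VModule V B C) (h : VModule V C D) (d : D) (a : A)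
    (c : C) (b : B) : κ g h d b c ▷ f.obj b a ≫ assocInvAux f g h d a b =
      (α_ _ _ _).hom ≫ h.obj d c ◁ κ f g c a b ≫ κ (composite f g) h d a c :=
  κ_descR ..

/-- Components of the inverse of the associativity isomorphism. -/
def assocInvApp (f : VModule V A B) (g : VModule V B C) (h : VModule V C D) (d : D) (a : A) :
    coend f (composite g h) d a ⟶ coend (composite f g) h d a :=
  desc f (composite g h) d a (fun b => assocInvAux f g h d a b) (fun x y => by
    apply coend_extRR
    intro c
    have h₁ := κ_balanced f g c a x y
    rw [← comp_whiskerRight_assoc (κ g h d x c ▷ _), κ_compRact,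
      associator_naturality_left_assoc, ← whisker_exchange_assoc, κ_assocInvAux]
    simp only [comp_whiskerRight, Category.assoc]
    rw [κ_assocInvAux, associator_naturality_middle_assoc,
      ← MonoidalCategory.whiskerLeft_comp_assoc _ (g.ract c x y ▷ _), h₁]
    simp)

lemma κ_assocInvApp (f : VModule V A B) (g : VModule V B C) (h : VModule V C D) (d : D) (a : A)
    (c : C) (b : B) :
    κ g h d b c ▷ f.obj b a ≫ κ f (composite g h) d a b ≫ assocInvApp f g h d a =
      (α_ _ _ _).hom ≫ h.obj d c ◁ κ f g c a b ≫ κ (composite f g) h d a c := by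
  rw [assocInvApp, κ_desc, κ_assocInvAux]

lemma κ_assocInvApp_assoc (f : VModule V A B) (g : VModule V B C) (h : VModule V C D) (d : D)
    (a : A) (c : C) (b : B) {Z : V} (k : coend (composite f g) h d a ⟶ Z) :
    κ g h d b c ▷ f.obj b a ≫ κ f (composite g h) d a b ≫ assocInvApp f g h d a ≫ k =
      (α_ _ _ _).hom ≫ h.obj d c ◁ κ f g c a b ≫ κ (composite f g) h d a c ≫ k := by
  simpa using κ_assocInvApp f g h d a c b =≫ k

/-- Two morphisms out of a composite of three modules agree when they agree on
`h(d,c) ⊗ (g(c,b) ⊗ f(b,a))`. -/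
lemma coend_ext₃ {f : VModule V A B} {g : VModule V B C} {h : VModule V C D} {d : D} {a : A}
    {Z : V} {s t : coend (composite f g) h d a ⟶ Z}
    (H : ∀ c b, h.obj d c ◁ κ f g c a b ≫ κ (composite f g) h d a c ≫ s =
      h.obj d c ◁ κ f g c a b ≫ κ (composite f g) h d a c ≫ t) : s = t :=
  coend_ext fun c => coend_extL fun b => H c b

lemma coend_ext₃' {f : VModule V A B} {g : VModule V B C} {h : VModule V C D} {d : D} {a : A}
    {Z : V} {s t : coend f (composite g h) d a ⟶ Z}
    (H : ∀ b c, κ g h d b c ▷ f.obj b a ≫ κ f (composite g h) d a b ≫ s =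
      κ g h d b c ▷ f.obj b a ≫ κ f (composite g h) d a b ≫ t) : s = t :=
  coend_ext fun b => coend_extR fun c => H b c

/-- The associativity isomorphism `h ∘ (g ∘ f) ≅ (h ∘ g) ∘ f`. -/
def assoc (f : VModule V A B) (g : VModule V B C) (h : VModule V C D) :
    composite (composite f g) h ≅ composite f (composite g h) :=
  isoMk
    { app := assocApp f g h
      lact_app := fun d d' a => by
        apply coend_extL
        intro c
        apply coend_extLL
        intro b
        rw [κ_compLact_assoc (composite f g) h, associator_inv_naturality_right_assoc,
          whisker_exchange_assoc, κ_assocApp,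
          ← MonoidalCategory.whiskerLeft_comp_assoc _ (κ (composite f g) h d' a c),
          ← MonoidalCategory.whiskerLeft_comp_assoc, κ_assocApp]
        simp only [MonoidalCategory.whiskerLeft_comp, Category.assoc]
        rw [κ_compLact f (composite g h), associator_inv_naturality_middle_assoc,
          ← comp_whiskerRight_assoc _ (compLact g h d d' b), κ_compLact]
        simp
      ract_app := fun d a a' => by
        apply coend_extR
        intro c
        apply coend_extLR
        intro b
        rw [κ_compRact_assoc (composite f g) h, associator_naturality_middle_assoc,
          ← MonoidalCategory.whiskerLeft_comp_assoc _ (κ f g c a b ▷ _), κ_compRact,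
          ← comp_whiskerRight_assoc (κ (composite f g) h d a c),
          ← comp_whiskerRight_assoc, κ_assocApp]
        simp only [MonoidalCategory.whiskerLeft_comp, comp_whiskerRight, Category.assoc]
        rw [κ_assocApp, κ_compRact f (composite g h), associator_naturality_left_assoc,
          ← whisker_exchange_assoc]
        simp }
    (assocInvApp f g h)
    (fun d a => coend_ext₃ fun c b => by
      dsimp only
      rw [κ_assocApp_assoc, κ_assocInvApp, Category.comp_id, Iso.inv_hom_id_assoc])
    (fun d a => coend_ext₃' fun c b => by
      dsimp only
      rw [κ_assocInvApp_assoc, κ_assocApp, Category.comp_id, Iso.hom_inv_id_assoc])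

end VModule

section Bicat

open MonoidalCategory VModule

/-- The objects of the bicategory `V-Mod`: the small `V`-categories. -/
structure VMod (V : Type u) [Category.{v} V] [MonoidalCategory V] where
  /-- The objects of the `V`-category. -/
  carrier : Type w
  [enriched : EnrichedCategory V carrier]
  [small : VSmall V carrier]

attribute [instance] VMod.enriched VMod.small

variable {V : Type u} [Category.{v} V] [MonoidalCategory V] [SymmetricCategory V]
  [MonoidalClosed V] [HasColimits V]

/-- The bicategory `V-Mod` of small `V`-categories, modules and morphisms of modules. The composite
`f ≫ g` of `f : A ⇸ B` and `g : B ⇸ C` is `∫^b g(-,b) ⊗ f(b,-)`. -/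
instance : Bicategory (VMod.{v, u, w} V) where
  Hom A B := VModule V A.carrier B.carrier
  id A := unit V A.carrier
  comp f g := composite f g
  homCategory A B := inferInstanceAs (Category (VModule V A.carrier B.carrier))
  whiskerLeft f _ _ η := whiskL f η
  whiskerRight η g := whiskR η g
  associator f g h := assoc f g h
  leftUnitor f := lu f
  rightUnitor f := ru f
  whiskerLeft_id f g := hom_ext fun c a => coend_ext fun b => by
    dsimp [whiskL]
    rw [κ_appL]; simp
  whiskerLeft_comp f _ _ _ η θ := hom_ext fun c a => coend_ext fun b => by
    dsimp [whiskL]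
    rw [κ_appL, κ_appL_assoc, κ_appL]; simp
  id_whiskerLeft η := by
    rw [← Category.assoc, Iso.eq_comp_inv]
    refine hom_ext fun c a => coend_ext fun b => ?_
    change κ _ _ _ _ _ ≫ appL _ η c a ≫ luApp _ c a = κ _ _ _ _ _ ≫ luApp _ c a ≫ η.app c a
    rw [κ_appL_assoc, κ_luApp_assoc, κ_luApp, η.ract_app]
  comp_whiskerLeft f g _ _ η := by
    rw [← Category.assoc, Iso.eq_comp_inv]
    refine hom_ext fun c a => coend_ext₃ fun b b' => ?_
    change _ ≫ _ ≫ appL _ η c a ≫ assocApp _ _ _ c a =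
      _ ≫ _ ≫ assocApp _ _ _ c a ≫ appL f (whiskL g η) c a
    rw [κ_appL_assoc, κ_assocApp_assoc, κ_appL, whisker_exchange_assoc, κ_assocApp,
      whiskL_app, ← comp_whiskerRight_assoc (κ _ _ _ _ _), κ_appL]
    simp
  id_whiskerRight f g := hom_ext fun c a => coend_ext fun b => by
    dsimp [whiskR]
    rw [κ_appR]; simp
  comp_whiskerRight η θ g := hom_ext fun c a => coend_ext fun b => by
    dsimp [whiskR]
    rw [κ_appR, κ_appR_assoc, κ_appR]; simp
  whiskerRight_id η := by
    rw [← Category.assoc, Iso.eq_comp_inv]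
    refine hom_ext fun c a => coend_ext fun b => ?_
    change κ _ _ _ _ _ ≫ appR η _ c a ≫ ruApp _ c a = κ _ _ _ _ _ ≫ ruApp _ c a ≫ η.app c a
    rw [κ_appR_assoc, κ_ruApp_assoc, κ_ruApp, η.lact_app]
  whiskerRight_comp η g h := by
    rw [Iso.eq_inv_comp]
    refine hom_ext fun c a => coend_ext₃ fun b b' => ?_
    change _ ≫ _ ≫ assocApp _ _ _ c a ≫ appR η _ c a =
      _ ≫ _ ≫ appR (whiskR η g) h c a ≫ assocApp _ _ _ c a
    rw [κ_appR_assoc, κ_assocApp_assoc, κ_appR, ← whisker_exchange_assoc, whiskR_app,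
      ← MonoidalCategory.whiskerLeft_comp_assoc, κ_appR]
    simp only [MonoidalCategory.whiskerLeft_comp, Category.assoc]
    rw [κ_assocApp]
    simp
  whisker_assoc f _ _ η h := by
    rw [← Category.assoc, Iso.eq_comp_inv]
    refine hom_ext fun c a => coend_ext₃ fun b b' => ?_
    change _ ≫ _ ≫ appR (whiskL f η) h c a ≫ assocApp _ _ _ c a =
      _ ≫ _ ≫ assocApp _ _ _ c a ≫ appL f (whiskR η h) c a
    rw [κ_appR_assoc, κ_assocApp_assoc, κ_appL, whiskL_app, whiskR_app,
      ← MonoidalCategory.whiskerLeft_comp_assoc, κ_appL, ← comp_whiskerRight_assoc (κ _ _ _ _ _),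
      κ_appR]
    simp only [MonoidalCategory.whiskerLeft_comp, comp_whiskerRight, Category.assoc]
    rw [κ_assocApp]
    simp
  whisker_exchange η θ := hom_ext fun c a => coend_ext fun b => by
    change κ _ _ _ _ _ ≫ appL _ θ c a ≫ appR η _ c a = κ _ _ _ _ _ ≫ appR η _ c a ≫ appL _ θ c a
    rw [κ_appL_assoc, κ_appR_assoc, κ_appL, κ_appR, whisker_exchange_assoc]
  pentagon f g h i := hom_ext fun c a => coend_ext fun d => coend_extL fun d' =>
      coend_extLL fun b => by
    change _ ≫ _ ≫ κ _ _ _ _ _ ≫ appR (assoc f g h).hom i c a ≫ assocApp f (composite g h) i c a ≫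
        appL f (assoc g h i).hom c a =
      _ ≫ _ ≫ κ _ _ _ _ _ ≫ assocApp (composite f g) h i c a ≫ assocApp f g (composite h i) c a
    have e₁ : ∀ x y, (assoc f g h).hom.app x y = assocApp f g h x y := fun _ _ => rfl
    have e₂ : ∀ x y, (assoc g h i).hom.app x y = assocApp g h i x y := fun _ _ => rfl
    have H := κ_assocApp f g (composite h i) c a d' b
    have H' := κ_assocApp f g h d a d' b
    rw [κ_appR_assoc, e₁, κ_assocApp_assoc (composite f g) h i,
      associator_inv_naturality_right_assoc, whisker_exchange_assoc, H,
      ← MonoidalCategory.whiskerLeft_comp_assoc, ← MonoidalCategory.whiskerLeft_comp_assoc,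
      Category.assoc, H']
    simp only [MonoidalCategory.whiskerLeft_comp, Category.assoc]
    rw [κ_assocApp_assoc f (composite g h) i, κ_appL, e₂, associator_inv_naturality_middle_assoc,
      ← comp_whiskerRight_assoc (κ _ _ _ _ _), ← comp_whiskerRight_assoc (_ ◁ _), κ_assocApp]
    simp
  triangle f g := hom_ext fun c a => coend_ext₃ fun b b' => by
    change _ ≫ κ _ _ _ _ _ ≫ assocApp f _ g c a ≫ appL f (lu g).hom c a =
      _ ≫ κ _ _ _ _ _ ≫ appR (ru f).hom g c a
    have e₁ : ∀ x y, (lu g).hom.app x y = luApp g x y := fun _ _ => rfl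
    have e₂ : ∀ x y, (ru f).hom.app x y = ruApp f x y := fun _ _ => rfl
    rw [κ_assocApp_assoc, κ_appL, κ_appR, e₁, e₂, ← comp_whiskerRight_assoc, κ_luApp,
      ← MonoidalCategory.whiskerLeft_comp_assoc, κ_ruApp, κ_balanced, Iso.inv_hom_id_assoc]

end Bicat

section FunctorCategory

open MonoidalCategory

section

variable {V : Type u} [Category.{v} V] [MonoidalCategory V]
variable {A : Type w₁} [EnrichedCategory V A] {B : Type w₂} [EnrichedCategory V B]
  {D : Type w₃} [EnrichedCategory V D]

/-- The module `D(F-,G-) : A ⇸ B` of two `V`-functors `F : B ⥤ D` and `G : A ⥤ D`. -/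
@[reducible]
def homModule (F : EnrichedFunctor V B D) (G : EnrichedFunctor V A D) : VModule V A B where
  obj b a := F.obj b ⟶[V] G.obj a
  lact b b' a := F.map b b' ▷ _ ≫ eComp V (F.obj b) (F.obj b') (G.obj a)
  ract b a a' := _ ◁ G.map a a' ≫ eComp V (F.obj b) (G.obj a) (G.obj a')
  id_lact b a := by
    rw [← comp_whiskerRight_assoc, F.map_id, ← cancel_epi (λ_ _).inv, e_id_comp, Iso.inv_hom_id]
  comp_lact b b' b'' a := by
    have := e_assoc' V (F.obj b) (F.obj b') (F.obj b'') (G.obj a)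
    rw [← comp_whiskerRight_assoc, F.map_comp, comp_whiskerRight_assoc, ← this,
      MonoidalCategory.tensorHom_def, comp_whiskerRight_assoc,
      associator_naturality_middle_assoc, associator_naturality_left_assoc,
      ← MonoidalCategory.whiskerLeft_comp_assoc, ← whisker_exchange_assoc]
  ract_id b a := by
    rw [← MonoidalCategory.whiskerLeft_comp_assoc, G.map_id, ← cancel_epi (ρ_ _).inv, e_comp_id,
      Iso.inv_hom_id]
  ract_comp b a a' a'' := by
    have := e_assoc V (F.obj b) (G.obj a) (G.obj a') (G.obj a'')
    rw [← MonoidalCategory.whiskerLeft_comp_assoc, G.map_comp,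
      MonoidalCategory.whiskerLeft_comp_assoc, ← this, MonoidalCategory.tensorHom_def,
      MonoidalCategory.whiskerLeft_comp_assoc, associator_inv_naturality_right_assoc,
      associator_inv_naturality_middle_assoc, whisker_exchange_assoc]
    simp
  lact_ract b b' a a' := by
    have := e_assoc' V (F.obj b) (F.obj b') (G.obj a) (G.obj a')
    rw [comp_whiskerRight_assoc, ← whisker_exchange_assoc, ← this,
      associator_naturality_right_assoc, associator_naturality_left_assoc,
      ← whisker_exchange_assoc, ← whisker_exchange_assoc]
    simp

end

section

variable {V : Type u} [Category.{v} V] [MonoidalCategory V] [SymmetricCategory V]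
variable {C : Type w₁} [EnrichedCategory V C] {D : Type w₂} [EnrichedCategory V D]

lemma isWedge_comp {M : VModule V C C} {T T' : V} {σ : ∀ x, T ⟶ M.obj x x} (hσ : IsWedge M σ)
    (t : T' ⟶ T) : IsWedge M fun x => t ≫ σ x := fun x y => by
  rw [comp_whiskerRight_assoc, hσ, BraidedCategory.braiding_naturality_left_assoc,
    MonoidalCategory.whiskerLeft_comp_assoc]

lemma isWedge_id (F : EnrichedFunctor V C D) :
    IsWedge (homModule F F) fun x => eId V (F.obj x) := fun x y => by
  have h₁ := e_id_comp V (F.obj x) (F.obj y)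
  have h₂ := e_comp_id V (F.obj x) (F.obj y)
  dsimp only
  rw [← whisker_exchange_assoc, ← cancel_epi (λ_ _).inv,
    ← leftUnitor_inv_naturality_assoc, h₁, whisker_exchange_assoc,
    leftUnitor_inv_braiding_assoc, ← rightUnitor_inv_naturality_assoc, h₂]

lemma isWedge_mul {F G H : EnrichedFunctor V C D} {P Q : V}
    {p : ∀ x, P ⟶ (F.obj x ⟶[V] G.obj x)} {q : ∀ x, Q ⟶ (G.obj x ⟶[V] H.obj x)}
    (hp : IsWedge (homModule F G) p) (hq : IsWedge (homModule G H) q) :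
    IsWedge (homModule F H) fun x => (p x ⊗ₘ q x) ≫ eComp V _ (G.obj x) _ := fun x y => by
  have e₁ := e_assoc' V (F.obj x) (G.obj x) (H.obj x) (H.obj y)
  have e₂ := e_assoc V (F.obj x) (G.obj x) (G.obj y) (H.obj y)
  have e₂' := e_assoc' V (F.obj x) (G.obj x) (G.obj y) (H.obj y)
  have e₃ := e_assoc' V (F.obj x) (F.obj y) (G.obj y) (H.obj y)
  have hp' := hp x y
  have hq' := hq x y
  dsimp only at hp' hq' ⊢
  rw [MonoidalCategory.tensorHom_def', MonoidalCategory.tensorHom_def']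
  calc
    _ = (α_ P Q (x ⟶[V] y)).hom ≫ P ◁ (q x ▷ (x ⟶[V] y) ≫ _ ◁ H.map x y ≫
          eComp V (G.obj x) (H.obj x) (H.obj y)) ≫ p x ▷ _ ≫ eComp V _ _ _ := by
      rw [comp_whiskerRight_assoc, comp_whiskerRight_assoc, ← whisker_exchange_assoc (eComp V _ _ _),
        ← e₁]
      simp only [MonoidalCategory.whiskerLeft_comp, Category.assoc]
      rw [whisker_exchange_assoc (p x), whisker_exchange_assoc (p x)]
      simp
    _ = (α_ P Q (x ⟶[V] y)).hom ≫ P ◁ (β_ Q (x ⟶[V] y)).hom ≫ (α_ P (x ⟶[V] y) Q).inv ≫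
          (P ⊗ (x ⟶[V] y)) ◁ q y ≫ (p x ▷ (x ⟶[V] y) ≫ _ ◁ G.map x y ≫
          eComp V (F.obj x) (G.obj x) (G.obj y)) ▷ _ ≫ eComp V _ _ _ := by
      rw [hq']
      simp only [MonoidalCategory.whiskerLeft_comp, Category.assoc]
      rw [whisker_exchange_assoc (p x), ← e₂, ← whisker_exchange_assoc (p x)]
      simp [e₂']
    _ = _ := by
      rw [hp', BraidedCategory.braiding_tensor_left_hom]
      simp only [MonoidalCategory.whiskerLeft_comp, comp_whiskerRight, Category.assoc]
      rw [← e₃, whisker_exchange_assoc (F.map x y), whisker_exchange_assoc (β_ _ _).hom]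
      simp

end

variable {V : Type u} [Category.{v} V] [MonoidalCategory V] [SymmetricCategory V]
  [MonoidalClosed V] [HasLimits V]
variable {C : Type w₁} [EnrichedCategory V C] [VSmall V C] {D : Type w₂} [EnrichedCategory V D]

theorem exists_nat (F G : EnrichedFunctor V C D) :
    ∃ (N : V) (π : ∀ x, N ⟶ (F.obj x ⟶[V] G.obj x)), IsWedge (homModule F G) π ∧
      ∀ (T : V) (σ : ∀ x, T ⟶ (F.obj x ⟶[V] G.obj x)), IsWedge (homModule F G) σ →
        ∃! t : T ⟶ N, ∀ x, t ≫ π x = σ x :=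
  have := essentiallySmall_forget V C
  exists_end (X := ForgetEnrichment V C) (homModule F G)

/-- The object `∫_x D(F x, G x)` of `V`-natural transformations from `F` to `G`. -/
def natObj (F G : EnrichedFunctor V C D) : V := (exists_nat F G).choose

/-- The projections `∫_x D(F x, G x) ⟶ D(F x, G x)`. -/
def natπ (F G : EnrichedFunctor V C D) (x : C) : natObj F G ⟶ (F.obj x ⟶[V] G.obj x) :=
  (exists_nat F G).choose_spec.choose x

lemma natπ_wedge (F G : EnrichedFunctor V C D) : IsWedge (homModule F G) (natπ F G) :=
  (exists_nat F G).choose_spec.choose_spec.1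

/-- The morphism into `∫_x D(F x, G x)` given by a `V`-natural family. -/
def natLift (F G : EnrichedFunctor V C D) {T : V} (σ : ∀ x, T ⟶ (F.obj x ⟶[V] G.obj x))
    (hσ : IsWedge (homModule F G) σ) : T ⟶ natObj F G :=
  ((exists_nat F G).choose_spec.choose_spec.2 T σ hσ).choose

lemma natLift_π (F G : EnrichedFunctor V C D) {T : V} (σ : ∀ x, T ⟶ (F.obj x ⟶[V] G.obj x))
    (hσ : IsWedge (homModule F G) σ) (x : C) : natLift F G σ hσ ≫ natπ F G x = σ x :=
  ((exists_nat F G).choose_spec.choose_spec.2 T σ hσ).choose_spec.1 x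

lemma nat_ext {F G : EnrichedFunctor V C D} {T : V} {s t : T ⟶ natObj F G}
    (h : ∀ x, s ≫ natπ F G x = t ≫ natπ F G x) : s = t :=
  ((exists_nat F G).choose_spec.choose_spec.2 T _ (isWedge_comp (natπ_wedge F G) t)).unique h
    (fun _ => rfl)

/-- The functor `V`-category `[C,D]`, for `C` small. -/
instance : EnrichedCategory V (EnrichedFunctor V C D) where
  Hom F G := natObj F G
  id F := natLift F F (fun x => eId V (F.obj x)) (isWedge_id F)
  comp F G H := natLift F H (fun x => (natπ F G x ⊗ₘ natπ G H x) ≫ eComp V _ (G.obj x) _)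
    (isWedge_mul (natπ_wedge F G) (natπ_wedge G H))
  id_comp F G := nat_ext fun x => by
    rw [Category.assoc, Category.assoc, natLift_π, Category.id_comp,
      MonoidalCategory.tensorHom_def, Category.assoc, ← comp_whiskerRight_assoc, natLift_π,
      ← whisker_exchange_assoc, ← leftUnitor_inv_naturality_assoc, e_id_comp, Category.comp_id]
  comp_id F G := nat_ext fun x => by
    rw [Category.assoc, Category.assoc, natLift_π, Category.id_comp,
      MonoidalCategory.tensorHom_def', Category.assoc, ← MonoidalCategory.whiskerLeft_comp_assoc,
      natLift_π, whisker_exchange_assoc, ← rightUnitor_inv_naturality_assoc, e_comp_id,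
      Category.comp_id]
  assoc F G H K := nat_ext fun x => by
    have := e_assoc' V (F.obj x) (G.obj x) (H.obj x) (K.obj x)
    simp only [Category.assoc, natLift_π]
    rw [MonoidalCategory.tensorHom_def, Category.assoc, ← comp_whiskerRight_assoc, natLift_π,
      MonoidalCategory.tensorHom_def' (natπ F G x) (natπ G K x), Category.assoc,
      ← MonoidalCategory.whiskerLeft_comp_assoc, natLift_π]
    simp only [MonoidalCategory.whiskerLeft_comp, comp_whiskerRight, Category.assoc]
    rw [← whisker_exchange_assoc (eComp V _ _ _), ← this, MonoidalCategory.tensorHom_def,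
      MonoidalCategory.tensorHom_def]
    simp only [MonoidalCategory.whiskerLeft_comp, comp_whiskerRight, Category.assoc]
    rw [whisker_exchange_assoc (natπ F G x), whisker_exchange_assoc (natπ F G x),
      whisker_exchange_assoc (natπ F G x)]
    simp

lemma nat_id_π (F : EnrichedFunctor V C D) (x : C) : eId V F ≫ natπ F F x = eId V (F.obj x) :=
  natLift_π F F _ (isWedge_id F) x

lemma nat_comp_π (F G H : EnrichedFunctor V C D) (x : C) :
    eComp V F G H ≫ natπ F H x = (natπ F G x ⊗ₘ natπ G H x) ≫ eComp V _ (G.obj x) _ :=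
  natLift_π F H _ (isWedge_mul (natπ_wedge F G) (natπ_wedge G H)) x

end FunctorCategory

section Colimits

open MonoidalCategory

section

variable {V : Type u} [Category.{v} V] [MonoidalCategory V] [SymmetricCategory V]
  [MonoidalClosed V]
variable {C : Type w₁} [EnrichedCategory V C] {A : Type w₂} [EnrichedCategory V A]
  {A' : Type w₃} [EnrichedCategory V A']

/-- `V`-naturality of a family `T ⟶ [F x, G x]` in terms of its transposes `F x ⊗ T ⟶ G x`. -/
lemma isWedge_of_act (F G : EnrichedFunctor V C V) {T : V} (k : ∀ x, F.obj x ⊗ T ⟶ G.obj x)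
    (hk : ∀ x y, k x ▷ (x ⟶[V] y) ≫ act G x y =
      (α_ _ _ _).hom ≫ F.obj x ◁ (β_ T _).hom ≫ (α_ _ _ _).inv ≫ act F x y ▷ T ≫ k y) :
    IsWedge (homModule F G) fun x => MonoidalClosed.curry (k x) := fun x y => by
  have h := hk x y
  apply MonoidalClosed.uncurry_injective
  have e₁ := tensorHom_compTranspose (MonoidalClosed.curry (k x)) (G.map x y)
  have e₂ := tensorHom_compTranspose (F.map x y) (MonoidalClosed.curry (k y))
  rw [MonoidalClosed.uncurry_curry] at e₁ e₂
  dsimp only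
  rw [MonoidalClosed.enrichedCategorySelf_comp, MonoidalClosed.enrichedCategorySelf_comp,
    MonoidalClosed.comp_eq, MonoidalClosed.comp_eq, ← MonoidalCategory.tensorHom_def_assoc,
    ← MonoidalCategory.tensorHom_def'_assoc, MonoidalClosed.uncurry_natural_left,
    MonoidalClosed.uncurry_natural_left, MonoidalClosed.uncurry_natural_left,
    MonoidalClosed.uncurry_curry, MonoidalClosed.uncurry_curry]
  refine Eq.trans e₁ (Eq.trans ?_ (congrArg (_ ◁ _ ≫ ·) e₂).symm)
  have h' := (α_ _ _ _).inv ≫= h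
  simpa only [act, Iso.inv_hom_id_assoc] using h'

lemma cocone_map_aux (F : EnrichedFunctor V A A') {X Y L : V} {r s p : A} (e : X ⊗ L ⟶ Y)
    (m : L ⟶ (s ⟶[V] r)) (i : X ⟶ (r ⟶[V] p)) (j : Y ⟶ (s ⟶[V] p))
    (h : e ≫ j = i ▷ L ≫ _ ◁ m ≫ (β_ _ _).hom ≫ eComp V s r p) :
    e ≫ j ≫ F.map s p = (i ≫ F.map r p) ▷ L ≫ _ ◁ (m ≫ F.map s r) ≫ (β_ _ _).hom ≫
      eComp V (F.obj s) (F.obj r) (F.obj p) := by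
  have h' := h =≫ F.map s p
  rw [Category.assoc] at h'
  rw [h']
  simp only [Category.assoc, F.map_comp, comp_whiskerRight, MonoidalCategory.whiskerLeft_comp]
  rw [MonoidalCategory.tensorHom_def', Category.assoc,
    ← BraidedCategory.braiding_naturality_left_assoc,
    ← BraidedCategory.braiding_naturality_right_assoc, whisker_exchange_assoc (F.map r p)]

lemma comparison_aux {X Y L : V} {r s p a : A} (e : X ⊗ L ⟶ Y)
    (m : L ⟶ (s ⟶[V] r)) (i : X ⟶ (r ⟶[V] p)) (j : Y ⟶ (s ⟶[V] p))
    (h : e ≫ j = i ▷ L ≫ _ ◁ m ≫ (β_ _ _).hom ≫ eComp V s r p) :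
    (i ▷ (p ⟶[V] a) ≫ eComp V r p a) ▷ L ≫ _ ◁ m ≫ (β_ _ _).hom ≫ eComp V s r a =
      (α_ _ _ _).hom ≫ X ◁ (β_ (p ⟶[V] a) L).hom ≫ (α_ _ _ _).inv ≫ e ▷ (p ⟶[V] a) ≫
        j ▷ (p ⟶[V] a) ≫ eComp V s p a := by
  have e' := e_assoc' V s r p a
  rw [← comp_whiskerRight_assoc e, h]
  simp only [comp_whiskerRight, Category.assoc]
  rw [← e', ← whisker_exchange_assoc (eComp V _ _ _),
    BraidedCategory.braiding_naturality_left_assoc, BraidedCategory.braiding_tensor_left_hom]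
  simp only [Category.assoc, tensor_whiskerLeft, Iso.inv_hom_id_assoc]
  rw [← MonoidalCategory.whiskerLeft_comp_assoc _ (_ ◁ m) (β_ _ _).hom,
    BraidedCategory.braiding_naturality_right, MonoidalCategory.whiskerLeft_comp_assoc,
    associator_inv_naturality_middle_assoc, associator_naturality_left_assoc,
    ← whisker_exchange_assoc i, associator_inv_naturality_left_assoc]

lemma yoneda_aux (b b' : A) (x y : A) :
    eComp V x b b' ▷ (y ⟶[V] x) ≫ (β_ _ _).hom ≫ eComp V y x b' =
      (α_ _ _ _).hom ≫ (x ⟶[V] b) ◁ (β_ (b ⟶[V] b') (y ⟶[V] x)).hom ≫ (α_ _ _ _).inv ≫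
        ((β_ _ _).hom ≫ eComp V y x b) ▷ _ ≫ eComp V y b b' := by
  have e' := e_assoc' V y x b b'
  simp only [comp_whiskerRight, Category.assoc]
  rw [← e', BraidedCategory.braiding_naturality_left_assoc,
    BraidedCategory.braiding_tensor_left_hom]
  simp

lemma act_homTo (a : A) (x y : Aᵒᵖ) :
    act (homTo a) x y = (β_ (x.unop ⟶[V] a) (y.unop ⟶[V] x.unop)).hom ≫
      eComp V y.unop x.unop a :=
  MonoidalClosed.uncurry_curry _

/-- The presheaf `A(S-,a) : Kᵒᵖ ⥤ V`. -/
def homAlong (S : EnrichedFunctor V C A) (a : A) : EnrichedFunctor V Cᵒᵖ V :=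
  (opFunctor S).comp V (homTo a)

lemma act_homAlong (S : EnrichedFunctor V C A) (a : A) (x y : Cᵒᵖ) :
    act (homAlong S a) x y = (S.obj x.unop ⟶[V] a) ◁ S.map y.unop x.unop ≫ (β_ _ _).hom ≫
      eComp V (S.obj y.unop) (S.obj x.unop) a := by
  have h := MonoidalClosed.uncurry_natural_left (S.map y.unop x.unop)
    ((homTo a).map (Opposite.op (S.obj x.unop)) (Opposite.op (S.obj y.unop)))
  exact h.trans (congrArg _ (act_homTo _ _ _))

/-- A cocone under `S : K ⥤ A` with weight `φ : Kᵒᵖ ⥤ V`: an object `a` of `A` with a `V`-natural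
transformation `φ ⟶ A(S-,a)`. -/
structure WeightedCocone (φ : EnrichedFunctor V Cᵒᵖ V) (S : EnrichedFunctor V C A) where
  /-- The vertex of the cocone. -/
  pt : A
  /-- The components of the transformation `φ ⟶ A(S-,a)`. -/
  ι (x : Cᵒᵖ) : φ.obj x ⟶ (S.obj x.unop ⟶[V] pt)
  naturality (x y : Cᵒᵖ) :
    act φ x y ≫ ι y = ι x ▷ (x ⟶[V] y) ≫ act (homAlong S pt) x y

/-- The image of a weighted cocone under a `V`-functor. -/
@[simps]
def WeightedCocone.map {φ : EnrichedFunctor V Cᵒᵖ V} {S : EnrichedFunctor V C A}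
    (c : WeightedCocone φ S) (F : EnrichedFunctor V A A') : WeightedCocone φ (S.comp V F) where
  pt := F.obj c.pt
  ι x := c.ι x ≫ F.map _ _
  naturality x y := by
    have h := c.naturality x y
    rw [act_homAlong] at h ⊢
    exact cocone_map_aux F _ (S.map y.unop x.unop) (c.ι x) (c.ι y) h

variable [HasLimits V] [VSmall V C]

/-- The canonical comparison `A(c,a) ⟶ [Kᵒᵖ,V](φ, A(S-,a))` of a weighted cocone with vertex `c`. -/
def WeightedCocone.comparison {φ : EnrichedFunctor V Cᵒᵖ V} {S : EnrichedFunctor V C A}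
    (c : WeightedCocone φ S) (a : A) : (c.pt ⟶[V] a) ⟶ natObj φ (homAlong S a) :=
  natLift φ (homAlong S a)
    (fun x => MonoidalClosed.curry (c.ι x ▷ _ ≫ eComp V (S.obj x.unop) c.pt a))
    (isWedge_of_act φ (homAlong S a) _ fun x y => by
      have h := c.naturality x y
      rw [act_homAlong] at h ⊢
      exact comparison_aux _ (S.map y.unop x.unop) (c.ι x) (c.ι y) h)

/-- A weighted cocone with vertex `c` is a colimit `φ * S` when it induces isomorphisms
`A(c,a) ≅ [Kᵒᵖ,V](φ, A(S-,a))`. -/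
def WeightedCocone.IsColimit {φ : EnrichedFunctor V Cᵒᵖ V} {S : EnrichedFunctor V C A}
    (c : WeightedCocone φ S) : Prop :=
  ∀ a, IsIso (c.comparison a)

/-- The `V`-functor `F` preserves the colimit `φ * S`. -/
def PreservesWeightedColimit (φ : EnrichedFunctor V Cᵒᵖ V) (S : EnrichedFunctor V C A)
    (F : EnrichedFunctor V A A') : Prop :=
  ∀ c : WeightedCocone φ S, c.IsColimit → (c.map F).IsColimit

end

section

variable {V : Type u} [Category.{v} V] [MonoidalCategory V] [SymmetricCategory V]
  [MonoidalClosed V] [HasLimits V]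

/-- A `V`-functor is cocontinuous when it preserves all small weighted colimits. The set of objects
of the small `V`-category `K` may lie in any universe containing the small sets; only its set of
isomorphism classes has to be small. -/
def Cocontinuous {A : Type w₁} [EnrichedCategory V A] {A' : Type w₂} [EnrichedCategory V A']
    (F : EnrichedFunctor V A A') : Prop :=
  ∀ (K : Type (max v w)) [EnrichedCategory V K] [VSmall V K] (θ : EnrichedFunctor V Kᵒᵖ V)
    (S : EnrichedFunctor V K A), PreservesWeightedColimit θ S F

variable {B : Type w} [EnrichedCategory V B] [VSmall V B]

/-- The Yoneda embedding `Y : B ⥤ [Bᵒᵖ,V]`. -/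
def enrichedYoneda : EnrichedFunctor V B (EnrichedFunctor V Bᵒᵖ V) where
  obj b := homTo b
  map b b' := natLift (homTo b) (homTo b')
    (fun x => MonoidalClosed.curry (eComp V x.unop b b'))
    (isWedge_of_act (homTo b) (homTo b') _ fun x y => by
      rw [act_homTo, act_homTo]
      exact yoneda_aux b b' x.unop y.unop)
  map_id b := nat_ext fun x => by
    rw [Category.assoc, natLift_π, nat_id_π]
    exact (homFrom x.unop).map_id b
  map_comp b b' b'' := nat_ext fun x => by
    rw [Category.assoc, Category.assoc, natLift_π, nat_comp_π,
      MonoidalCategory.tensorHom_comp_tensorHom_assoc, natLift_π, natLift_π]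
    exact (homFrom x.unop).map_comp b b' b''

/-- The representable `V`-functor `{φ,-} = [Bᵒᵖ,V](φ,-) : [Bᵒᵖ,V] ⥤ V`. -/
def weightedHom (φ : EnrichedFunctor V Bᵒᵖ V) : EnrichedFunctor V (EnrichedFunctor V Bᵒᵖ V) V :=
  homFrom φ

end

end Colimits

section PresheafModules

open MonoidalCategory

variable {V : Type u} [Category.{v} V] [MonoidalCategory V] [SymmetricCategory V]
  [MonoidalClosed V]

/-- The small `V`-category `B` as an object of `V-Mod`. -/
abbrev VMod.of (V : Type u) [Category.{v} V] [MonoidalCategory V] (B : Type w)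
    [EnrichedCategory V B] [VSmall V B] : VMod.{v, u, w} V := ⟨B⟩

/-- The unit `V`-category as an object of `V-Mod`. -/
abbrev unitObj (V : Type u) [Category.{v} V] [MonoidalCategory V] : VMod.{v, u, w} V :=
  VMod.of V UnitObj.{w}

lemma comp_lact_aux {X Y Z H H' K : V} (c : H ⊗ H' ⟶ K) (p : X ⊗ K ⟶ Z) (q : X ⊗ H' ⟶ Y)
    (r : Y ⊗ H ⟶ Z)
    (h : X ◁ ((β_ H' H).hom ≫ c) ≫ p = (α_ _ _ _).inv ≫ q ▷ H ≫ r) :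
    c ▷ X ≫ (β_ _ _).hom ≫ p = (α_ _ _ _).hom ≫ H ◁ ((β_ _ _).hom ≫ q) ≫ (β_ _ _).hom ≫ r := by
  have h' : X ◁ c ≫ p = X ◁ (β_ H H').hom ≫ (α_ _ _ _).inv ≫ q ▷ H ≫ r := by
    rw [← h, ← MonoidalCategory.whiskerLeft_comp_assoc, SymmetricCategory.symmetry_assoc]
  rw [BraidedCategory.braiding_naturality_left_assoc, h', MonoidalCategory.whiskerLeft_comp_assoc,
    BraidedCategory.braiding_naturality_right_assoc, BraidedCategory.braiding_tensor_left_hom,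
    BraidedCategory.braiding_tensor_right_hom]
  simp only [Category.assoc]

/-- The module `𝓘 ⇸ B` given by a presheaf `φ : Bᵒᵖ ⥤ V`. -/
def presheafModule {B : Type w} [EnrichedCategory V B] (φ : EnrichedFunctor V Bᵒᵖ V) :
    VModule V UnitObj.{w} B where
  obj b _ := φ.obj (Opposite.op b)
  lact b b' _ := (β_ _ _).hom ≫ act φ (Opposite.op b') (Opposite.op b)
  ract b _ _ := (ρ_ (φ.obj (Opposite.op b))).hom
  id_lact b _ := by
    have h : _ ◁ eId V b ≫ act φ (Opposite.op b) (Opposite.op b) = _ :=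
      act_id φ (Opposite.op b)
    rw [BraidedCategory.braiding_naturality_left_assoc, h, braiding_rightUnitor]
  comp_lact b b' b'' _ := by
    exact comp_lact_aux _ _ _ _
      (act_comp φ (Opposite.op b'') (Opposite.op b') (Opposite.op b))
  ract_id b _ := by
    have h : φ.obj (Opposite.op b) ◁ 𝟙 (𝟙_ V) ≫ (ρ_ (φ.obj (Opposite.op b))).hom = (ρ_ (φ.obj (Opposite.op b))).hom := by simp
    exact h
  ract_comp b _ _ _ := by
    have h : φ.obj (Opposite.op b) ◁ (λ_ (𝟙_ V)).hom ≫ (ρ_ (φ.obj (Opposite.op b))).hom =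
        (α_ (φ.obj (Opposite.op b)) (𝟙_ V) (𝟙_ V)).inv ≫ (ρ_ (φ.obj (Opposite.op b))).hom ▷ 𝟙_ V ≫ (ρ_ (φ.obj (Opposite.op b))).hom := by
      simp [MonoidalCategory.unitors_equal]
    exact h
  lact_ract b b' _ _ := by
    have h : ((β_ (b ⟶[V] b') _).hom ≫ act φ (Opposite.op b') (Opposite.op b)) ▷ 𝟙_ V ≫
        (ρ_ (φ.obj (Opposite.op b))).hom = (α_ _ _ _).hom ≫ (b ⟶[V] b') ◁ (ρ_ (φ.obj (Opposite.op b'))).hom ≫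
          (β_ _ _).hom ≫ act φ (Opposite.op b') (Opposite.op b) := by simp
    exact h

/-- The module `B ⇸ 𝓘` given by a `V`-functor `ψ : B ⥤ V`. -/
def copresheafModule {B : Type w} [EnrichedCategory V B] (ψ : EnrichedFunctor V B V) :
    VModule V B UnitObj.{w} where
  obj _ b := ψ.obj b
  lact _ _ b := (λ_ (ψ.obj b)).hom
  ract _ b b' := act ψ b b'
  id_lact _ b := by
    have h : 𝟙 (𝟙_ V) ▷ ψ.obj b ≫ (λ_ (ψ.obj b)).hom = (λ_ (ψ.obj b)).hom := by simp
    exact h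
  comp_lact _ _ _ b := by
    have h : (λ_ (𝟙_ V)).hom ▷ ψ.obj b ≫ (λ_ (ψ.obj b)).hom =
        (α_ _ _ _).hom ≫ 𝟙_ V ◁ (λ_ (ψ.obj b)).hom ≫ (λ_ (ψ.obj b)).hom := by simp
    exact h
  ract_id _ b := act_id ψ b
  ract_comp _ b b' b'' := act_comp ψ b b' b''
  lact_ract _ _ b b' := by
    have h : (λ_ (ψ.obj b)).hom ▷ (b ⟶[V] b') ≫ act ψ b b' =
        (α_ _ _ _).hom ≫ 𝟙_ V ◁ act ψ b b' ≫ (λ_ (ψ.obj b')).hom := by simp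
    exact h

variable [HasLimits V] [HasColimits V] {B : Type w} [EnrichedCategory V B] [VSmall V B]

/-- The 1-cell `φ̄ : 𝓘 ⇸ B` of `V-Mod` given by a presheaf `φ : Bᵒᵖ ⥤ V`. -/
def overline (φ : EnrichedFunctor V Bᵒᵖ V) : unitObj.{v, u, w} V ⟶ VMod.of V B :=
  presheafModule φ

/-- The 1-cell `ψ̲ : B ⇸ 𝓘` of `V-Mod` given by a `V`-functor `ψ : B ⥤ V`. -/
def underline (ψ : EnrichedFunctor V B V) : VMod.of V B ⟶ unitObj.{v, u, w} V :=
  copresheafModule ψ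

end PresheafModules

end EnrichedModules

end

/-! A right adjoint of `overline φ` is a module `r : B ⇸ 𝓘` with a counit, which amounts to a
pairing `φ b ⊗ r(x) ⟶ B(b,x)`, and a unit, which amounts to a morphism `η : 𝟙_ V ⟶ ∫^x r(x) ⊗ φ x`.
Any such pairing, followed by the action of `B` on a presheaf `F`, induces a comparison `tensorToHom
ε F : ∫^x r(x) ⊗ F x ⟶ [Bᵒᵖ,V](φ,F)`, natural in `F`. The whole argument is about this comparison.

From an adjunction to cocontinuity: the left triangle identity says that `η` is sent by the
comparison at `φ` to the identity of `φ`. Inserting `η` and evaluating then gives a map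
`[Bᵒᵖ,V](φ,F) ⟶ ∫^x r(x) ⊗ F x`, and the two triangle identities make it inverse to the comparison
(`isIso_tensorToHom`). So `{φ,-}` is tensoring with `r`, which has the right adjoint `Z ↦ [r(-),Z]`
(`homCoHomIso`), and a functor `F` whose presheaves `A'(F-,a')` are all representable preserves
colimits (`preservesWeightedColimit_of_representable`).

From preservation of `φ * Y` to an adjunction: take `r = [Bᵒᵖ,V](φ,Y-)` with evaluation as the
pairing (`dualCounit`). By the Yoneda lemma `φ` itself is the colimit `φ * Y`
(`yonedaCocone_isColimit`). Once `{φ,-}` preserves it, `[Bᵒᵖ,V](φ,φ)` has the universal property of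
`∫^x r(x) ⊗ φ x`, so the comparison at `φ` has a section (`exists_section_tensorToHom`). The image
of the identity of `φ` under the section is the unit. For this pairing the counit halves of both
triangles factor through the comparison at `φ` (`counitLeft_presheafModule`,
`counitRight_dualCounit`), so both triangle identities reduce to the unit laws of the presheaf
category. -/

noncomputable section

namespace EnrichedModules

open MonoidalCategory

/-! ### Triangle identities in `V-Mod`, unwound on coends. -/

namespace VModule

variable {V : Type u} [Category.{v} V] [MonoidalCategory V] [SymmetricCategory V]
  [MonoidalClosed V] [HasColimits V]
variable {A : Type w₁} [EnrichedCategory V A] [VSmall V A] {B : Type w₂} [EnrichedCategory V B]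
  [VSmall V B]

/-- The morphism `f(b,a') ⊗ (g ∘ f)(a',a) ⟶ f(b,a)` induced by a 2-cell `f ∘ g ⟶ 1`. -/
def counitLeft (f : VModule V A B) (g : VModule V B A) (ε : composite g f ⟶ unit V B)
    (b : B) (a' a : A) : f.obj b a' ⊗ coend f g a' a ⟶ f.obj b a :=
  assocAux f g f b a a' ≫ appL f ε b a ≫ ruApp f b a

lemma κ_counitLeft (f : VModule V A B) (g : VModule V B A) (ε : composite g f ⟶ unit V B)
    (b : B) (a' a : A) (x : B) :
    f.obj b a' ◁ κ f g a' a x ≫ counitLeft f g ε b a' a =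
      (α_ _ _ _).inv ≫ (κ g f b x a' ≫ ε.app b x) ▷ f.obj x a ≫ f.lact b x a := by
  rw [counitLeft, reassoc_of% κ_assocAux f g f b a a' x, κ_appL_assoc, κ_ruApp]
  simp

/-- The morphism `(g ∘ f)(a,a') ⊗ g(a',b) ⟶ g(a,b)` induced by a 2-cell `f ∘ g ⟶ 1`. -/
def counitRight (f : VModule V A B) (g : VModule V B A) (ε : composite g f ⟶ unit V B)
    (a a' : A) (b : B) : coend f g a a' ⊗ g.obj a' b ⟶ g.obj a b :=
  assocInvAux g f g a b a' ≫ appR ε g a b ≫ luApp g a b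

lemma κ_counitRight (f : VModule V A B) (g : VModule V B A) (ε : composite g f ⟶ unit V B)
    (a a' : A) (b : B) (x : B) :
    κ f g a a' x ▷ g.obj a' b ≫ counitRight f g ε a a' b =
      (α_ _ _ _).hom ≫ g.obj a x ◁ (κ g f x b a' ≫ ε.app x b) ≫ g.ract a x b := by
  rw [counitRight, reassoc_of% κ_assocInvAux g f g a b x a', κ_appR_assoc, κ_luApp]
  simp

/-- The left zigzag of `η` and `ε`, evaluated on `f(b,a') ⊗ A(a',a)`. -/
lemma κ_leftZigzag (f : VModule V A B) (g : VModule V B A) (η : unit V A ⟶ composite f g)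
    (ε : composite g f ⟶ unit V B) (b : B) (a' a : A) :
    κ (unit V A) f b a a' ≫ appR η f b a ≫ assocApp f g f b a ≫ appL f ε b a ≫ ruApp f b a =
      f.obj b a' ◁ η.app a' a ≫ counitLeft f g ε b a' a := by
  rw [κ_appR_assoc, assocApp, κ_desc_assoc, counitLeft]

lemma κ_rightZigzag (f : VModule V A B) (g : VModule V B A) (η : unit V A ⟶ composite f g)
    (ε : composite g f ⟶ unit V B) (a a' : A) (b : B) :
    κ g (unit V A) a b a' ≫ appL g η a b ≫ assocInvApp g f g a b ≫ appR ε g a b ≫ luApp g a b =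
      η.app a a' ▷ g.obj a' b ≫ counitRight f g ε a a' b := by
  rw [κ_appL_assoc, assocInvApp, κ_desc_assoc, counitRight]

end VModule

section Adjunction

open VModule

variable {V : Type u} [Category.{v} V] [MonoidalCategory V] [SymmetricCategory V]
  [MonoidalClosed V] [HasColimits V] {A B : VMod.{v, u, w} V}

/-- The injections of the coend `f ∘ 1` are jointly epic. On each of them the unitors become actions
and the associator becomes a regrouping, so the bicategorical identity turns into an equation
between morphisms of `V`. When `A` is the unit category only one object `a = a'` is left. -/
lemma leftZigzag_eq_iff (f : A ⟶ B) (g : B ⟶ A) (η : 𝟙 A ⟶ f ≫ g) (ε : g ≫ f ⟶ 𝟙 B) :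
    Bicategory.leftZigzag η ε = (Bicategory.leftUnitor f).hom ≫ (Bicategory.rightUnitor f).inv ↔
      ∀ b a' a, VModule.obj f b a' ◁ VModule.Hom.app η a' a ≫ counitLeft f g ε b a' a =
        VModule.ract f b a' a := by
  have e : Bicategory.leftZigzag η ε = (Bicategory.whiskerRight η f ≫
      (Bicategory.associator f g f).hom) ≫ Bicategory.whiskerLeft f ε := by
    simp [Bicategory.leftZigzag, bicategoricalComp]
  rw [e, Iso.eq_comp_inv]
  have key (b : B.carrier) (a' a : A.carrier) : κ (unit V A.carrier) f b a a' ≫ VModule.Hom.app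
      (((Bicategory.whiskerRight η f ≫ (Bicategory.associator f g f).hom) ≫
        Bicategory.whiskerLeft f ε) ≫ (Bicategory.rightUnitor f).hom) b a =
      VModule.obj f b a' ◁ VModule.Hom.app η a' a ≫ counitLeft f g ε b a' a := by
    rw [← κ_leftZigzag]
    change _ ≫ ((appR η f b a ≫ assocApp f g f b a) ≫ appL f ε b a) ≫ ruApp f b a = _
    simp only [Category.assoc]
  constructor
  · intro h b a' a
    rw [← key, h]
    exact κ_luApp f b a a'
  · intro h
    refine hom_ext fun b a => coend_ext fun a' => ?_
    exact (key b a' a).trans ((h b a' a).trans (κ_luApp f b a a').symm)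

/-- The same test, now on the injections of `1 ∘ g`, where the left action of `A` appears. -/
lemma rightZigzag_eq_iff (f : A ⟶ B) (g : B ⟶ A) (η : 𝟙 A ⟶ f ≫ g) (ε : g ≫ f ⟶ 𝟙 B) :
    Bicategory.rightZigzag η ε = (Bicategory.rightUnitor g).hom ≫ (Bicategory.leftUnitor g).inv ↔
      ∀ a a' b, VModule.Hom.app η a a' ▷ VModule.obj g a' b ≫ counitRight f g ε a a' b =
        VModule.lact g a a' b := by
  have e : Bicategory.rightZigzag η ε = (Bicategory.whiskerLeft g η ≫
      (Bicategory.associator g f g).inv) ≫ Bicategory.whiskerRight ε g := by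
    simp [Bicategory.rightZigzag, bicategoricalComp]
  rw [e, Iso.eq_comp_inv]
  have key (a a' : A.carrier) (b : B.carrier) : κ g (unit V A.carrier) a b a' ≫ VModule.Hom.app
      (((Bicategory.whiskerLeft g η ≫ (Bicategory.associator g f g).inv) ≫
        Bicategory.whiskerRight ε g) ≫ (Bicategory.leftUnitor g).hom) a b =
      VModule.Hom.app η a a' ▷ VModule.obj g a' b ≫ counitRight f g ε a a' b := by
    rw [← κ_rightZigzag]
    change _ ≫ ((appL g η a b ≫ assocInvApp g f g a b) ≫ appR ε g a b) ≫ luApp g a b = _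
    simp only [Category.assoc]
  constructor
  · intro h a a' b
    rw [← key, h]
    exact κ_ruApp g a b a'
  · intro h
    refine hom_ext fun a b => coend_ext fun a' => ?_
    exact (key a a' b).trans ((h a a' b).trans (κ_ruApp g a b a').symm)

end Adjunction

open MonoidalCategory

/-! ### Natural transformations between `V`-valued functors, in transposed form. -/

section NatFamilies

variable {V : Type u} [Category.{v} V] [MonoidalCategory V] [SymmetricCategory V]
  [MonoidalClosed V]
variable {C : Type w₁} [EnrichedCategory V C]

/-- A family `F x ⊗ T ⟶ G x` is `V`-natural in `x`. -/
def IsNatFamily (F G : EnrichedFunctor V C V) {T : V} (k : ∀ x, F.obj x ⊗ T ⟶ G.obj x) : Prop :=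
  ∀ x y, k x ▷ (x ⟶[V] y) ≫ act G x y =
    (α_ _ _ _).hom ≫ F.obj x ◁ (β_ T _).hom ≫ (α_ _ _ _).inv ≫ act F x y ▷ T ≫ k y

/-- Composition in the self-enrichment of `V` is itself a transpose, so uncurrying a wedge condition
leaves only actions and braidings. The direction not given by `isWedge_of_act` reads the same
computation backwards. -/
lemma isWedge_curry_iff (F G : EnrichedFunctor V C V) {T : V} (k : ∀ x, F.obj x ⊗ T ⟶ G.obj x) :
    IsWedge (homModule F G) (fun x => MonoidalClosed.curry (k x)) ↔ IsNatFamily F G k := by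
  refine ⟨fun h x y => ?_, isWedge_of_act F G k⟩
  have h := congrArg MonoidalClosed.uncurry (h x y)
  have e₁ := tensorHom_compTranspose (MonoidalClosed.curry (k x)) (G.map x y)
  have e₂ := tensorHom_compTranspose (F.map x y) (MonoidalClosed.curry (k y))
  rw [MonoidalClosed.uncurry_curry] at e₁ e₂
  dsimp only at h
  rw [MonoidalClosed.enrichedCategorySelf_comp, MonoidalClosed.enrichedCategorySelf_comp,
    MonoidalClosed.comp_eq, MonoidalClosed.comp_eq, ← MonoidalCategory.tensorHom_def_assoc,
    ← MonoidalCategory.tensorHom_def'_assoc, MonoidalClosed.uncurry_natural_left,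
    MonoidalClosed.uncurry_natural_left, MonoidalClosed.uncurry_natural_left,
    MonoidalClosed.uncurry_curry, MonoidalClosed.uncurry_curry] at h
  have h' := (α_ _ _ _).hom ≫= (e₁.symm.trans (h.trans (congrArg (_ ◁ _ ≫ ·) e₂)))
  simpa only [act, Iso.hom_inv_id_assoc] using h'

lemma isWedge_iff (F G : EnrichedFunctor V C V) {T : V}
    (s : ∀ x, T ⟶ (ihom (F.obj x)).obj (G.obj x)) :
    IsWedge (homModule F G) s ↔ IsNatFamily F G fun x => MonoidalClosed.uncurry (s x) := by
  rw [← isWedge_curry_iff]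
  simp only [MonoidalClosed.curry_uncurry]

lemma isNatFamily_comp {F G : EnrichedFunctor V C V} {T T' : V} {k : ∀ x, F.obj x ⊗ T ⟶ G.obj x}
    (hk : IsNatFamily F G k) (t : T' ⟶ T) : IsNatFamily F G fun x => F.obj x ◁ t ≫ k x := by
  intro x y
  have h := hk x y
  rw [comp_whiskerRight_assoc, h, ← whisker_exchange_assoc]
  simp only [whisker_assoc, Category.assoc, Iso.inv_hom_id_assoc, tensor_whiskerLeft]
  rw [← MonoidalCategory.whiskerLeft_comp_assoc, ← MonoidalCategory.whiskerLeft_comp_assoc,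
    BraidedCategory.braiding_naturality_left]

variable [HasLimits V] [VSmall V C]

/-- The evaluation `F x ⊗ [C,V](F,G) ⟶ G x`. -/
def natEv (F G : EnrichedFunctor V C V) (x : C) : F.obj x ⊗ natObj F G ⟶ G.obj x :=
  MonoidalClosed.uncurry (natπ F G x)

lemma natEv_isNatFamily (F G : EnrichedFunctor V C V) : IsNatFamily F G (natEv F G) :=
  (isWedge_iff F G _).1 (natπ_wedge F G)

/-- The morphism `T ⟶ [C,V](F,G)` given by a `V`-natural family `F x ⊗ T ⟶ G x`. -/
def natMk (F G : EnrichedFunctor V C V) {T : V} (k : ∀ x, F.obj x ⊗ T ⟶ G.obj x)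
    (hk : IsNatFamily F G k) : T ⟶ natObj F G :=
  natLift F G (fun x => MonoidalClosed.curry (k x)) ((isWedge_curry_iff F G k).2 hk)

lemma natMk_ev (F G : EnrichedFunctor V C V) {T : V} (k : ∀ x, F.obj x ⊗ T ⟶ G.obj x)
    (hk : IsNatFamily F G k) (x : C) : F.obj x ◁ natMk F G k hk ≫ natEv F G x = k x := by
  rw [natEv, ← MonoidalClosed.uncurry_natural_left, natMk, natLift_π, MonoidalClosed.uncurry_curry]

lemma natEv_ext {F G : EnrichedFunctor V C V} {T : V} {s t : T ⟶ natObj F G}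
    (h : ∀ x, F.obj x ◁ s ≫ natEv F G x = F.obj x ◁ t ≫ natEv F G x) : s = t :=
  nat_ext fun x => MonoidalClosed.uncurry_injective (by
    rw [MonoidalClosed.uncurry_natural_left, MonoidalClosed.uncurry_natural_left]
    exact h x)

/-- Evaluation of a composite. -/
lemma comp_natEv (F G H : EnrichedFunctor V C V) (x : C) :
    F.obj x ◁ eComp V F G H ≫ natEv F H x =
      (α_ _ _ _).inv ≫ natEv F G x ▷ _ ≫ natEv G H x := by
  rw [natEv, ← MonoidalClosed.uncurry_natural_left, nat_comp_π,
    MonoidalClosed.uncurry_natural_left, MonoidalClosed.enrichedCategorySelf_comp,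
    MonoidalClosed.comp_eq, MonoidalClosed.uncurry_curry]
  exact tensorHom_compTranspose _ _

lemma id_natEv (F : EnrichedFunctor V C V) (x : C) :
    F.obj x ◁ eId V F ≫ natEv F F x = (ρ_ _).hom := by
  rw [natEv, ← MonoidalClosed.uncurry_natural_left, nat_id_π,
    MonoidalClosed.enrichedCategorySelf_id, MonoidalClosed.id_eq, MonoidalClosed.uncurry_curry]

end NatFamilies

/-! ### Weighted colimits through generalized elements. -/

section Colimits

variable {V : Type u} [Category.{v} V] [MonoidalCategory V] [SymmetricCategory V]
  [MonoidalClosed V] [HasLimits V]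
variable {C : Type w₁} [EnrichedCategory V C] [VSmall V C] {A : Type w₂} [EnrichedCategory V A]
  {A' : Type w₃} [EnrichedCategory V A']

/-- The comparison morphism on generalized elements. -/
lemma whiskerLeft_comparison_natEv {φ : EnrichedFunctor V Cᵒᵖ V} {S : EnrichedFunctor V C A}
    (c : WeightedCocone φ S) (a : A) {T : V} (t : T ⟶ (c.pt ⟶[V] a)) (x : Cᵒᵖ) :
    φ.obj x ◁ (t ≫ c.comparison a) ≫ natEv φ (homAlong S a) x =
      c.ι x ▷ T ≫ _ ◁ t ≫ eComp V (S.obj x.unop) c.pt a := by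
  have h : φ.obj x ◁ c.comparison a ≫ natEv φ (homAlong S a) x =
      c.ι x ▷ _ ≫ eComp V (S.obj x.unop) c.pt a := by
    rw [natEv, ← MonoidalClosed.uncurry_natural_left, WeightedCocone.comparison, natLift_π]
    exact MonoidalClosed.uncurry_curry _
  rw [MonoidalCategory.whiskerLeft_comp_assoc, h]
  exact whisker_exchange_assoc _ _ _

/-- The colimit property in terms of generalized elements. -/
lemma WeightedCocone.isColimit_iff {φ : EnrichedFunctor V Cᵒᵖ V} {S : EnrichedFunctor V C A}
    (c : WeightedCocone φ S) : c.IsColimit ↔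
      ∀ (a : A) (T : V) (k : ∀ x : Cᵒᵖ, φ.obj x ⊗ T ⟶ (S.obj x.unop ⟶[V] a)),
        IsNatFamily φ (homAlong S a) k → ∃! t : T ⟶ (c.pt ⟶[V] a),
          ∀ x, c.ι x ▷ T ≫ _ ◁ t ≫ eComp V (S.obj x.unop) c.pt a = k x := by
  have key (a : A) {T : V} (t : T ⟶ (c.pt ⟶[V] a)) (x : Cᵒᵖ) :=
    whiskerLeft_comparison_natEv c a t x
  constructor
  · intro h a T k hk
    have := h a
    refine ⟨natMk φ (homAlong S a) k hk ≫ inv (c.comparison a), fun x => ?_, fun t ht => ?_⟩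
    · refine (key a _ x).symm.trans ?_
      rw [Category.assoc, IsIso.inv_hom_id, Category.comp_id]
      exact natMk_ev φ (homAlong S a) k hk x
    · rw [IsIso.eq_comp_inv]
      exact natEv_ext fun x => (key a t x).trans
        ((ht x).trans (natMk_ev φ (homAlong S a) k hk x).symm)
  · intro h a
    -- The universal natural family, evaluation, factors through the cocone; the factorisation is
    -- the candidate inverse.
    obtain ⟨t, ht, -⟩ := h a _ _ (natEv_isNatFamily φ (homAlong S a))
    have h₁ : t ≫ c.comparison a = 𝟙 _ := natEv_ext fun x => by
      refine (key a t x).trans ((ht x).trans ?_)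
      rw [MonoidalCategory.whiskerLeft_id, Category.id_comp]
    refine ⟨t, ?_, h₁⟩
    -- Both the identity and the comparison followed by `t` factor this family, so uniqueness
    -- identifies them.
    have hk := isNatFamily_comp (natEv_isNatFamily φ (homAlong S a)) (c.comparison a)
    refine (h a _ _ hk).unique (fun x => ?_) (fun x => ?_)
    · refine (key a _ x).symm.trans ?_
      rw [Category.assoc, h₁, Category.comp_id]
    · refine (key a _ x).symm.trans ?_
      rw [Category.id_comp]

end Colimits

open MonoidalCategory Opposite

/-! ### Presheaves as left actions. -/

section Presheaves

variable {V : Type u} [Category.{v} V] [MonoidalCategory V] [SymmetricCategory V]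
  [MonoidalClosed V]
variable {B : Type w} [EnrichedCategory V B]

/-- The left action `B(x,y) ⊗ F y ⟶ F x` of a presheaf `F : Bᵒᵖ ⥤ V`. -/
def pact (F : EnrichedFunctor V Bᵒᵖ V) (x y : B) :
    (x ⟶[V] y) ⊗ F.obj (op y) ⟶ F.obj (op x) :=
  (β_ _ _).hom ≫ act F (op y) (op x)

lemma pact_id (F : EnrichedFunctor V Bᵒᵖ V) (x : B) :
    eId V x ▷ F.obj (op x) ≫ pact F x x = (λ_ _).hom :=
  (presheafModule F).id_lact x UnitObj.star

lemma pact_comp (F : EnrichedFunctor V Bᵒᵖ V) (x y z : B) :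
    eComp V x y z ▷ F.obj (op z) ≫ pact F x z =
      (α_ _ _ _).hom ≫ (x ⟶[V] y) ◁ pact F y z ≫ pact F x y :=
  (presheafModule F).comp_lact x y z UnitObj.star

/-- The braiding that turns `act` into a left action cancels the one in the definition of the
contravariant representable, because `V` is symmetric. -/
lemma pact_homTo (b x y : B) : pact (homTo (V := V) b) x y = eComp V x y b := by
  rw [pact, act_homTo]
  exact SymmetricCategory.symmetry_assoc _ _ _

lemma pact_homAlong {A : Type w₁} [EnrichedCategory V A] (S : EnrichedFunctor V B A) (a : A)
    (x y : B) : pact (homAlong S a) x y =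
      S.map x y ▷ (S.obj y ⟶[V] a) ≫ eComp V (S.obj x) (S.obj y) a := by
  rw [pact, act_homAlong]
  refine (BraidedCategory.braiding_naturality_left_assoc (S.map x y) (S.obj y ⟶[V] a) _).symm.trans
    (_ ≫= ?_)
  exact SymmetricCategory.symmetry_assoc _ _ _

/-- A family `F x ⊗ T ⟶ G x` is compatible with the left actions. -/
def IsPresheafFamily (F G : EnrichedFunctor V Bᵒᵖ V) {T : V}
    (k : ∀ x : B, F.obj (op x) ⊗ T ⟶ G.obj (op x)) : Prop :=
  ∀ x y : B, (x ⟶[V] y) ◁ k y ≫ pact G x y = (α_ _ _ _).inv ≫ pact F x y ▷ T ≫ k x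

/-- The two conditions differ by the invertible braiding that moves `B(x,y)` past `F y ⊗ T`. The
hexagon splits it, and the two crossings of `B(x,y)` with `T` cancel by symmetry. From here on all
naturality is stated for left actions, without braidings. -/
lemma isNatFamily_iff_isPresheafFamily (F G : EnrichedFunctor V Bᵒᵖ V) {T : V}
    (k : ∀ x : Bᵒᵖ, F.obj x ⊗ T ⟶ G.obj x) :
    IsNatFamily F G k ↔ IsPresheafFamily F G fun x => k (op x) := by
  have key (x y : B) {Z : V} (l : F.obj (op x) ⊗ T ⟶ Z) : (β_ (x ⟶[V] y) (F.obj (op y) ⊗ T)).hom ≫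
      (α_ _ _ _).hom ≫ F.obj (op y) ◁ (β_ T (x ⟶[V] y)).hom ≫ (α_ _ _ _).inv ≫
        act F (op y) (op x) ▷ T ≫ l = (α_ _ _ _).inv ≫ pact F x y ▷ T ≫ l := by
    rw [pact, BraidedCategory.braiding_tensor_right_hom]
    simp only [Category.assoc, Iso.inv_hom_id_assoc]
    rw [← MonoidalCategory.whiskerLeft_comp_assoc, SymmetricCategory.symmetry]
    simp
  constructor
  · intro h x y
    have h' := (β_ (x ⟶[V] y) (F.obj (op y) ⊗ T)).hom ≫= h (op y) (op x)
    rw [← key, pact]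
    exact (BraidedCategory.braiding_naturality_right_assoc _ _ _).trans h'
  · intro h x y
    obtain ⟨x⟩ := x
    obtain ⟨y⟩ := y
    have h' := h y x
    rw [← key, pact] at h'
    refine (cancel_epi (β_ (y ⟶[V] x) _).hom).1 (Eq.trans ?_ h')
    exact (BraidedCategory.braiding_naturality_right_assoc _ _ _).symm

end Presheaves

/-! ### Evaluation on presheaves and the enriched Yoneda lemma. -/

section Evaluation

variable {V : Type u} [Category.{v} V] [MonoidalCategory V] [SymmetricCategory V]
  [MonoidalClosed V] [HasLimits V]
variable {B : Type w} [EnrichedCategory V B] [VSmall V B]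

/-- The evaluation `F x ⊗ [Bᵒᵖ,V](F,G) ⟶ G x`. -/
def ev (F G : EnrichedFunctor V Bᵒᵖ V) (x : B) :
    F.obj (op x) ⊗ (F ⟶[V] G) ⟶ G.obj (op x) :=
  natEv F G (op x)

lemma ev_isPresheafFamily (F G : EnrichedFunctor V Bᵒᵖ V) : IsPresheafFamily F G (ev F G) :=
  (isNatFamily_iff_isPresheafFamily F G _).1 (natEv_isNatFamily F G)

/-- The morphism `T ⟶ [Bᵒᵖ,V](F,G)` given by a compatible family. -/
def presheafMk (F G : EnrichedFunctor V Bᵒᵖ V) {T : V}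
    (k : ∀ x : B, F.obj (op x) ⊗ T ⟶ G.obj (op x)) (hk : IsPresheafFamily F G k) :
    T ⟶ (F ⟶[V] G) :=
  natMk F G (fun x => k x.unop) ((isNatFamily_iff_isPresheafFamily F G _).2 hk)

lemma presheafMk_ev (F G : EnrichedFunctor V Bᵒᵖ V) {T : V}
    (k : ∀ x : B, F.obj (op x) ⊗ T ⟶ G.obj (op x)) (hk : IsPresheafFamily F G k) (x : B) :
    F.obj (op x) ◁ presheafMk F G k hk ≫ ev F G x = k x :=
  natMk_ev F G (fun x => k x.unop) _ (op x)

lemma ev_ext {F G : EnrichedFunctor V Bᵒᵖ V} {T : V} {s t : T ⟶ (F ⟶[V] G)}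
    (h : ∀ x : B, F.obj (op x) ◁ s ≫ ev F G x = F.obj (op x) ◁ t ≫ ev F G x) : s = t :=
  natEv_ext fun x => h x.unop

lemma comp_ev (F G H : EnrichedFunctor V Bᵒᵖ V) (x : B) :
    F.obj (op x) ◁ eComp V F G H ≫ ev F H x =
      (α_ _ _ _).inv ≫ ev F G x ▷ _ ≫ ev G H x :=
  comp_natEv F G H (op x)

lemma id_ev (F : EnrichedFunctor V Bᵒᵖ V) (x : B) :
    F.obj (op x) ◁ eId V F ≫ ev F F x = (ρ_ _).hom :=
  id_natEv F (op x)

/-- The evaluation `φ x ⊗ [Bᵒᵖ,V](φ,B(-,b)) ⟶ B(x,b)`. -/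
def evHomTo (φ : EnrichedFunctor V Bᵒᵖ V) (b x : B) :
    φ.obj (op x) ⊗ (φ ⟶[V] homTo (V := V) b) ⟶ (x ⟶[V] b) :=
  ev φ (homTo b) x

lemma evHomTo_nat (φ : EnrichedFunctor V Bᵒᵖ V) (b x y : B) :
    (x ⟶[V] y) ◁ evHomTo φ b y ≫ eComp V x y b =
      (α_ _ _ _).inv ≫ pact φ x y ▷ _ ≫ evHomTo φ b x := by
  have h := ev_isPresheafFamily φ (homTo b) x y
  rw [pact_homTo] at h
  exact h

/-- The evaluation `B(x,b) ⊗ [Bᵒᵖ,V](B(-,b),F) ⟶ F x`. -/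
def homToEv (F : EnrichedFunctor V Bᵒᵖ V) (b x : B) :
    (x ⟶[V] b) ⊗ (homTo (V := V) b ⟶[V] F) ⟶ F.obj (op x) :=
  ev (homTo b) F x

lemma homToEv_nat (F : EnrichedFunctor V Bᵒᵖ V) (b x y : B) :
    (x ⟶[V] y) ◁ homToEv F b y ≫ pact F x y =
      (α_ _ _ _).inv ≫ eComp V x y b ▷ _ ≫ homToEv F b x := by
  have h := ev_isPresheafFamily (homTo b) F x y
  rw [pact_homTo] at h
  exact h

lemma comp_homToEv (F G : EnrichedFunctor V Bᵒᵖ V) (b x : B) :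
    (x ⟶[V] b) ◁ eComp V (homTo b) F G ≫ homToEv G b x =
      (α_ _ _ _).inv ≫ homToEv F b x ▷ _ ≫ ev F G x :=
  comp_ev (homTo b) F G x

lemma comp_ev_homTo (φ F : EnrichedFunctor V Bᵒᵖ V) (b x : B) :
    φ.obj (op x) ◁ eComp V φ (homTo b) F ≫ ev φ F x =
      (α_ _ _ _).inv ≫ evHomTo φ b x ▷ _ ≫ homToEv F b x :=
  comp_ev φ (homTo b) F x

/-- The Yoneda morphism `F b ⟶ [Bᵒᵖ,V](B(-,b),F)`. -/
def yonedaMk (F : EnrichedFunctor V Bᵒᵖ V) (b : B) : F.obj (op b) ⟶ (homTo (V := V) b ⟶[V] F) :=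
  presheafMk (homTo b) F (fun x => pact F x b) (fun x y => by
    rw [pact_homTo]
    exact (Iso.inv_hom_id_assoc (α_ _ _ _) _).symm.trans
      ((α_ _ _ _).inv ≫= (pact_comp F x y b).symm))

lemma yonedaMk_homToEv (F : EnrichedFunctor V Bᵒᵖ V) (b x : B) :
    (x ⟶[V] b) ◁ yonedaMk F b ≫ homToEv F b x = pact F x b :=
  presheafMk_ev (homTo b) F (fun x => pact F x b) _ x

lemma homToEv_ext {F : EnrichedFunctor V Bᵒᵖ V} {b : B} {T : V}
    {s t : T ⟶ (homTo (V := V) b ⟶[V] F)}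
    (h : ∀ x : B, (x ⟶[V] b) ◁ s ≫ homToEv F b x = (x ⟶[V] b) ◁ t ≫ homToEv F b x) : s = t :=
  ev_ext h

lemma evHomTo_ext {F : EnrichedFunctor V Bᵒᵖ V} {b : B} {T : V}
    {s t : T ⟶ (F ⟶[V] homTo (V := V) b)}
    (h : ∀ x : B, F.obj (op x) ◁ s ≫ evHomTo F b x = F.obj (op x) ◁ t ≫ evHomTo F b x) : s = t :=
  ev_ext h

/-- Evaluation at the identity, `[Bᵒᵖ,V](B(-,b),F) ⟶ F b`. -/
def yonedaEv (F : EnrichedFunctor V Bᵒᵖ V) (b : B) : (homTo (V := V) b ⟶[V] F) ⟶ F.obj (op b) :=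
  (λ_ _).inv ≫ eId V b ▷ _ ≫ homToEv F b b

/-- The Yoneda argument: naturality of the evaluation moves the action of `B(x,b)` into a
composition with the identity of `b`, which disappears. -/
lemma yonedaEv_pact (F : EnrichedFunctor V Bᵒᵖ V) (b x : B) :
    (x ⟶[V] b) ◁ yonedaEv F b ≫ pact F x b = homToEv F b x := by
  have h := e_comp_id V x b
  rw [yonedaEv, MonoidalCategory.whiskerLeft_comp_assoc, MonoidalCategory.whiskerLeft_comp_assoc,
    homToEv_nat, associator_inv_naturality_middle_assoc, ← comp_whiskerRight_assoc]
  have h' : (x ⟶[V] b) ◁ eId V b ≫ eComp V x b b = (ρ_ _).hom := by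
    rw [← cancel_epi (ρ_ _).inv, h, Iso.inv_hom_id]
  rw [h']
  simp

lemma yonedaEv_yonedaMk (F : EnrichedFunctor V Bᵒᵖ V) (b : B) :
    yonedaEv F b ≫ yonedaMk F b = 𝟙 _ :=
  homToEv_ext fun x => by
    rw [MonoidalCategory.whiskerLeft_comp_assoc, yonedaMk_homToEv, yonedaEv_pact]
    simp

lemma yonedaMk_yonedaEv (F : EnrichedFunctor V Bᵒᵖ V) (b : B) :
    yonedaMk F b ≫ yonedaEv F b = 𝟙 _ := by
  rw [yonedaEv, leftUnitor_inv_naturality_assoc, whisker_exchange_assoc, yonedaMk_homToEv,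
    pact_id, Iso.inv_hom_id]

/-- The action `B(b,b') ⟶ [Bᵒᵖ,V](B(-,b),B(-,b'))` of the Yoneda embedding. -/
def yonedaMap (b b' : B) : (b ⟶[V] b') ⟶ (homTo (V := V) b ⟶[V] homTo (V := V) b') :=
  (enrichedYoneda (V := V)).map b b'

lemma yonedaMap_homToEv (b b' x : B) :
    (x ⟶[V] b) ◁ yonedaMap b b' ≫ homToEv (homTo b') b x = eComp V x b b' := by
  have h : yonedaMap b b' ≫ natπ (homTo b) (homTo b') (op x) =
      MonoidalClosed.curry (eComp V x b b') := by
    dsimp only [yonedaMap, enrichedYoneda]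
    exact natLift_π ..
  exact (MonoidalClosed.uncurry_natural_left _ _).symm.trans
    ((congrArg MonoidalClosed.uncurry h).trans (MonoidalClosed.uncurry_curry _))

/-- `V`-naturality of `yonedaEv` in the object of `B`. -/
lemma yonedaMap_comp_yonedaEv (F : EnrichedFunctor V Bᵒᵖ V) (b b' : B) :
    yonedaMap b b' ▷ _ ≫ eComp V (homTo b) (homTo b') F ≫ yonedaEv F b = homToEv F b' b := by
  -- `z` is the evaluation at `b` of morphisms `B(-,b) ⟶ B(-,b')`, with its source and target
  -- written as hom objects of `B` rather than as values of `homTo`, so that both facts about it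
  -- apply in the same form.
  obtain ⟨z, h, h₂⟩ : ∃ z : (b ⟶[V] b) ⊗ (homTo (V := V) b ⟶[V] homTo (V := V) b') ⟶ (b ⟶[V] b'),
      (b ⟶[V] b) ◁ yonedaMap b b' ≫ z = eComp V b b b' ∧
      (b ⟶[V] b) ◁ eComp V (homTo b) (homTo b') F ≫ homToEv F b b =
        (α_ _ _ _).inv ≫ z ▷ _ ≫ homToEv F b' b :=
    ⟨_, yonedaMap_homToEv b b' b, comp_ev (homTo b) (homTo b') F b⟩
  have e : eId V b ▷ _ ≫ eComp V b b b' = (λ_ _).hom := by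
    rw [← cancel_epi (λ_ _).inv, e_id_comp, Iso.inv_hom_id]
  rw [yonedaEv, leftUnitor_inv_naturality_assoc, leftUnitor_inv_naturality_assoc,
    whisker_exchange_assoc, whisker_exchange_assoc, h₂, associator_inv_naturality_middle_assoc]
  rw [← comp_whiskerRight_assoc, h, associator_inv_naturality_left_assoc,
    ← comp_whiskerRight_assoc, e]
  simp

end Evaluation

open MonoidalCategory Opposite

/-! ### Weighted colimits through left actions, and their preservation. -/

section WeightedColimits

variable {V : Type u} [Category.{v} V] [MonoidalCategory V] [SymmetricCategory V]
  [MonoidalClosed V]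
variable {K : Type w} [EnrichedCategory V K] {A : Type w₂} [EnrichedCategory V A]

/-- A family `φ x ⊗ T ⟶ A(S x, a)` is `V`-natural in `x : K`. -/
def IsConeFamily (φ : EnrichedFunctor V Kᵒᵖ V) (S : EnrichedFunctor V K A) (a : A) {T : V}
    (k : ∀ x : K, φ.obj (op x) ⊗ T ⟶ (S.obj x ⟶[V] a)) : Prop :=
  ∀ x y : K, (x ⟶[V] y) ◁ k y ≫ S.map x y ▷ _ ≫ eComp V (S.obj x) (S.obj y) a =
    (α_ _ _ _).inv ≫ pact φ x y ▷ T ≫ k x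

lemma isNatFamily_homAlong_iff (φ : EnrichedFunctor V Kᵒᵖ V) (S : EnrichedFunctor V K A) (a : A)
    {T : V} (k : ∀ x : Kᵒᵖ, φ.obj x ⊗ T ⟶ (S.obj x.unop ⟶[V] a)) :
    IsNatFamily φ (homAlong S a) k ↔ IsConeFamily φ S a fun x => k (op x) := by
  refine (isNatFamily_iff_isPresheafFamily φ (homAlong S a) k).trans
    (forall₂_congr fun x y => ?_)
  rw [pact_homAlong]
  exact Iff.rfl

/-- A weighted cocone given by its left actions. -/
def weightedCoconeMk {φ : EnrichedFunctor V Kᵒᵖ V} {S : EnrichedFunctor V K A} (a : A)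
    (i : ∀ x : K, φ.obj (op x) ⟶ (S.obj x ⟶[V] a))
    (hi : ∀ x y : K, (x ⟶[V] y) ◁ i y ≫ S.map x y ▷ _ ≫ eComp V (S.obj x) (S.obj y) a =
      pact φ x y ≫ i x) : WeightedCocone φ S where
  pt := a
  ι x := i x.unop
  naturality x y := by
    obtain ⟨x⟩ := x
    obtain ⟨y⟩ := y
    refine (cancel_epi (β_ (y ⟶[V] x) _).hom).1 ?_
    have h := hi y x
    have h' := pact_homAlong S a y x
    rw [pact] at h'
    rw [pact, Category.assoc] at h
    refine h.symm.trans ((_ ≫= h').symm.trans ?_)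
    exact BraidedCategory.braiding_naturality_right_assoc _ _ _

variable [HasLimits V] [VSmall V K]

/-- The working form of the colimit property: indices in `K` instead of `Kᵒᵖ`, and naturality in
`IsConeFamily` form. -/
lemma WeightedCocone.isColimit_iff_existsUnique {φ : EnrichedFunctor V Kᵒᵖ V}
    {S : EnrichedFunctor V K A} (c : WeightedCocone φ S) : c.IsColimit ↔
      ∀ (a : A) (T : V) (k : ∀ x : K, φ.obj (op x) ⊗ T ⟶ (S.obj x ⟶[V] a)),
        IsConeFamily φ S a k → ∃! t : T ⟶ (c.pt ⟶[V] a),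
          ∀ x, c.ι (op x) ▷ T ≫ _ ◁ t ≫ eComp V (S.obj x) c.pt a = k x := by
  rw [c.isColimit_iff]
  constructor
  · intro h a T k hk
    obtain ⟨t, ht, hu⟩ := h a T (fun x => k x.unop) ((isNatFamily_homAlong_iff φ S a _).2 hk)
    exact ⟨t, fun x => ht (op x), fun s hs => hu s fun x => hs x.unop⟩
  · intro h a T k hk
    obtain ⟨t, ht, hu⟩ := h a T (fun x => k (op x)) ((isNatFamily_homAlong_iff φ S a _).1 hk)
    exact ⟨t, fun x => ht x.unop, fun s hs => hu s fun x => hs (op x)⟩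

/-- A `V`-functor all of whose presheaves `A'(F-,a')` are representable preserves colimits. -/
theorem preservesWeightedColimit_of_representable {A' : Type w₃} [EnrichedCategory V A']
    (F : EnrichedFunctor V A A') (R : A' → A)
    (e : ∀ (x : A) (a' : A'), (x ⟶[V] R a') ≅ (F.obj x ⟶[V] a'))
    (he : ∀ (x y : A) (a' : A'), eComp V x y (R a') ≫ (e x a').hom =
      (F.map x y ⊗ₘ (e y a').hom) ≫ eComp V (F.obj x) (F.obj y) a')
    (φ : EnrichedFunctor V Kᵒᵖ V) (S : EnrichedFunctor V K A) :
    PreservesWeightedColimit φ S F := by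
  intro c hc
  rw [WeightedCocone.isColimit_iff_existsUnique] at hc ⊢
  intro a' T (k : ∀ x, φ.obj (op x) ⊗ T ⟶ (F.obj (S.obj x) ⟶[V] a')) hk
  suffices h : ∃! t : T ⟶ (F.obj c.pt ⟶[V] a'), ∀ x : K,
      (c.ι (op x) ≫ F.map (S.obj x) c.pt) ▷ T ≫ _ ◁ t ≫
        eComp V (F.obj (S.obj x)) (F.obj c.pt) a' = k x from h
  replace hk (x y : K) : (x ⟶[V] y) ◁ k y ≫ (S.map x y ≫ F.map (S.obj x) (S.obj y)) ▷ _ ≫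
      eComp V (F.obj (S.obj x)) (F.obj (S.obj y)) a' = (α_ _ _ _).inv ≫ pact φ x y ▷ T ≫ k x :=
    hk x y
  -- Transport along `e` turns a cone under `F ∘ S` with vertex `a'` into a cone under `S` with
  -- vertex `R a'`. Only the naturality `he` in the object of `A` enters, so `R` can be a mere map
  -- of objects.
  have hk' : IsConeFamily φ S (R a') fun x => k x ≫ (e (S.obj x) a').inv := by
    intro x y
    rw [← cancel_mono (e (S.obj x) a').hom]
    simp only [Category.assoc, Iso.inv_hom_id, Category.comp_id]
    rw [← hk, he, MonoidalCategory.whiskerLeft_comp_assoc, MonoidalCategory.tensorHom_def',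
      Category.assoc, ← whisker_exchange_assoc,
      ← MonoidalCategory.whiskerLeft_comp_assoc _ (e (S.obj y) a').inv,
      Iso.inv_hom_id, MonoidalCategory.whiskerLeft_id, Category.id_comp, comp_whiskerRight_assoc]
  -- Transport along `e` also matches the factorisations through `c` with those through the image of
  -- `c`.
  have key (t : T ⟶ (c.pt ⟶[V] R a')) (x : K) :
      (c.ι (op x) ▷ T ≫ _ ◁ t ≫ eComp V (S.obj x) c.pt (R a')) ≫ (e (S.obj x) a').hom =
        (c.ι (op x) ≫ F.map (S.obj x) c.pt) ▷ T ≫ _ ◁ (t ≫ (e c.pt a').hom) ≫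
          eComp V (F.obj (S.obj x)) (F.obj c.pt) a' := by
    simp only [Category.assoc]
    rw [he, MonoidalCategory.tensorHom_def, MonoidalCategory.whiskerLeft_comp]
    simp only [Category.assoc]
    rw [whisker_exchange_assoc, comp_whiskerRight_assoc]
  obtain ⟨t, ht, hu⟩ := hc (R a') T _ hk'
  refine ⟨t ≫ (e c.pt a').hom, fun x => (key t x).symm.trans ?_, fun s hs => ?_⟩
  · rw [ht, Category.assoc, Iso.inv_hom_id, Category.comp_id]
  · rw [← hu (s ≫ (e c.pt a').inv) fun x => ?_, Category.assoc, Iso.inv_hom_id, Category.comp_id]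
    rw [← cancel_mono (e (S.obj x) a').hom, key, Category.assoc, Iso.inv_hom_id, Category.comp_id,
      Category.assoc, Iso.inv_hom_id, Category.comp_id, hs]

end WeightedColimits

/-! ### Change of universe for the indexing category. -/

section Lift

variable {V : Type u} [Category.{v} V] [MonoidalCategory V] [SymmetricCategory V]
  [MonoidalClosed V] [HasLimits V]
variable {K : Type w} [EnrichedCategory V K] [VSmall V K] {A : Type w₂} [EnrichedCategory V A]

/-- `Cocontinuous` quantifies over indexing categories in one fixed universe, which may be larger
than that of `B`. This copy brings `B` into its range. -/
instance ulift_enrichedCategory : EnrichedCategory V (ULift.{w'} K) where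
  Hom x y := x.down ⟶[V] y.down
  id x := eId V x.down
  comp x y z := eComp V x.down y.down z.down
  id_comp x y := e_id_comp V x.down y.down
  comp_id x y := e_comp_id V x.down y.down
  assoc x y z t := e_assoc V x.down y.down z.down t.down

/-- The lift, which is the identity on hom objects, is essentially surjective, so the isomorphism
classes of the copy are an image of those of `K`. -/
instance : VSmall V (ULift.{w'} K) where
  small := by
    have : Small.{v} (Skeleton (ForgetEnrichment V K)) := VSmall.small
    let up : EnrichedFunctor V K (ULift.{w'} K) :=
      { obj := ULift.up
        map := fun x y => 𝟙 (x ⟶[V] y)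
        map_id := fun x => Category.comp_id _
        map_comp := fun x y z => (Category.comp_id _).trans
          ((congrArg (· ≫ _) (MonoidalCategory.id_tensorHom_id _ _)).trans
            (Category.id_comp _)).symm }
    have : up.forget.EssSurj := ⟨fun y => ⟨ForgetEnrichment.of V y.to.down, ⟨Iso.refl _⟩⟩⟩
    exact small_of_surjective up.forget.mapSkeleton_surjective

/-- Precomposition of a `V`-functor with the change of universe. -/
def uliftFunctor (S : EnrichedFunctor V K A) : EnrichedFunctor V (ULift.{w'} K) A where
  obj x := S.obj x.down
  map x y := S.map x.down y.down
  map_id x := S.map_id x.down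
  map_comp x y z := S.map_comp x.down y.down z.down

/-- Precomposition of a presheaf with the change of universe. -/
def uliftPresheaf (φ : EnrichedFunctor V Kᵒᵖ V) : EnrichedFunctor V (ULift.{w'} K)ᵒᵖ V where
  obj x := φ.obj (op x.unop.down)
  map x y := φ.map (op x.unop.down) (op y.unop.down)
  map_id x := φ.map_id (op x.unop.down)
  map_comp x y z := φ.map_comp (op x.unop.down) (op y.unop.down) (op z.unop.down)

/-- Change of universe for weighted cocones. -/
def WeightedCocone.ulift {φ : EnrichedFunctor V Kᵒᵖ V} {S : EnrichedFunctor V K A}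
    (c : WeightedCocone φ S) : WeightedCocone (uliftPresheaf.{v, u, w, w'} φ) (uliftFunctor S) where
  pt := c.pt
  ι x := c.ι (op x.unop.down)
  naturality x y := c.naturality (op x.unop.down) (op y.unop.down)

lemma WeightedCocone.ulift_isColimit_iff {φ : EnrichedFunctor V Kᵒᵖ V} {S : EnrichedFunctor V K A}
    (c : WeightedCocone φ S) : (ulift.{v, u, w, w'} c).IsColimit ↔ c.IsColimit := by
  rw [isColimit_iff_existsUnique, isColimit_iff_existsUnique]
  constructor
  · intro h a T k hk
    obtain ⟨t, ht, hu⟩ := h a T (fun x => k x.down) fun x y => hk x.down y.down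
    exact ⟨t, fun x => ht ⟨x⟩, fun s hs => hu s fun x => hs x.down⟩
  · intro h a T k hk
    obtain ⟨t, ht, hu⟩ := h a T (fun x => k ⟨x⟩) fun x y => hk ⟨x⟩ ⟨y⟩
    exact ⟨t, fun x => ht x.down, fun s hs => hu s fun x => hs ⟨x⟩⟩

/-- A cocontinuous `V`-functor preserves colimits indexed in a smaller universe. -/
lemma Cocontinuous.preservesWeightedColimit {A' : Type w₃} [EnrichedCategory V A']
    {F : EnrichedFunctor V A A'} (hF : Cocontinuous.{v, u, max w w'} F)
    (φ : EnrichedFunctor V Kᵒᵖ V) (S : EnrichedFunctor V K A) : PreservesWeightedColimit φ S F :=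
  -- Lifting a cocone and taking its image under `F` commute by definition.
  fun c hc => (c.map F).ulift_isColimit_iff.1
    (hF (ULift.{max v w'} K) _ _ _ (c.ulift_isColimit_iff.2 hc))

end Lift

/-! ### Density: every presheaf is a colimit of representables. -/

section Yoneda

variable {V : Type u} [Category.{v} V] [MonoidalCategory V] [SymmetricCategory V]
  [MonoidalClosed V] [HasLimits V]
variable {B : Type w} [EnrichedCategory V B] [VSmall V B]

/-- The canonical cocone exhibiting `φ` as the colimit `φ * Y`. -/
def yonedaCocone (φ : EnrichedFunctor V Bᵒᵖ V) :
    WeightedCocone φ (enrichedYoneda (V := V) (B := B)) :=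
  weightedCoconeMk φ (yonedaMk φ) fun x y => by
    have h : (x ⟶[V] y) ◁ yonedaMk φ y ≫ yonedaMap x y ▷ _ ≫ eComp V (homTo x) (homTo y) φ =
        pact φ x y ≫ yonedaMk φ x := by
      -- Both sides land in a presheaf hom out of a representable, where inserting evaluation at the
      -- identity followed by its inverse reduces the claim to elements of `φ`.
      rw [← Category.comp_id (eComp V (homTo x) (homTo y) φ), ← yonedaEv_yonedaMk φ x,
        reassoc_of% yonedaMap_comp_yonedaEv, reassoc_of% yonedaMk_homToEv]
    exact h

/-- Naturality of the Yoneda isomorphism in the presheaf. -/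
lemma comp_yonedaEv (F G : EnrichedFunctor V Bᵒᵖ V) (b : B) :
    eComp V (homTo b) F G ≫ yonedaEv G b = yonedaEv F b ▷ _ ≫ ev F G b := by
  rw [yonedaEv, leftUnitor_inv_naturality_assoc, whisker_exchange_assoc, comp_homToEv, yonedaEv]
  simp

/-- Evaluation at identities turns a cone `φ x ⊗ T ⟶ [Bᵒᵖ,V](Yx,F)` into a natural family `φ x ⊗ T ⟶
F x`, which is the same as a morphism `T ⟶ [Bᵒᵖ,V](φ,F)`. -/
lemma yonedaCocone_isColimit (φ : EnrichedFunctor V Bᵒᵖ V) : (yonedaCocone φ).IsColimit := by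
  rw [WeightedCocone.isColimit_iff_existsUnique]
  intro F T (k : ∀ x, _ ⟶ (homTo (V := V) x ⟶[V] F)) hk
  suffices h : ∃! t : T ⟶ (φ ⟶[V] F), ∀ x : B,
      yonedaMk φ x ▷ T ≫ _ ◁ t ≫ eComp V (homTo x) φ F = k x from h
  replace hk (x y : B) : (x ⟶[V] y) ◁ k y ≫ yonedaMap x y ▷ _ ≫ eComp V (homTo x) (homTo y) F =
      (α_ _ _ _).inv ≫ pact φ x y ▷ T ≫ k x := hk x y
  have key (t : T ⟶ (φ ⟶[V] F)) (x : B) :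
      (yonedaMk φ x ▷ T ≫ _ ◁ t ≫ eComp V (homTo x) φ F) ≫ yonedaEv F x =
        φ.obj (op x) ◁ t ≫ ev φ F x := by
    rw [Category.assoc, Category.assoc, comp_yonedaEv, whisker_exchange_assoc,
      ← comp_whiskerRight_assoc, yonedaMk_yonedaEv, id_whiskerRight, Category.id_comp]
  -- Equations between families may therefore be checked after evaluation.
  have hm (x : B) : Mono (yonedaEv F x) := mono_of_mono_fac (yonedaEv_yonedaMk F x)
  have hk' : IsPresheafFamily φ F fun x => k x ≫ yonedaEv F x := fun x y => by
    have h := hk x y =≫ yonedaEv F x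
    simp only [Category.assoc] at h
    rw [yonedaMap_comp_yonedaEv, ← yonedaEv_pact] at h
    rw [MonoidalCategory.whiskerLeft_comp_assoc]
    exact h
  refine ⟨presheafMk φ F _ hk', fun x => ?_, fun s hs => ev_ext fun x => ?_⟩
  · rw [← cancel_mono (yonedaEv F x), key, presheafMk_ev]
  · rw [presheafMk_ev, ← key, hs]

end Yoneda

/-! ### Weighted colimits in `V` as coends. -/

section ColimitsInBase

variable {V : Type u} [Category.{v} V] [MonoidalCategory V] [SymmetricCategory V]
  [MonoidalClosed V]

/-- Composition in `V`, in terms of transposes. -/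
lemma uncurry_tensorHom_eComp {X Y Z P Q : V} (f : P ⟶ (ihom X).obj Y) (g : Q ⟶ (ihom Y).obj Z) :
    MonoidalClosed.uncurry ((f ⊗ₘ g) ≫ eComp V X Y Z) =
      (α_ _ _ _).inv ≫ MonoidalClosed.uncurry f ▷ Q ≫ MonoidalClosed.uncurry g := by
  rw [MonoidalClosed.uncurry_natural_left, MonoidalClosed.enrichedCategorySelf_comp,
    MonoidalClosed.comp_eq, MonoidalClosed.uncurry_curry, tensorHom_compTranspose]

variable [HasLimits V] {K : Type w} [EnrichedCategory V K] [VSmall V K]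

/-- The universal property of a colimit in `V`. -/
lemma WeightedCocone.IsColimit.existsUnique_desc {φ : EnrichedFunctor V Kᵒᵖ V}
    {S : EnrichedFunctor V K V} {c : WeightedCocone φ S} (hc : c.IsColimit) {Z : V}
    (k : ∀ x : K, S.obj x ⊗ φ.obj (op x) ⟶ Z)
    (hk : ∀ x y : K, act S x y ▷ φ.obj (op y) ≫ k y =
      (α_ _ _ _).hom ≫ S.obj x ◁ pact φ x y ≫ k x) :
    ∃! t : c.pt ⟶ Z, ∀ x : K, MonoidalClosed.uncurry (c.ι (op x)) ≫ t = k x := by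
  have key (x : K) (t : 𝟙_ V ⟶ (ihom c.pt).obj Z) :
      c.ι (op x) ▷ 𝟙_ V ≫ _ ◁ t ≫ eComp V (S.obj x) c.pt Z =
        (ρ_ _).hom ≫ MonoidalClosed.curry (k x) ↔
      MonoidalClosed.uncurry (c.ι (op x)) ≫ (ρ_ _).inv ≫ MonoidalClosed.uncurry t = k x := by
    rw [← MonoidalCategory.tensorHom_def_assoc, ← Iso.inv_comp_eq,
      ← MonoidalClosed.uncurry_injective.eq_iff, MonoidalClosed.uncurry_curry,
      MonoidalClosed.uncurry_natural_left, uncurry_tensorHom_eComp]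
    simp
  -- Testing at `T = 𝟙_ V` suffices, since morphisms `𝟙_ V ⟶ [c,Z]` are the transposes of morphisms
  -- `c ⟶ Z`, up to a unitor.
  obtain ⟨t, ht, hu⟩ := c.isColimit_iff_existsUnique.1 hc Z (𝟙_ V)
    (fun x => (ρ_ _).hom ≫ MonoidalClosed.curry (k x)) fun x y => by
      apply MonoidalClosed.uncurry_injective
      have h : MonoidalClosed.uncurry (S.map x y) = act S x y := rfl
      have h' := hk x y
      simp only [MonoidalCategory.whiskerLeft_comp_assoc]
      rw [← MonoidalCategory.tensorHom_def'_assoc, MonoidalClosed.uncurry_natural_left,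
        uncurry_tensorHom_eComp, MonoidalClosed.uncurry_curry, h, h']
      rw [← Category.assoc (pact φ x y ▷ _), ← Category.assoc, MonoidalClosed.uncurry_natural_left,
        MonoidalClosed.uncurry_natural_left, MonoidalClosed.uncurry_curry]
      simp
  refine ⟨(ρ_ _).inv ≫ MonoidalClosed.uncurry t, fun x => (key x t).1 (ht x), fun s hs => ?_⟩
  rw [Iso.eq_inv_comp, ← hu (MonoidalClosed.curry ((ρ_ _).hom ≫ s)) fun x => (key x _).2 ?_,
    MonoidalClosed.uncurry_curry]
  rw [MonoidalClosed.uncurry_curry, Iso.inv_hom_id_assoc, hs]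

end ColimitsInBase

open MonoidalCategory Opposite VModule

/-! ### The tensor product of a presheaf with a module `B ⇸ 𝓘`. -/

section Tensor

variable {V : Type u} [Category.{v} V] [MonoidalCategory V] [SymmetricCategory V]
  [MonoidalClosed V] [HasColimits V]
variable {B : Type w} [EnrichedCategory V B] [VSmall V B]

/-- The coend `∫^x r(x) ⊗ F x` of a presheaf `F` and a module `r : B ⇸ 𝓘`. -/
def tensorObj (F : EnrichedFunctor V Bᵒᵖ V) (r : VModule V B UnitObj.{w}) : V :=
  coend (presheafModule F) r UnitObj.star UnitObj.star

/-- The family `r(x) ⊗ F x ⟶ Z` is dinatural in `x`. -/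
def IsTensorFamily (F : EnrichedFunctor V Bᵒᵖ V) (r : VModule V B UnitObj.{w}) {Z : V}
    (k : ∀ x : B, r.obj UnitObj.star x ⊗ F.obj (op x) ⟶ Z) : Prop :=
  ∀ x y : B, r.ract UnitObj.star x y ▷ F.obj (op y) ≫ k y =
    (α_ _ _ _).hom ≫ r.obj UnitObj.star x ◁ pact F x y ≫ k x

/-- The universal dinatural family `r(x) ⊗ F x ⟶ ∫^x r(x) ⊗ F x`. -/
def tensorι (F : EnrichedFunctor V Bᵒᵖ V) (r : VModule V B UnitObj.{w}) (x : B) :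
    r.obj UnitObj.star x ⊗ F.obj (op x) ⟶ tensorObj F r :=
  κ (presheafModule F) r UnitObj.star UnitObj.star x

lemma tensorι_isTensorFamily (F : EnrichedFunctor V Bᵒᵖ V) (r : VModule V B UnitObj.{w}) :
    IsTensorFamily F r (tensorι F r) :=
  κ_balanced (presheafModule F) r UnitObj.star UnitObj.star

/-- The morphism out of `∫^x r(x) ⊗ F x` given by a dinatural family. -/
def tensorDesc (F : EnrichedFunctor V Bᵒᵖ V) (r : VModule V B UnitObj.{w}) {Z : V}
    (k : ∀ x : B, r.obj UnitObj.star x ⊗ F.obj (op x) ⟶ Z) (hk : IsTensorFamily F r k) :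
    tensorObj F r ⟶ Z :=
  desc (presheafModule F) r UnitObj.star UnitObj.star k hk

lemma tensorι_desc (F : EnrichedFunctor V Bᵒᵖ V) (r : VModule V B UnitObj.{w}) {Z : V}
    (k : ∀ x : B, r.obj UnitObj.star x ⊗ F.obj (op x) ⟶ Z) (hk : IsTensorFamily F r k) (x : B) :
    tensorι F r x ≫ tensorDesc F r k hk = k x :=
  κ_desc (presheafModule F) r UnitObj.star UnitObj.star k hk x

lemma tensor_ext {F : EnrichedFunctor V Bᵒᵖ V} {r : VModule V B UnitObj.{w}} {Z : V}
    {s t : tensorObj F r ⟶ Z} (h : ∀ x, tensorι F r x ≫ s = tensorι F r x ≫ t) : s = t :=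
  coend_ext h

lemma tensor_extR {F : EnrichedFunctor V Bᵒᵖ V} {r : VModule V B UnitObj.{w}} {W Z : V}
    {s t : tensorObj F r ⊗ W ⟶ Z} (h : ∀ x, tensorι F r x ▷ W ≫ s = tensorι F r x ▷ W ≫ t) :
    s = t :=
  coend_extR h

/-- The morphism out of `(∫^x r(x) ⊗ F x) ⊗ W` given by a dinatural family. -/
lemma exists_tensorDescR (F : EnrichedFunctor V Bᵒᵖ V) (r : VModule V B UnitObj.{w}) {W Z : V}
    (k : ∀ x : B, (r.obj UnitObj.star x ⊗ F.obj (op x)) ⊗ W ⟶ Z)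
    (hk : ∀ x y : B, r.ract UnitObj.star x y ▷ F.obj (op y) ▷ W ≫ k y =
      (α_ _ _ _).hom ▷ W ≫ (r.obj UnitObj.star x ◁ pact F x y) ▷ W ≫ k x) :
    ∃ d : tensorObj F r ⊗ W ⟶ Z, ∀ x, tensorι F r x ▷ W ≫ d = k x :=
  ⟨descR (presheafModule F) r UnitObj.star UnitObj.star W k hk, fun x =>
    κ_descR (presheafModule F) r UnitObj.star UnitObj.star W k hk x⟩

end Tensor

/-! ### The comparison from the tensor product to `{φ,-}`. -/

section Pairing

variable {V : Type u} [Category.{v} V] [MonoidalCategory V] [SymmetricCategory V]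
  [MonoidalClosed V] [HasColimits V]
variable {B : Type w} [EnrichedCategory V B] [VSmall V B]
variable {φ : EnrichedFunctor V Bᵒᵖ V} {r : VModule V B UnitObj.{w}}

/-- The morphism `φ b ⊗ r(x) ⟶ B(b,x)` given by a 2-cell `φ̄ ∘ r ⟶ 1`. -/
def pairing (ε : composite r (presheafModule φ) ⟶ unit V B) (b x : B) :
    φ.obj (op b) ⊗ r.obj UnitObj.star x ⟶ (b ⟶[V] x) :=
  κ r (presheafModule φ) b x UnitObj.star ≫ ε.app b x

/-- Of the two compatibilities of the counit with `B`, this one makes the induced families natural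
in `b`; `pairing_ract` makes them dinatural in `x`. -/
lemma pairing_lact (ε : composite r (presheafModule φ) ⟶ unit V B) (b b' x : B) :
    (b ⟶[V] b') ◁ pairing ε b' x ≫ eComp V b b' x =
      (α_ _ _ _).inv ≫ pact φ b b' ▷ _ ≫ pairing ε b x := by
  have h := ε.lact_app b b' x
  have h' := κ_compLact_assoc r (presheafModule φ) b b' x UnitObj.star (ε.app b x)
  exact (MonoidalCategory.whiskerLeft_comp_assoc _ (κ r (presheafModule φ) b' x UnitObj.star)
    (ε.app b' x) _).trans ((_ ≫= h.symm).trans h')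

lemma pairing_ract (ε : composite r (presheafModule φ) ⟶ unit V B) (b x y : B) :
    φ.obj (op b) ◁ r.ract UnitObj.star x y ≫ pairing ε b y =
      (α_ _ _ _).inv ≫ pairing ε b x ▷ _ ≫ eComp V b x y := by
  have h := ε.ract_app b x y
  have h' := κ_compRact_assoc r (presheafModule φ) b x y UnitObj.star (ε.app b y)
  exact (Iso.eq_inv_comp _).2 (h'.symm.trans ((_ ≫= h).trans
    (comp_whiskerRight_assoc (κ r (presheafModule φ) b x UnitObj.star) (ε.app b x) _ _).symm))

variable [HasLimits V]

lemma pairing_isPresheafFamily (ε : composite r (presheafModule φ) ⟶ unit V B)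
    (F : EnrichedFunctor V Bᵒᵖ V) (x : B) :
    IsPresheafFamily φ F fun b => (α_ _ (r.obj UnitObj.star x) _).inv ≫
      pairing ε b x ▷ F.obj (op x) ≫ pact F b x := by
  intro b b'
  have h := pairing_lact ε b b' x
  have h₂ : (b ⟶[V] b') ◁ pact F b' x ≫ pact F b b' =
      (α_ _ _ _).inv ≫ eComp V b b' x ▷ F.obj (op x) ≫ pact F b x := by
    rw [pact_comp, Iso.inv_hom_id_assoc]
  simp only [MonoidalCategory.whiskerLeft_comp, Category.assoc]
  rw [h₂, associator_inv_naturality_middle_assoc, ← comp_whiskerRight_assoc _ (eComp V b b' x), h]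
  simp

/-- The morphism `r(x) ⊗ F x ⟶ [Bᵒᵖ,V](φ,F)` given by `φ b ⊗ r(x) ⊗ F x ⟶ B(b,x) ⊗ F x ⟶ F b`. -/
def homDesc (ε : composite r (presheafModule φ) ⟶ unit V B) (F : EnrichedFunctor V Bᵒᵖ V) (x : B) :
    r.obj UnitObj.star x ⊗ F.obj (op x) ⟶ (φ ⟶[V] F) :=
  presheafMk φ F _ (pairing_isPresheafFamily ε F x)

lemma homDesc_ev (ε : composite r (presheafModule φ) ⟶ unit V B) (F : EnrichedFunctor V Bᵒᵖ V)
    (x b : B) : φ.obj (op b) ◁ homDesc ε F x ≫ ev φ F b =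
      (α_ _ _ _).inv ≫ pairing ε b x ▷ F.obj (op x) ≫ pact F b x :=
  presheafMk_ev φ F _ (pairing_isPresheafFamily ε F x) b

/-- By `pairing_ract`, the action of `B(x,y)` on `r` becomes a composition in `B`, which
associativity of the action on `F` passes on to `F y`. -/
lemma homDesc_isTensorFamily (ε : composite r (presheafModule φ) ⟶ unit V B)
    (F : EnrichedFunctor V Bᵒᵖ V) : IsTensorFamily F r (homDesc ε F) := by
  intro x y
  refine ev_ext fun b => ?_
  have h := pairing_ract ε b x y
  simp only [MonoidalCategory.whiskerLeft_comp, Category.assoc]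
  rw [homDesc_ev, homDesc_ev, associator_inv_naturality_middle_assoc, ← comp_whiskerRight_assoc, h]
  simp only [comp_whiskerRight, Category.assoc]
  rw [pact_comp, associator_inv_naturality_right_assoc, whisker_exchange_assoc]
  simp

/-- `V`-naturality of the comparison in `F`, read on one coend injection. It holds because
evaluating a morphism of presheaves commutes with the action of `B`. -/
lemma homDesc_comp (ε : composite r (presheafModule φ) ⟶ unit V B)
    (F G : EnrichedFunctor V Bᵒᵖ V) (x : B) :
    homDesc ε F x ▷ _ ≫ eComp V φ F G =
      (α_ _ _ _).hom ≫ r.obj UnitObj.star x ◁ ev F G x ≫ homDesc ε G x := by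
  refine ev_ext fun b => ?_
  simp only [MonoidalCategory.whiskerLeft_comp, Category.assoc]
  have h : (b ⟶[V] x) ◁ ev F G x ≫ pact G b x = _ := ev_isPresheafFamily F G b x
  rw [comp_ev, homDesc_ev, associator_inv_naturality_middle_assoc, ← comp_whiskerRight_assoc,
    homDesc_ev, associator_inv_naturality_right_assoc, whisker_exchange_assoc, h]
  simp

/-- The comparison `∫^x r(x) ⊗ F x ⟶ [Bᵒᵖ,V](φ,F)`. -/
def tensorToHom (ε : composite r (presheafModule φ) ⟶ unit V B) (F : EnrichedFunctor V Bᵒᵖ V) :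
    tensorObj F r ⟶ (φ ⟶[V] F) :=
  tensorDesc F r (homDesc ε F) (homDesc_isTensorFamily ε F)

lemma tensorι_tensorToHom (ε : composite r (presheafModule φ) ⟶ unit V B)
    (F : EnrichedFunctor V Bᵒᵖ V) (x : B) :
    tensorι F r x ≫ tensorToHom ε F = homDesc ε F x :=
  tensorι_desc ..

/-- The composite occurring in the left triangle identity is an evaluation. -/
lemma counitLeft_presheafModule (ε : composite r (presheafModule φ) ⟶ unit V B) (b : B) :
    counitLeft (presheafModule φ) r ε b UnitObj.star UnitObj.star =
      φ.obj (op b) ◁ tensorToHom ε φ ≫ ev φ φ b := by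
  refine coend_extL fun x => (κ_counitLeft (presheafModule φ) r ε b _ _ x).trans ?_
  have h : φ.obj (op b) ◁ tensorι φ r x ≫ φ.obj (op b) ◁ tensorToHom ε φ ≫ ev φ φ b =
      (α_ _ _ _).inv ≫ pairing ε b x ▷ φ.obj (op x) ≫ pact φ b x := by
    rw [← MonoidalCategory.whiskerLeft_comp_assoc, tensorι_tensorToHom, homDesc_ev]
  exact h.symm

/-- The counit half of the right triangle, specialised to the unit category: pair the `φ` factor
with `r(b)`, then act on the remaining factor of `r`. -/
lemma exists_counitRight (ε : composite r (presheafModule φ) ⟶ unit V B) (b : B) :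
    ∃ d : tensorObj φ r ⊗ r.obj UnitObj.star b ⟶ r.obj UnitObj.star b,
      d = counitRight (presheafModule φ) r ε UnitObj.star UnitObj.star b ∧
      ∀ x, tensorι φ r x ▷ _ ≫ d =
        (α_ _ _ _).hom ≫ r.obj UnitObj.star x ◁ pairing ε x b ≫ r.ract UnitObj.star x b :=
  ⟨_, rfl, fun x => κ_counitRight (presheafModule φ) r ε _ _ b x⟩

/-- The unit and counit of an adjunction `φ̄ ⊣ r` make the comparison invertible. -/
theorem isIso_tensorToHom (ε : composite r (presheafModule φ) ⟶ unit V B)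
    (η : 𝟙_ V ⟶ tensorObj φ r)
    (h₁ : η ≫ tensorToHom ε φ = eId V φ)
    (h₂ : ∀ b, η ▷ r.obj UnitObj.star b ≫
      counitRight (presheafModule φ) r ε UnitObj.star UnitObj.star b = (λ_ _).hom)
    (F : EnrichedFunctor V Bᵒᵖ V) : IsIso (tensorToHom ε F) := by
  -- `d` is the functoriality of the tensor product with `r`: it applies an element of
  -- `[Bᵒᵖ,V](φ,F)` to the `φ` factor.
  obtain ⟨d, hd⟩ := exists_tensorDescR φ r (W := (φ ⟶[V] F)) (Z := tensorObj F r)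
    (fun x => (α_ _ _ _).hom ≫ r.obj UnitObj.star x ◁ ev φ F x ≫ tensorι F r x) (fun x y => by
      have h := tensorι_isTensorFamily F r x y
      have h' := ev_isPresheafFamily φ F x y
      rw [associator_naturality_left_assoc, ← whisker_exchange_assoc, h,
        associator_naturality_middle_assoc]
      simp only [tensor_whiskerLeft, Category.assoc, Iso.inv_hom_id_assoc]
      rw [← MonoidalCategory.whiskerLeft_comp_assoc _ _ (pact F x y), h']
      simp)
  -- The inverse inserts `η` and then transports it along the given element of `[Bᵒᵖ,V](φ,F)`.
  refine ⟨(λ_ _).inv ≫ η ▷ _ ≫ d, tensor_ext fun x => ?_, ?_⟩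
  · obtain ⟨e, he, he'⟩ := exists_counitRight ε x
    have h₃ : η ▷ r.obj UnitObj.star x ≫ e = (λ_ _).hom := he ▸ h₂ x
    -- Dinaturality moves the element of `B(y,x)` produced by the pairing from `F x` to `r(y)`. What
    -- is left is the counit half of the right triangle, which `η` cancels by `h₂`.
    have key : tensorObj φ r ◁ homDesc ε F x ≫ d =
        (α_ _ _ _).inv ≫ e ▷ F.obj (op x) ≫ tensorι F r x := tensor_extR fun y => by
      have h := tensorι_isTensorFamily F r y x
      rw [← whisker_exchange_assoc, hd, associator_inv_naturality_left_assoc,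
        ← comp_whiskerRight_assoc, he', tensor_whiskerLeft_assoc, Iso.inv_hom_id_assoc,
        ← MonoidalCategory.whiskerLeft_comp_assoc, homDesc_ev]
      simp [h]
    rw [reassoc_of% tensorι_tensorToHom, leftUnitor_inv_naturality_assoc, whisker_exchange_assoc,
      key, associator_inv_naturality_left_assoc, ← comp_whiskerRight_assoc, h₃]
    simp
  -- By naturality `d` followed by the comparison is composition with an element of `[Bᵒᵖ,V](φ,φ)`;
  -- `h₁` makes that element the identity.
  · have key : d ≫ tensorToHom ε F = tensorToHom ε φ ▷ _ ≫ eComp V φ φ F :=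
      tensor_extR fun x => by
        rw [reassoc_of% hd, tensorι_tensorToHom, ← comp_whiskerRight_assoc, tensorι_tensorToHom,
          homDesc_comp]
    rw [Category.assoc, Category.assoc, key, ← comp_whiskerRight_assoc, h₁, e_id_comp]

end Pairing

open MonoidalCategory Opposite VModule

/-! ### The presheaf `[r(-),Z]`. -/

section CoHom

variable {V : Type u} [Category.{v} V] [MonoidalCategory V] [SymmetricCategory V]
  [MonoidalClosed V]
variable {B : Type w} [EnrichedCategory V B]

/-- The `V`-functor `B ⥤ V` underlying a module `B ⇸ 𝓘`. -/
def moduleFunctor (r : VModule V B UnitObj.{w}) : EnrichedFunctor V B V :=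
  ofAct (r.obj UnitObj.star) (r.ract UnitObj.star) (r.ract_id UnitObj.star)
    (r.ract_comp UnitObj.star)

/-- The presheaf `[r(-),Z] : Bᵒᵖ ⥤ V`. -/
def coHom (r : VModule V B UnitObj.{w}) (Z : V) : EnrichedFunctor V Bᵒᵖ V :=
  homAlong (moduleFunctor r) Z

/-- The evaluation `r(x) ⊗ [r(x),Z] ⟶ Z`. -/
def coHomEv (r : VModule V B UnitObj.{w}) (Z : V) (x : B) :
    r.obj UnitObj.star x ⊗ (coHom r Z).obj (op x) ⟶ Z :=
  (ihom.ev (r.obj UnitObj.star x)).app Z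

/-- The transpose `T ⟶ [r(x),Z]` of a morphism `r(x) ⊗ T ⟶ Z`. -/
def coHomMk (r : VModule V B UnitObj.{w}) {Z T : V} {x : B}
    (k : r.obj UnitObj.star x ⊗ T ⟶ Z) : T ⟶ (coHom r Z).obj (op x) :=
  MonoidalClosed.curry k

lemma coHomMk_ev (r : VModule V B UnitObj.{w}) {Z T : V} {x : B}
    (k : r.obj UnitObj.star x ⊗ T ⟶ Z) :
    r.obj UnitObj.star x ◁ coHomMk r k ≫ coHomEv r Z x = k :=
  (MonoidalClosed.uncurry_eq _).symm.trans (MonoidalClosed.uncurry_curry k)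

lemma coHom_ext {r : VModule V B UnitObj.{w}} {Z T : V} {x : B}
    {s t : T ⟶ (coHom r Z).obj (op x)}
    (h : r.obj UnitObj.star x ◁ s ≫ coHomEv r Z x = r.obj UnitObj.star x ◁ t ≫ coHomEv r Z x) :
    s = t :=
  MonoidalClosed.uncurry_injective
    ((MonoidalClosed.uncurry_eq _).trans (h.trans (MonoidalClosed.uncurry_eq _).symm))

/-- `B` acts on `[r(-),Z]` by precomposition with its action on `r`. Hence the evaluations form a
dinatural family, which will give the counit of tensoring with `r` against `[r(-),-]`. -/
lemma pact_coHomEv (r : VModule V B UnitObj.{w}) (Z : V) (x y : B) :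
    r.obj UnitObj.star x ◁ pact (coHom r Z) x y ≫ coHomEv r Z x =
      (α_ _ _ _).inv ≫ r.ract UnitObj.star x y ▷ _ ≫ coHomEv r Z y := by
  have h := pact_homAlong (moduleFunctor r) Z x y
  have h₁ : MonoidalClosed.uncurry ((moduleFunctor r).map x y) = r.ract UnitObj.star x y :=
    act_ofAct ..
  have h₂ := uncurry_tensorHom_eComp ((moduleFunctor r).map x y)
    (𝟙 ((ihom ((moduleFunctor r).obj y)).obj Z))
  rw [MonoidalCategory.tensorHom_id, MonoidalClosed.uncurry_id_eq_ev] at h₂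
  exact (MonoidalClosed.uncurry_eq _).symm.trans ((congrArg MonoidalClosed.uncurry h).trans
    (h₂.trans (congrArg (fun t => (α_ _ _ _).inv ≫ t ▷ _ ≫ coHomEv r Z y) h₁)))

lemma coHomEv_isTensorFamily (r : VModule V B UnitObj.{w}) (Z : V) :
    IsTensorFamily (coHom r Z) r (coHomEv r Z) := fun x y => by
  rw [pact_coHomEv, Iso.hom_inv_id_assoc]

end CoHom

/-! ### When the comparison is invertible, `{φ,-}` is cocontinuous. -/

section Cocontinuity

variable {V : Type u} [Category.{v} V] [MonoidalCategory V] [SymmetricCategory V]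
  [MonoidalClosed V] [HasColimits V] [HasLimits V]
variable {B : Type w} [EnrichedCategory V B] [VSmall V B]
variable {φ : EnrichedFunctor V Bᵒᵖ V} {r : VModule V B UnitObj.{w}}

lemma uncurry_weightedHom_map (φ F G : EnrichedFunctor V Bᵒᵖ V) :
    MonoidalClosed.uncurry ((weightedHom φ).map F G) = eComp V φ F G :=
  MonoidalClosed.uncurry_curry _

variable (ε : composite r (presheafModule φ) ⟶ unit V B) [∀ F, IsIso (tensorToHom ε F)]

/-- The morphism `[Bᵒᵖ,V](φ,[r(-),Z]) ⟶ Z` induced by the evaluations. -/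
def homCoHomEv (Z : V) : (φ ⟶[V] coHom r Z) ⟶ Z :=
  inv (tensorToHom ε (coHom r Z)) ≫ tensorDesc _ r (coHomEv r Z) (coHomEv_isTensorFamily r Z)

lemma homDesc_homCoHomEv (Z : V) (x : B) :
    homDesc ε (coHom r Z) x ≫ homCoHomEv ε Z = coHomEv r Z x := by
  rw [← tensorι_tensorToHom, homCoHomEv, Category.assoc, IsIso.hom_inv_id_assoc, tensorι_desc]

/-- The coend injections stay jointly epic after tensoring with `W`, and so they do when followed by
the invertible comparison. -/
lemma homDesc_ext {F : EnrichedFunctor V Bᵒᵖ V} {W Z : V} {s t : (φ ⟶[V] F) ⊗ W ⟶ Z}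
    (h : ∀ x, homDesc ε F x ▷ W ≫ s = homDesc ε F x ▷ W ≫ t) : s = t := by
  rw [← cancel_epi (tensorToHom ε F ▷ W)]
  refine tensor_extR fun x => ?_
  rw [← comp_whiskerRight_assoc, ← comp_whiskerRight_assoc, tensorι_tensorToHom, h]

/-- Dinaturality of `homDesc` trades the action on `F` for the action on `r`, which is how `B` acts
on `[r(-),Z]`. -/
lemma coHomMk_isPresheafFamily (F : EnrichedFunctor V Bᵒᵖ V) (Z : V) :
    IsPresheafFamily F (coHom r Z) fun x => coHomMk r ((α_ _ _ _).inv ≫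
      homDesc ε F x ▷ (ihom (φ ⟶[V] F)).obj Z ≫ (ihom.ev (φ ⟶[V] F)).app Z) := by
  intro x y
  refine coHom_ext ?_
  have h := homDesc_isTensorFamily ε F x y
  simp only [MonoidalCategory.whiskerLeft_comp, Category.assoc]
  rw [pact_coHomEv, associator_inv_naturality_right_assoc, whisker_exchange_assoc, coHomMk_ev,
    coHomMk_ev, associator_inv_naturality_left_assoc, ← comp_whiskerRight_assoc, h]
  simp

/-- The forward map of `homCoHomIso`, on an element of `r(x) ⊗ F x`, is two successive evaluations;
both inverse laws rest on this. -/
lemma homDesc_comp_homCoHomEv (F : EnrichedFunctor V Bᵒᵖ V) (Z : V) (x : B) :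
    homDesc ε F x ▷ _ ≫ eComp V φ F (coHom r Z) ≫ homCoHomEv ε Z =
      (α_ _ _ _).hom ≫ r.obj UnitObj.star x ◁ ev F (coHom r Z) x ≫ coHomEv r Z x := by
  rw [reassoc_of% homDesc_comp, homDesc_homCoHomEv]

/-- The isomorphism `[Bᵒᵖ,V](F,[r(-),Z]) ≅ [[Bᵒᵖ,V](φ,F),Z]`. -/
def homCoHomIso (F : EnrichedFunctor V Bᵒᵖ V) (Z : V) :
    (F ⟶[V] coHom r Z) ≅ (ihom (φ ⟶[V] F)).obj Z where
  hom := MonoidalClosed.curry (eComp V φ F (coHom r Z) ≫ homCoHomEv ε Z)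
  inv := presheafMk F (coHom r Z) _ (coHomMk_isPresheafFamily ε F Z)
  hom_inv_id := ev_ext fun x => by
    rw [MonoidalCategory.whiskerLeft_comp_assoc, presheafMk_ev]
    refine coHom_ext ?_
    rw [MonoidalCategory.whiskerLeft_comp_assoc, coHomMk_ev, associator_inv_naturality_right_assoc,
      whisker_exchange_assoc, ← MonoidalClosed.uncurry_eq, MonoidalClosed.uncurry_curry,
      homDesc_comp_homCoHomEv]
    simp
  inv_hom_id := MonoidalClosed.uncurry_injective (homDesc_ext ε fun x => by
    rw [MonoidalClosed.uncurry_natural_left, MonoidalClosed.uncurry_curry,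
      ← whisker_exchange_assoc, homDesc_comp_homCoHomEv, MonoidalClosed.uncurry_id_eq_ev,
      tensor_whiskerLeft_assoc, Iso.inv_hom_id_assoc, ← MonoidalCategory.whiskerLeft_comp_assoc,
      presheafMk_ev, coHomMk_ev, Iso.hom_inv_id_assoc])

/-- The presheaf `[{φ,-},Z]` is represented by `[r(-),Z]`. Since the isomorphism is composition
followed by a fixed map to `Z`, its naturality is associativity of composition in the presheaf
category. -/
theorem preservesWeightedColimit_weightedHom
    (ε : composite r (presheafModule φ) ⟶ unit V B) (hε : ∀ F, IsIso (tensorToHom ε F)) {K : Type w₁} [EnrichedCategory V K] [VSmall V K]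
    (θ : EnrichedFunctor V Kᵒᵖ V) (S : EnrichedFunctor V K (EnrichedFunctor V Bᵒᵖ V)) :
    PreservesWeightedColimit θ S (weightedHom φ) := by
  refine preservesWeightedColimit_of_representable (weightedHom φ) (coHom r) (homCoHomIso ε)
    (fun F G Z => ?_) θ S
  apply MonoidalClosed.uncurry_injective
  have e₁ : MonoidalClosed.uncurry (eComp V F G (coHom r Z) ≫ (homCoHomIso ε F Z).hom) =
      (φ ⟶[V] F) ◁ eComp V F G (coHom r Z) ≫ eComp V φ F (coHom r Z) ≫ homCoHomEv ε Z :=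
    (MonoidalClosed.uncurry_natural_left _ _).trans (_ ≫= MonoidalClosed.uncurry_curry _)
  have e₂ : MonoidalClosed.uncurry (homCoHomIso ε G Z).hom = eComp V φ G (coHom r Z) ≫
    homCoHomEv ε Z := MonoidalClosed.uncurry_curry _
  have e₃ := (uncurry_tensorHom_eComp ((weightedHom φ).map F G) (homCoHomIso ε G Z).hom).trans
    (congrArg₂ (fun (s : (φ ⟶[V] F) ⊗ (F ⟶[V] G) ⟶ (φ ⟶[V] G))
      (t : (φ ⟶[V] G) ⊗ (G ⟶[V] coHom r Z) ⟶ Z) => (α_ _ _ _).inv ≫ s ▷ _ ≫ t)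
      (uncurry_weightedHom_map φ F G) e₂)
  exact e₁.trans (Eq.trans (e_assoc_assoc V φ F G (coHom r Z) (homCoHomEv ε Z)).symm e₃.symm)

end Cocontinuity

open MonoidalCategory Opposite VModule

/-! ### The candidate right adjoint and the adjunction. -/

section RightAdjoint

variable {V : Type u} [Category.{v} V] [MonoidalCategory V] [SymmetricCategory V]
  [MonoidalClosed V] [HasColimits V] [HasLimits V]
variable {B : Type w} [EnrichedCategory V B] [VSmall V B]

/-- The module `B ⇸ 𝓘` given by `[Bᵒᵖ,V](φ,Y-)`. -/
def dualModule (φ : EnrichedFunctor V Bᵒᵖ V) : VModule V B UnitObj.{w} :=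
  copresheafModule (enrichedYoneda.comp V (weightedHom φ))

lemma dualModule_ract (φ : EnrichedFunctor V Bᵒᵖ V) (x y : B) :
    act (enrichedYoneda.comp V (weightedHom φ)) x y =
      (φ ⟶[V] homTo (V := V) x) ◁ yonedaMap x y ≫ eComp V φ (homTo x) (homTo y) :=
  (MonoidalClosed.uncurry_natural_left _ _).trans
    (_ ≫= uncurry_weightedHom_map φ (homTo x) (homTo y))

/-- The right action of `B` on `[Bᵒᵖ,V](φ,Y-)`, under evaluation. -/
lemma act_evHomTo (φ : EnrichedFunctor V Bᵒᵖ V) (b x y : B) :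
    φ.obj (op b) ◁ (dualModule φ).ract UnitObj.star x y ≫ evHomTo φ y b =
      (α_ _ _ _).inv ≫ evHomTo φ x b ▷ _ ≫ eComp V b x y := by
  obtain ⟨z, h', h''⟩ : ∃ z : (b ⟶[V] x) ⊗ (homTo (V := V) x ⟶[V] homTo (V := V) y) ⟶ (b ⟶[V] y),
      φ.obj (op b) ◁ eComp V φ (homTo x) (homTo y) ≫ evHomTo φ y b =
        (α_ _ _ _).inv ≫ evHomTo φ x b ▷ _ ≫ z ∧
      (b ⟶[V] x) ◁ yonedaMap x y ≫ z = eComp V b x y :=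
    ⟨_, comp_ev_homTo φ (homTo y) x b, yonedaMap_homToEv x y b⟩
  have h : φ.obj (op b) ◁ ((φ ⟶[V] homTo (V := V) x) ◁ yonedaMap x y ≫
      eComp V φ (homTo x) (homTo y)) ≫ evHomTo φ y b =
      (α_ _ _ _).inv ≫ evHomTo φ x b ▷ _ ≫ eComp V b x y := by
    rw [MonoidalCategory.whiskerLeft_comp_assoc, h', associator_inv_naturality_right_assoc,
      whisker_exchange_assoc, h'']
  exact Eq.trans (congrArg (fun t => φ.obj (op b) ◁ t ≫ evHomTo φ y b)
    (dualModule_ract φ x y)) h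

/-- The morphism `∫ φ b ⊗ [Bᵒᵖ,V](φ,Yx) ⟶ B(b,x)` given by evaluation. -/
def dualCounitApp (φ : EnrichedFunctor V Bᵒᵖ V) (b x : B) :
    coend (dualModule φ) (presheafModule φ) b x ⟶ (b ⟶[V] x) :=
  -- This coend runs over the one-object unit category, so dinaturality is the triangle axiom for
  -- the unitors.
  desc (dualModule φ) (presheafModule φ) b x (fun _ => evHomTo φ x b) (fun _ _ => by
    have h : (ρ_ (φ.obj (op b))).hom ▷ _ ≫ evHomTo φ x b =
      (α_ _ _ _).hom ≫ _ ◁ (λ_ _).hom ≫ evHomTo φ x b := by simp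
    exact h)

lemma κ_dualCounitApp (φ : EnrichedFunctor V Bᵒᵖ V) (b x : B) :
    κ (dualModule φ) (presheafModule φ) b x UnitObj.star ≫ dualCounitApp φ b x = evHomTo φ x b := by
  exact κ_desc (dualModule φ) (presheafModule φ) b x (fun _ => evHomTo φ x b) _ UnitObj.star

/-- The evaluation 2-cell `φ̄ ∘ [Bᵒᵖ,V](φ,Y-) ⟶ 1`. -/
def dualCounit (φ : EnrichedFunctor V Bᵒᵖ V) :
    composite (dualModule φ) (presheafModule φ) ⟶ unit V B where
  app b x := dualCounitApp φ b x
  lact_app b b' x := coend_extL fun _ => by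
    refine (κ_compLact_assoc (dualModule φ) (presheafModule φ) b b' x _ _).trans ?_
    refine Eq.trans ?_ (MonoidalCategory.whiskerLeft_comp_assoc (b ⟶[V] b')
      (κ (dualModule φ) (presheafModule φ) b' x UnitObj.star) (dualCounitApp φ b' x) _)
    refine Eq.trans (_ ≫= (_ ≫= κ_dualCounitApp φ b x)) ?_
    refine Eq.trans ?_ (congrArg (fun t => (b ⟶[V] b') ◁ t ≫ eComp V b b' x)
      (κ_dualCounitApp φ b' x).symm)
    exact (evHomTo_nat φ x b b').symm
  ract_app b x y := coend_extR fun _ => by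
    refine (κ_compRact_assoc (dualModule φ) (presheafModule φ) b x y _ _).trans ?_
    refine Eq.trans ?_ (comp_whiskerRight_assoc
      (κ (dualModule φ) (presheafModule φ) b x UnitObj.star) (dualCounitApp φ b x)
      (x ⟶[V] y) _)
    refine Eq.trans (_ ≫= (_ ≫= κ_dualCounitApp φ b y)) ?_
    refine Eq.trans ?_ (congrArg (fun t => t ▷ (x ⟶[V] y) ≫ eComp V b x y)
      (κ_dualCounitApp φ b x).symm)
    exact (Iso.eq_inv_comp _).1 (act_evHomTo φ b x y)

lemma pairing_dualCounit (φ : EnrichedFunctor V Bᵒᵖ V) (b x : B) :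
    pairing (dualCounit φ) b x = evHomTo φ x b :=
  κ_dualCounitApp φ b x

/-- Both sides evaluate to the action of `B(b,x)` on `φ`, by the Yoneda lemma. This recognises the
coend family at `φ` as the image under `{φ,-}` of the cocone `φ * Y`. -/
lemma homDesc_dualCounit (φ : EnrichedFunctor V Bᵒᵖ V) (x : B) :
    homDesc (dualCounit φ) φ x =
      (φ ⟶[V] homTo (V := V) x) ◁ yonedaMk φ x ≫ eComp V φ (homTo x) φ := by
  refine ev_ext fun b => ?_
  refine (homDesc_ev (dualCounit φ) φ x b).trans ?_
  obtain ⟨z, h', h''⟩ : ∃ z : (b ⟶[V] x) ⊗ (homTo (V := V) x ⟶[V] φ) ⟶ φ.obj (op b),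
      φ.obj (op b) ◁ eComp V φ (homTo x) φ ≫ ev φ φ b =
        (α_ _ _ _).inv ≫ evHomTo φ x b ▷ _ ≫ z ∧
      (b ⟶[V] x) ◁ yonedaMk φ x ≫ z = pact φ b x :=
    ⟨_, comp_ev_homTo φ φ x b, yonedaMk_homToEv φ x b⟩
  have h : φ.obj (op b) ◁ ((φ ⟶[V] homTo (V := V) x) ◁ yonedaMk φ x ≫
      eComp V φ (homTo x) φ) ≫ ev φ φ b =
      (α_ _ _ _).inv ≫ evHomTo φ x b ▷ _ ≫ pact φ b x := by
    rw [MonoidalCategory.whiskerLeft_comp_assoc, h', associator_inv_naturality_right_assoc,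
      whisker_exchange_assoc, h'']
  refine Eq.trans ?_ h.symm
  exact congrArg (fun t => (α_ _ _ _).inv ≫ t ▷ φ.obj (op x) ≫ pact φ b x)
    (pairing_dualCounit φ b x)

/-- At a representable, the action used in `homDesc` is composition in `B`, so evaluation cannot
tell the two sides apart. -/
lemma homDesc_dualCounit_homTo (φ : EnrichedFunctor V Bᵒᵖ V) (x b : B) :
    homDesc (dualCounit φ) (homTo b) x = (dualModule φ).ract UnitObj.star x b := by
  refine evHomTo_ext fun y => ?_
  refine (homDesc_ev (dualCounit φ) (homTo b) x y).trans ?_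
  rw [pact_homTo]
  refine Eq.trans ?_ (act_evHomTo φ y x b).symm
  exact congrArg (fun t => (α_ _ _ _).inv ≫ t ▷ (x ⟶[V] b) ≫ eComp V y x b)
    (pairing_dualCounit φ y x)

/-- Naturality of the comparison along morphisms `φ ⟶ B(-,b)`, where its target family is the action
by `homDesc_dualCounit_homTo`. So the right triangle, like the left one, depends on the unit only
through its image in `[Bᵒᵖ,V](φ,φ)`. -/
lemma counitRight_dualCounit (φ : EnrichedFunctor V Bᵒᵖ V) (b : B) :
    counitRight (presheafModule φ) (dualModule φ) (dualCounit φ) UnitObj.star UnitObj.star b =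
      tensorToHom (dualCounit φ) φ ▷ _ ≫ eComp V φ φ (homTo b) := by
  obtain ⟨d, hd, hd'⟩ := exists_counitRight (dualCounit φ) b
  refine hd.symm.trans (tensor_extR fun x => (hd' x).trans ?_)
  have h := homDesc_comp (dualCounit φ) φ (homTo b) x
  rw [homDesc_dualCounit_homTo] at h
  refine Eq.trans (_ ≫= (congrArg (fun t => _ ◁ t ≫ _) (pairing_dualCounit φ x b))) ?_
  refine h.symm.trans ?_
  refine Eq.trans ?_ (comp_whiskerRight_assoc (tensorι φ (dualModule φ) x)
    (tensorToHom (dualCounit φ) φ) (φ ⟶[V] homTo (V := V) b) _)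
  exact congrArg (fun t => t ▷ (φ ⟶[V] homTo (V := V) b) ≫ eComp V φ φ (homTo b))
    (tensorι_tensorToHom (dualCounit φ) φ x).symm

/-- A section of the comparison when `{φ,-}` preserves `φ * Y`. -/
lemma exists_section_tensorToHom {φ : EnrichedFunctor V Bᵒᵖ V}
    (h : PreservesWeightedColimit φ (enrichedYoneda (V := V) (B := B)) (weightedHom φ)) :
    ∃ t : (φ ⟶[V] φ) ⟶ tensorObj φ (dualModule φ), t ≫ tensorToHom (dualCounit φ) φ = 𝟙 _ := by
  have hc := h _ (yonedaCocone_isColimit φ)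
  have hι (x : B) : MonoidalClosed.uncurry (((yonedaCocone φ).map (weightedHom φ)).ι (op x)) =
      homDesc (dualCounit φ) φ x :=
    ((MonoidalClosed.uncurry_natural_left _ _).trans
      (_ ≫= uncurry_weightedHom_map φ (homTo x) φ)).trans (homDesc_dualCounit φ x).symm
  -- The preserved colimit `[Bᵒᵖ,V](φ,φ)` maps to the coend along the coend injections.
  obtain ⟨t, ht, -⟩ := hc.existsUnique_desc (tensorι φ (dualModule φ))
    (tensorι_isTensorFamily φ (dualModule φ))
  -- The composite with the comparison and the identity agree on every colimit injection. Only this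
  -- one-sided inverse is needed for the adjunction.
  refine ⟨t, (hc.existsUnique_desc (homDesc (dualCounit φ) φ)
    (homDesc_isTensorFamily (dualCounit φ) φ)).unique (fun x => ?_) (fun x => ?_)⟩
  · refine (Category.assoc _ _ _).symm.trans ((congrArg (· ≫ _) (ht x)).trans ?_)
    exact tensorι_tensorToHom ..
  · exact (Category.comp_id _).trans (hι x)

/-- The 2-cell `1 ⟶ r ∘ φ̄` given by a morphism `I ⟶ ∫^x r(x) ⊗ φ x`. -/
def unitHom {φ : EnrichedFunctor V Bᵒᵖ V} {r : VModule V B UnitObj.{w}}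
    (η : 𝟙_ V ⟶ tensorObj φ r) : unit V UnitObj.{w} ⟶ composite (presheafModule φ) r where
  app _ _ := η
  lact_app _ _ _ := by
    -- The identity of the unit category is `𝟙 (𝟙_ V)`, so the unit law forces its action on the
    -- composite to be the unitor. Compatibility is then naturality of the unitor.
    obtain ⟨m, hm, h⟩ : ∃ m : 𝟙_ V ⊗ tensorObj φ r ⟶ tensorObj φ r,
        m = compLact (presheafModule φ) r UnitObj.star UnitObj.star UnitObj.star ∧
        𝟙 (𝟙_ V) ▷ tensorObj φ r ≫ m = (λ_ _).hom :=
      ⟨_, rfl, (composite (presheafModule φ) r).id_lact UnitObj.star UnitObj.star⟩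
    rw [id_whiskerRight, Category.id_comp] at h
    exact ((_ ≫= (hm.symm.trans h)).trans (leftUnitor_naturality η)).symm
  ract_app _ _ _ := by
    obtain ⟨m, hm, h⟩ : ∃ m : tensorObj φ r ⊗ 𝟙_ V ⟶ tensorObj φ r,
        m = compRact (presheafModule φ) r UnitObj.star UnitObj.star UnitObj.star ∧
        tensorObj φ r ◁ 𝟙 (𝟙_ V) ≫ m = (ρ_ _).hom :=
      ⟨_, rfl, (composite (presheafModule φ) r).ract_id UnitObj.star UnitObj.star⟩
    rw [MonoidalCategory.whiskerLeft_id, Category.id_comp] at h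
    refine ((_ ≫= (hm.symm.trans h)).trans ((rightUnitor_naturality η).trans ?_)).symm
    -- The unit module acts on `𝟙_ V ⊗ 𝟙_ V` by the left unitor on both sides, while naturality
    -- yields the right one; they coincide.
    exact congrArg (· ≫ η) MonoidalCategory.unitors_equal.symm

/-- The adjunction `φ̄ ⊣ [Bᵒᵖ,V](φ,Y-)` when `{φ,-}` preserves `φ * Y`. -/
theorem nonempty_adjunction {φ : EnrichedFunctor V Bᵒᵖ V}
    (h : PreservesWeightedColimit φ (enrichedYoneda (V := V) (B := B)) (weightedHom φ)) :
    Nonempty (Bicategory.Adjunction (overline φ)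
      (underline (enrichedYoneda.comp V (weightedHom φ)))) := by
  obtain ⟨t, ht⟩ := exists_section_tensorToHom h
  -- The unit is the identity of `φ` carried along the section; this equation gives both triangles.
  have hη : (eId V φ ≫ t) ≫ tensorToHom (dualCounit φ) φ = eId V φ := by
    rw [Category.assoc, ht, Category.comp_id]
  refine ⟨⟨unitHom (r := dualModule φ) (eId V φ ≫ t), dualCounit φ,
    (leftZigzag_eq_iff _ _ _ _).2 fun b _ _ => ?_, (rightZigzag_eq_iff _ _ _ _).2 fun _ _ b => ?_⟩⟩
  · refine (_ ≫= counitLeft_presheafModule (dualCounit φ) b).trans ?_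
    refine (MonoidalCategory.whiskerLeft_comp_assoc _ _ _ _).symm.trans ?_
    refine (congrArg (fun s => φ.obj (op b) ◁ s ≫ ev φ φ b) hη).trans (id_ev φ b)
  · refine (_ ≫= counitRight_dualCounit φ b).trans ?_
    refine (comp_whiskerRight_assoc _ _ _ _).symm.trans ?_
    refine (congrArg (fun s => s ▷ (φ ⟶[V] homTo (V := V) b) ≫ eComp V φ φ (homTo b)) hη).trans ?_
    refine (cancel_epi (λ_ _).inv).1 ((e_id_comp V φ (homTo b)).trans ?_)
    exact (Iso.inv_hom_id (λ_ (φ ⟶[V] homTo (V := V) b))).symm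

/-- If `φ̄` has a right adjoint then `{φ,-}` preserves all weighted colimits. -/
theorem preservesWeightedColimit_of_isLeftAdjoint {φ : EnrichedFunctor V Bᵒᵖ V}
    (h : Bicategory.IsLeftAdjoint (overline φ)) {K : Type w₁} [EnrichedCategory V K] [VSmall V K]
    (θ : EnrichedFunctor V Kᵒᵖ V) (S : EnrichedFunctor V K (EnrichedFunctor V Bᵒᵖ V)) :
    PreservesWeightedColimit θ S (weightedHom φ) := by
  obtain ⟨⟨r, adj⟩⟩ := h
  let ε : composite (r : VModule V B UnitObj.{w}) (presheafModule φ) ⟶ unit V B := adj.counit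
  -- The unit category has one object, so the adjunction unit has just this component.
  let η : 𝟙_ V ⟶ tensorObj φ r := VModule.Hom.app adj.unit UnitObj.star UnitObj.star
  refine preservesWeightedColimit_weightedHom ε (isIso_tensorToHom ε η (ev_ext fun b => ?_)
    fun b => ?_) θ S
  · have h := (leftZigzag_eq_iff _ _ _ _).1 adj.left_triangle b UnitObj.star UnitObj.star
    have h' := (_ ≫= counitLeft_presheafModule ε b).symm.trans h
    refine (MonoidalCategory.whiskerLeft_comp_assoc _ _ _ _).trans (h'.trans (id_ev φ b).symm)
  · have h := (rightZigzag_eq_iff _ _ _ _).1 adj.right_triangle UnitObj.star UnitObj.star b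
    have h' : 𝟙 (𝟙_ V) ▷ VModule.obj r UnitObj.star b ≫
      VModule.lact r UnitObj.star UnitObj.star b = (λ_ _).hom := VModule.id_lact r UnitObj.star b
    rw [id_whiskerRight, Category.id_comp] at h'
    exact h.trans h'

end RightAdjoint

end EnrichedModules

end

/-! ### The equivalence and the formula for the right adjoint. -/

theorem proposition6 {V : Type u} [Category.{v} V] [MonoidalCategory V] [SymmetricCategory V]
    [MonoidalClosed V] [HasLimits V] [HasColimits V]
    {B : Type w} [EnrichedCategory V B] [EnrichedModules.VSmall V B]
    (φ : EnrichedFunctor V Bᵒᵖ V) :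
    List.TFAE
      [Bicategory.IsLeftAdjoint (EnrichedModules.overline φ),
        EnrichedModules.Cocontinuous.{v, u, max w w'} (EnrichedModules.weightedHom φ),
        EnrichedModules.PreservesWeightedColimit φ
          (EnrichedModules.enrichedYoneda (V := V) (B := B)) (EnrichedModules.weightedHom φ)] ∧
    (Bicategory.IsLeftAdjoint (EnrichedModules.overline φ) →
      Nonempty (Bicategory.Adjunction (EnrichedModules.overline φ)
        (EnrichedModules.underline
          (EnrichedModules.enrichedYoneda.comp V (EnrichedModules.weightedHom φ))))) := by
  have h₃₁ (h : EnrichedModules.PreservesWeightedColimit φ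
      (EnrichedModules.enrichedYoneda (V := V) (B := B)) (EnrichedModules.weightedHom φ)) :=
    EnrichedModules.nonempty_adjunction h
  -- The formula for the adjoint comes from passing through (iii), whose proof of (i) constructs
  -- this particular adjunction.
  refine ⟨?_, fun h => h₃₁ (EnrichedModules.preservesWeightedColimit_of_isLeftAdjoint h _ _)⟩
  tfae_have 1 → 2 := fun h _ _ _ θ S =>
    EnrichedModules.preservesWeightedColimit_of_isLeftAdjoint h θ S
  -- The instance `K = B` of cocontinuity, after the change of universe.
  tfae_have 2 → 3 := fun h =>
    EnrichedModules.Cocontinuous.preservesWeightedColimit.{v, u, w, w'} h _ _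
  tfae_have 3 → 1 := fun h => (h₃₁ h).elim fun adj => ⟨⟨_, adj⟩⟩
  tfae_finish
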